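/- **Models.** Let $\lambda=[\lambda_1>\dots>\lambda_p\ge 1]$ be integers, and $\rho=[p,p-1,\dots,1]$. Each of the families $\mathfrak B^\lambda,\mathfrak B_*^\lambda,\mathfrak C^\lambda,\mathfrak C_*^\lambda,\mathfrak D^\lambda$ (with $n=p$ bends) and $\mathfrak{BC}^\lambda$ (with $n=p-1$ bends) is a six-vertex model on a grid whose columns are labelled from right to left up to $\lambda_1$, whose rows are, from top to bottom, $1,\dots,n$, possibly a central row, and $\overline n,\dots,\overline 1$, and in which the right ends of the rows $j$ and $\overline j$ are joined by a bend carrying a bivalent vertex. * $\mathfrak B$: columns $1,\dots,\lambda_1$, no central row. * $\mathfrak B_*$: as $\mathfrak B$, with a central row $0$ whose right end points outward. * $\mathfrak C$: as $\mathfrak B$, with a central row $0$ and, to the right of column $1$, a half column $0$ crossing only the rows $\overline n,\dots,\overline 1$; the right end of row $0$ and the top of column $0$ are joined at a bivalent corner vertex. * $\mathfrak C_*$: as $\mathfrak B$, with such a half column $0$ whose top edge points inward, no central row. * $\mathfrak D$: as $\mathfrak B$, but column $1$ is a half column, crossing only the rows $\overline n,\dots,\overline 1$. * $\mathfrak{BC}$: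 as $\mathfrak B$, with a central row, of index $p=n+1$, whose right end points inward. Admissible states are the orientations of the edges with in-degree equal to out-degree at every vertex (bivalent ones included) such that the left end of every row points inward, the bottom edge of every column points outward, and the top edge of column $k$ points outward if $k$ is a part of $\lambda$ and inward otherwise (this includes column $1$ of $\mathfrak D$; the top of column $0$ of $\mathfrak C$ is not a boundary edge). **Weights.** The six decorations of a tetravalent vertex, named by their two inward edges, have weights $a_1=NW$, $a_2=SE$, $b_1=SW$, $b_2=NE$, $c_1=NS$, $c_2=EW$, depending on the row. A bend has weight $D$ if its arrow runs from row $j$ to row $\overline j$, and $U$ otherwise. The corner vertex of $\mathfrak C$ has weight $R$ if its arrow comes from row $0$, and $L$ otherwise. The partition function $\mathcal Z(\mathfrak M^\lambda)$ is the sum over all admissible states of the product of the weights of all vertices. Let $R_0$ be any commutative ring with an element $i$, $i^2=-1$ (for instance the ring of polynomials over $\mathbb Z[i]$ in the $t$'s and the central $x_\star$ and Laurent polynomials in the remaining $x_j$). Let $t_j\in R_0$, $x_j\in R_0^\times$ for $1\le j\le n$, and $t_\star,x_\star\in R_0$, where $\star=0$ for $\mathfrak B_*,\mathfrak C$ and $\star=p=n+1$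 for $\mathfrak{BC}$. The deformation weights are, in row $j$, $$a_1=a_2=1,\quad b_1=it_jx_j,\quad b_2=it_jx_j^{-1},\quad c_1=1-t_j^2,\quad c_2=1;$$ in row $\overline j$ the same with $a_1,a_2$ exchanged and $b_1,b_2$ exchanged; in the central row $$a_1=a_2=1,\quad b_1=b_2=it_\star x_\star,\quad c_1=1-t_\star^2x_\star^2,\quad c_2=1;$$ and $U=1$; $D=i$ for $\mathfrak B,\mathfrak C$ and $D=1$ for the other families; $R=1$, $L=1+t_0x_0$. **Statement.** Put $P=\prod_{1\le j<k\le n}(1-t_jt_kx_jx_k^{-1})(1-t_jt_kx_jx_k)$. With the deformation weights, in $R_0$, $$\begin{aligned} \prod_{j\le n}(1-t_jx_j)\,P &\;\mid\; \mathcal Z(\mathfrak B^\lambda),\\ \prod_{j\le n}(1-t_0t_jx_0x_j)\,P &\;\mid\; \mathcal Z(\mathfrak B_*^\lambda),\\ \prod_{j\le n}(1-t_jx_j)(1-t_jt_0x_0x_j)\,P &\;\mid\; \mathcal Z(\mathfrak C^\lambda),\\ \prod_{j\le n}(1-t_j^2x_j^2)\,P &\;\mid\; \mathcal Z(\mathfrak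 C_*^\lambda),\\ P &\;\mid\; \mathcal Z(\mathfrak D^\lambda)\quad\text{if } 1\in\lambda,\\ \prod_{j\le n}(1-t_j^2x_j^2)\,P &\;\mid\; \mathcal Z(\mathfrak D^\lambda)\quad\text{if } 1\notin\lambda,\\ \prod_{j\le n}(1-t_{n+1}t_jx_{n+1}x_j)(1-t_j^2x_j^2)\,P &\;\mid\; \mathcal Z(\mathfrak{BC}^\lambda). \end{aligned}$$ If $\lambda=\rho$, then in each family the partition function is equal to the stated divisor (for $\mathfrak D^\rho$, the one for $1\in\lambda$). -/

import Mathlib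

namespace BentIce

/-- The six families of bent ice models. -/
inductive Family
  | B | Bstar | C | Cstar | D | BC
  deriving DecidableEq

/-! ### The graph underlying a model

There are `m` pairs of rows joined by a bend.  Rows are counted from top to bottom starting with
`0`; the bent pairs are the rows `j` and `N - 1 - j` for `j < m`, where `N` is the number of rows.
Thus the row with spectral index `j + 1` is row `j`, and the one with spectral index
`overline (j + 1)` is row `N - 1 - j`.  If there is a central row, it is row `m`.
Columns carry natural number labels which increase from right to left, up to `L`. -/

/-- The number of central rows without a bend: `1` for `𝔅_*`, `ℭ`, `𝔅ℭ` and `0` otherwise. -/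
def centralRows : Family → ℕ
  | .Bstar | .C | .BC => 1
  | .B | .Cstar | .D => 0

/-- The number of rows of a model with `m` bends. -/
def numRows (F : Family) (m : ℕ) : ℕ := 2 * m + centralRows F

/-- The label of the half column, if there is one. -/
def halfColumn : Family → Option ℕ
  | .C | .Cstar => some 0
  | .D => some 1
  | .B | .Bstar | .BC => none

/-- The label of the rightmost column. -/
def minColumn : Family → ℕ
  | .C | .Cstar => 0
  | .B | .Bstar | .D | .BC => 1

/-- The labels of all columns, including the half column. -/
def columns (F : Family) (L : ℕ) : Finset ℕ := Finset.Icc (minColumn F) L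

/-- The first row which column `k` meets: a full column meets all the rows, the half column
meets only the `m` bottom rows. -/
def firstRow (F : Family) (m k : ℕ) : ℕ :=
  if halfColumn F = some k then m + centralRows F else 0

/-- The label of the rightmost column which meets row `r`. -/
def lastColumn (F : Family) (m r : ℕ) : ℕ :=
  match halfColumn F with
  | some l => if r < m + centralRows F then l + 1 else l
  | none => minColumn F

/-- The tetravalent vertices, as pairs (row, column). -/
def vertices (F : Family) (m L : ℕ) : Finset (ℕ × ℕ) :=
  (Finset.range (numRows F m) ×ˢ columns F L).filter fun p => firstRow F m p.2 ≤ p.1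

/-- The horizontal edges, as pairs (row, position).  The edge `(r, e)` of row `r` is the one
immediately to the right of column `e` and immediately to the left of column `e - 1`.
So the vertex `(r, k)` has left edge `(r, k + 1)` and right edge `(r, k)`. -/
def horizontalEdges (F : Family) (m L : ℕ) : Finset (ℕ × ℕ) :=
  (Finset.range (numRows F m) ×ˢ Finset.range (L + 2)).filter fun p => lastColumn F m p.1 ≤ p.2

/-- The vertical edges, as pairs (level, column).  The edge `(l, k)` of column `k` is the one
immediately above row `l` and immediately below row `l - 1`.
So the vertex `(r, k)` has top edge `(r, k)` and bottom edge `(r + 1, k)`. -/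
def verticalEdges (F : Family) (m L : ℕ) : Finset (ℕ × ℕ) :=
  (Finset.range (numRows F m + 1) ×ˢ columns F L).filter fun p => firstRow F m p.2 ≤ p.1

/-! ### Admissible states

An orientation of all edges is recorded by the set `H` of the horizontal edges that point to the
right and the set `V` of the vertical edges that point down; the remaining horizontal edges point
to the left and the remaining vertical edges point up. -/

/-- The number of edges which point into the vertex `(r, k)`. -/
def inDegree (H V : Finset (ℕ × ℕ)) (r k : ℕ) : ℕ :=
  (if (r, k + 1) ∈ H then 1 else 0) + (if (r, k) ∈ H then 0 else 1) +
    (if (r, k) ∈ V then 1 else 0) + (if (r + 1, k) ∈ V then 0 else 1)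

/-- The number of edges which point out of the vertex `(r, k)`. -/
def outDegree (H V : Finset (ℕ × ℕ)) (r k : ℕ) : ℕ :=
  (if (r, k + 1) ∈ H then 0 else 1) + (if (r, k) ∈ H then 1 else 0) +
    (if (r, k) ∈ V then 0 else 1) + (if (r + 1, k) ∈ V then 1 else 0)

/-- The greatest part of `lam`. -/
def greatestPart {p : ℕ} (lam : Fin p → ℕ) : ℕ := Finset.univ.sup lam

/-- The orientation `(H, V)` is an admissible state of the model of type `F` with `m` bends and
top boundary given by `lam`. -/
structure Admissible (F : Family) (m : ℕ) {p : ℕ} (lam : Fin p → ℕ)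
    (H V : Finset (ℕ × ℕ)) : Prop where
  /-- In-degree and out-degree agree at every tetravalent vertex. -/
  ice : ∀ v ∈ vertices F m (greatestPart lam), inDegree H V v.1 v.2 = outDegree H V v.1 v.2
  /-- The far left edge of every row points inward. -/
  left : ∀ r ∈ Finset.range (numRows F m), (r, greatestPart lam + 1) ∈ H
  /-- The bottom edge of every column points outward. -/
  bottom : ∀ k ∈ columns F (greatestPart lam), (numRows F m, k) ∈ V
  /-- The top edge of a column points outward if the label of the column is a part of `lam`, and
  inward otherwise.  (The top of the half column of `ℭ` is not on the boundary.) -/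
  top : ∀ k ∈ columns F (greatestPart lam), ¬ (F = .C ∧ k = 0) →
    ((firstRow F m k, k) ∈ V ↔ ∀ j, lam j ≠ k)
  /-- Each bend has one arrow in and one arrow out. -/
  bend : ∀ j ∈ Finset.range m, ((j, lastColumn F m j) ∈ H ↔
    (numRows F m - 1 - j, lastColumn F m (numRows F m - 1 - j)) ∉ H)
  /-- In `𝔅_*` the far right edge of the central row points outward. -/
  central_Bstar : F = .Bstar → (m, lastColumn F m m) ∈ H
  /-- In `𝔅ℭ` the far right edge of the central row points inward. -/
  central_BC : F = .BC → (m, lastColumn F m m) ∉ H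
  /-- In `ℭ` the corner vertex, which joins the right end of the central row to the top of the half
  column, has one arrow in and one arrow out. -/
  corner : F = .C → ((m, lastColumn F m m) ∈ H ↔ (m + 1, 0) ∈ V)

open Classical in
/-- The finite set of admissible states. -/
noncomputable def states (F : Family) (m : ℕ) {p : ℕ} (lam : Fin p → ℕ) :
    Finset (Finset (ℕ × ℕ) × Finset (ℕ × ℕ)) :=
  ((horizontalEdges F m (greatestPart lam)).powerset ×ˢ
    (verticalEdges F m (greatestPart lam)).powerset).filter
      fun s => Admissible F m lam s.1 s.2

/-! ### Boltzmann weights and the partition function -/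

/-- Weights of the six decorations of a tetravalent vertex, named after the two edges that point
inward: `a₁ = NW`, `a₂ = SE`, `b₁ = SW`, `b₂ = NE`, `c₁ = NS`, `c₂ = EW`. -/
structure VertexWeights (R : Type*) where
  a₁ : R
  a₂ : R
  b₁ : R
  b₂ : R
  c₁ : R
  c₂ : R

/-- The weights for the spectral index `overline j` in terms of those for `j`
(the symmetry conditions for bent ice). -/
def VertexWeights.bar {R : Type*} (w : VertexWeights R) : VertexWeights R :=
  ⟨w.a₂, w.a₁, w.b₂, w.b₁, w.c₁, w.c₂⟩

/-- The weight of the decoration of the vertex `(r, k)`. -/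
def vertexWeight {R : Type*} [CommRing R] (w : VertexWeights R)
    (H V : Finset (ℕ × ℕ)) (r k : ℕ) : R :=
  -- left edge to the right?, right edge to the right?, top edge down?, bottom edge down?
  match decide ((r, k + 1) ∈ H), decide ((r, k) ∈ H),
      decide ((r, k) ∈ V), decide ((r + 1, k) ∈ V) with
  | true, true, true, true => w.a₁
  | false, false, false, false => w.a₂
  | true, true, false, false => w.b₁
  | false, false, true, true => w.b₂
  | false, true, true, false => w.c₁
  | true, false, false, true => w.c₂
  | _, _, _, _ => 0

/-- All Boltzmann weights of a model with `m` bends: the vertex weights of the rows `1, …, m`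
(those of the rows `overline 1, …, overline m` follow by symmetry) and of the central row, the
weights `D`, `U` of the bends, and the weights `cornerR`, `cornerL` of the corner vertex. -/
structure BoltzmannWeights (R : Type*) (m : ℕ) where
  row : Fin m → VertexWeights R
  central : VertexWeights R
  D : Fin m → R
  U : Fin m → R
  cornerR : R
  cornerL : R

/-- The vertex weights used in row `r`. -/
def BoltzmannWeights.atRow {R : Type*} {m : ℕ} (W : BoltzmannWeights R m) (F : Family) (r : ℕ) :
    VertexWeights R :=
  if h : r < m then W.row ⟨r, h⟩
  else if h : numRows F m - 1 - r < m then (W.row ⟨numRows F m - 1 - r, h⟩).bar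
  else W.central

/-- The Boltzmann weight of a state: the product of the weights of all of its vertices.
A bend has weight `D` if its arrow goes down (the right end of the upper row points to the right)
and `U` if it goes up; the corner of `ℭ` has weight `cornerR` if the arrow enters it from the
central row and `cornerL` otherwise. -/
def stateWeight {R : Type*} [CommRing R] {m : ℕ} (W : BoltzmannWeights R m) (F : Family) (L : ℕ)
    (H V : Finset (ℕ × ℕ)) : R :=
  (∏ v ∈ vertices F m L, vertexWeight (W.atRow F v.1) H V v.1 v.2) *
  (∏ j : Fin m, if ((j : ℕ), lastColumn F m j) ∈ H then W.D j else W.U j) *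
  (if F = .C then (if (m, lastColumn F m m) ∈ H then W.cornerR else W.cornerL) else 1)

/-- The partition function of the model of type `F` with `m` bends and top boundary `lam`. -/
noncomputable def partitionFunction {R : Type*} [CommRing R] {m : ℕ} (W : BoltzmannWeights R m)
    (F : Family) {p : ℕ} (lam : Fin p → ℕ) : R :=
  ∑ s ∈ states F m lam, stateWeight W F (greatestPart lam) s.1 s.2

/-! ### Deformation weights -/

/-- The deformation weights, where `I` is a square root of `-1`, together with the conventional
bending weights: `U = 1`, `D = I` for `𝔅` and `ℭ`, `D = 1` for the other families, and
`cornerR = 1`, `cornerL = a - I * b` for `a`, `b` the weights of the central row.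
The parameters `tc`, `xc` are those of the central row. -/
def deformationWeights {R : Type*} [CommRing R] (I : R) (F : Family) {m : ℕ}
    (t : Fin m → R) (x : Fin m → Rˣ) (tc xc : R) : BoltzmannWeights R m where
  row j := ⟨1, 1, I * t j * (x j : R), I * t j * ((x j)⁻¹ : Rˣ), 1 - t j ^ 2, 1⟩
  central := ⟨1, 1, I * tc * xc, I * tc * xc, 1 - tc ^ 2 * xc ^ 2, 1⟩
  D _ := match F with
    | .B | .C => I
    | .Bstar | .Cstar | .D | .BC => 1
  U _ := 1
  cornerR := 1
  cornerL := 1 - I * (I * tc * xc)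

/-- The partition function of the model of type `F` for the deformation weights. -/
noncomputable def Z {R : Type*} [CommRing R] (I : R) (F : Family) {m : ℕ} (t : Fin m → R)
    (x : Fin m → Rˣ) (tc xc : R) {p : ℕ} (lam : Fin p → ℕ) : R :=
  partitionFunction (deformationWeights I F t x tc xc) F lam

/-- `lam` is a strictly decreasing sequence of positive integers. -/
def IsStrict {p : ℕ} (lam : Fin p → ℕ) : Prop := StrictAnti lam ∧ ∀ j, 1 ≤ lam j

/-- `ρ = [p, p - 1, …, 1]`. -/
def rho (p : ℕ) : Fin p → ℕ := fun j => p - j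

/-- `∏_{j < k} (1 - t_j t_k x_j x_k⁻¹) (1 - t_j t_k x_j x_k)`. -/
def pairProduct {R : Type*} [CommRing R] {m : ℕ} (t : Fin m → R) (x : Fin m → Rˣ) : R :=
  ∏ j : Fin m, ∏ k ∈ Finset.Ioi j,
    (1 - t j * t k * (x j : R) * ((x k)⁻¹ : Rˣ)) * (1 - t j * t k * (x j : R) * (x k : R))

end BentIce

/-!
# Divisibility of the partition functions of bent ice

The deformation weights are free fermionic: `a₁ a₂ + b₁ b₂ = c₁ c₂`.  Regard the up and left
arrows as particles.  Then a vertex acts on the exterior algebra over the edges as the second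
quantization of a `2 × 2` matrix (`gate_wedge`), so a row maps exterior products of one-particle
vectors to exterior products.  In terms of generating functions, a row multiplies a vector by
`(z + b₁) / (1 - b₂ z)`, and a row entered by a particle adds the factor `1 / (1 - b₂ z)`.  Two
exterior products which differ in a single vector can be merged, so the two directions of a bend
together create one new vector.  Summing over the bends from the innermost pair of rows outwards
(`nested_sum`), the partition function becomes a determinant: its rows are the created vectors and
its columns the parts of `λ` (`Z_eq_wedgeSeries`, `wedgeSeries_eq_det`).

Put `β_j = i t_j x_j`, `β'_j = i t_j / x_j`.  All created vectors have the same denominator, and the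
numerator of the `i`-th one is `∏_{l < i} (z + β_l) (1 - β_l z)` times the sum of two terms, one for
each direction of the bend (`created_full`, `created_half`).  Both terms are products over the pairs
of rows inside bend `i`, related by `z ↦ 1 / z`.  This makes their sum a common factor `κ z ^ s`,
which depends only on the family, times a form, that is, a homogeneous polynomial in `1 - z ^ 2` and
`z`, of degree one less than the number `N` of parts (`IsSplitPair`, `bracket_forms_B` and its
analogues).  Hence the partition function is the product of the determinant of the `N × N` matrix of
the coefficients of these forms, which does not depend on `λ`, and of another determinant, which for
`λ = ρ` is unitriangular (`det_dvd_wedgeSeries`).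

The determinant of the coefficient matrix is computed by evaluation at the points `-β_j`
(`exists_matrix_of_forms`): the matrix of values is triangular, its diagonal is explicit, and the
evaluation of forms is a projective Vandermonde matrix.  The division this requires is
possible after the parameters `β_j` have been deformed to `β_j + y ^ (j + 1)` over `R[y]`; setting
`y = 0` gives the result over `R`.  The determinant is precisely the stated divisor.  For `𝔇` with
`1 ∈ λ` the constant terms of the vectors contribute as well; they are, up to the factor `∏ β_j`, the
last column of the coefficient matrix, and this factor is cancelled in the same way
(`exists_matrix_D`).
-/

namespace BentIce

open Finset

/-! ### Fermionic amplitudes -/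

section Wedge

variable {R : Type*} [CommRing R]

/-- The sign which moves a particle at `s` past the particles of `S` to its right (those with a
smaller label). -/
def rightSign (R : Type*) [CommRing R] (S : Finset ℕ) (s : ℕ) : R := (-1) ^ #(S.filter (· < s))

/-- The amplitude which is concentrated on the configuration without particles. -/
def vac (S : Finset ℕ) : R := if S = ∅ then 1 else 0

/-- Exterior multiplication of an amplitude by a one-particle vector, in coordinates: the
amplitude `Φ` assigns a coefficient to each finite set of occupied sites, and the new particle is
placed to the right of the others. -/
def wedge (v : ℕ → R) (Φ : Finset ℕ → R) (S : Finset ℕ) : R :=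
  ∑ s ∈ S, rightSign R S s * v s * Φ (S.erase s)

/-- The iterated exterior product `v₁ ∧ ⋯ ∧ v_m` of a list of vectors. -/
def wedgeList (l : List (ℕ → R)) : Finset ℕ → R := l.foldl (fun Φ v => wedge v Φ) vac

lemma wedgeList_concat (l : List (ℕ → R)) (v : ℕ → R) :
    wedgeList (l ++ [v]) = wedge v (wedgeList l) := by
  simp [wedgeList]

lemma rightSign_insert {S : Finset ℕ} {a : ℕ} (ha : a ∉ S) (s : ℕ) :
    rightSign R (insert a S) s = (if a < s then -1 else 1) * rightSign R S s := by
  unfold rightSign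
  rw [filter_insert]
  split_ifs with h
  · rw [card_insert_of_notMem (by simp [ha]), pow_succ]; ring
  · simp

lemma rightSign_succ {S : Finset ℕ} {k : ℕ} (hk : k ∉ S) :
    rightSign R S (k + 1) = rightSign R S k := by
  unfold rightSign
  congr 2
  ext x
  simp only [mem_filter, and_congr_right_iff]
  intro hx
  have : x ≠ k := fun h => hk (h ▸ hx)
  omega

lemma wedge_insert (v : ℕ → R) (Φ : Finset ℕ → R) {S : Finset ℕ} {a : ℕ} (ha : a ∉ S) :
    wedge v Φ (insert a S) = rightSign R S a * v a * Φ S +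
      ∑ s ∈ S, (if a < s then -1 else 1) *
        (rightSign R S s * v s * Φ (insert a (S.erase s))) := by
  unfold wedge
  rw [sum_insert ha, rightSign_insert ha, erase_insert ha]
  congr 1
  · simp
  · refine sum_congr rfl fun s hs => ?_
    have : a ≠ s := fun h => ha (h ▸ hs)
    rw [rightSign_insert ha, erase_insert_of_ne this]
    ring

lemma wedge_add_left (v w : ℕ → R) (Φ : Finset ℕ → R) :
    wedge (v + w) Φ = wedge v Φ + wedge w Φ := by
  funext S
  simp only [wedge, Pi.add_apply, ← sum_add_distrib]
  exact sum_congr rfl fun s _ => by ring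

lemma wedge_smul_left (c : R) (v : ℕ → R) (Φ : Finset ℕ → R) :
    wedge (c • v) Φ = c • wedge v Φ := by
  funext S
  simp only [wedge, Pi.smul_apply, smul_eq_mul, mul_sum]
  exact sum_congr rfl fun s _ => by ring

lemma wedge_add_right (v : ℕ → R) (Φ Ψ : Finset ℕ → R) :
    wedge v (Φ + Ψ) = wedge v Φ + wedge v Ψ := by
  funext S
  simp only [wedge, Pi.add_apply, ← sum_add_distrib]
  exact sum_congr rfl fun s _ => by ring

lemma wedge_smul_right (c : R) (v : ℕ → R) (Φ : Finset ℕ → R) :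
    wedge v (c • Φ) = c • wedge v Φ := by
  funext S
  simp only [wedge, Pi.smul_apply, smul_eq_mul, mul_sum]
  exact sum_congr rfl fun s _ => by ring

lemma rightSign_erase_mul {S : Finset ℕ} {s s' : ℕ} (hs : s ∈ S) (hs' : s' ∈ S) (h : s ≠ s') :
    rightSign R S s * rightSign R (S.erase s) s' =
      -(rightSign R S s' * rightSign R (S.erase s') s) := by
  have key : ∀ {a b : ℕ}, a ∈ S → rightSign R S b =
      (if a < b then -1 else 1) * rightSign R (S.erase a) b := by
    intro a b ha
    conv_lhs => rw [← insert_erase ha]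
    exact rightSign_insert (notMem_erase _ _) _
  rw [key (a := s) (b := s') hs, key (a := s') (b := s) hs']
  rcases lt_or_gt_of_ne h with h | h
  · simp only [if_pos h, if_neg (asymm h)]; ring
  · simp only [if_pos h, if_neg (asymm h)]; ring

lemma wedge_wedge (v w : ℕ → R) (Φ : Finset ℕ → R) :
    wedge v (wedge w Φ) = -wedge w (wedge v Φ) := by
  funext S
  simp only [wedge, Pi.neg_apply, mul_sum]
  rw [sum_comm' (t' := S) (s' := fun y => S.erase y)
    (h := by intro x y; simp only [mem_erase]; tauto), ← sum_neg_distrib]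
  refine sum_congr rfl fun y hy => ?_
  rw [← sum_neg_distrib]
  refine sum_congr rfl fun x hx => ?_
  have hx' := mem_erase.1 hx
  have := rightSign_erase_mul (R := R) hx'.2 hy hx'.1
  rw [erase_right_comm]
  linear_combination v x * w y * Φ ((S.erase y).erase x) * this

lemma foldl_wedge_add (l : List (ℕ → R)) (Φ Ψ : Finset ℕ → R) :
    l.foldl (fun Φ v => wedge v Φ) (Φ + Ψ) =
      l.foldl (fun Φ v => wedge v Φ) Φ + l.foldl (fun Φ v => wedge v Φ) Ψ := by
  induction l generalizing Φ Ψ with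
  | nil => rfl
  | cons a l ih => simp only [List.foldl_cons, wedge_add_right, ih]

lemma foldl_wedge_smul (l : List (ℕ → R)) (c : R) (Φ : Finset ℕ → R) :
    l.foldl (fun Φ v => wedge v Φ) (c • Φ) = c • l.foldl (fun Φ v => wedge v Φ) Φ := by
  induction l generalizing Φ with
  | nil => rfl
  | cons a l ih => simp only [List.foldl_cons, wedge_smul_right, ih]

lemma wedge_foldl (l : List (ℕ → R)) (v : ℕ → R) (Φ : Finset ℕ → R) :
    wedge v (l.foldl (fun Φ v => wedge v Φ) Φ) =
      (-1 : R) ^ l.length • l.foldl (fun Φ v => wedge v Φ) (wedge v Φ) := by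
  induction l generalizing Φ with
  | nil => simp
  | cons a l ih =>
    simp only [List.foldl_cons, ih, List.length_cons]
    rw [wedge_wedge v a, ← neg_one_smul R (wedge a (wedge v Φ)), foldl_wedge_smul, smul_smul,
      pow_succ]

/-- A vector at the end of an exterior product can be merged with one in the middle. -/
lemma wedgeList_merge (l l' : List (ℕ → R)) (v w : ℕ → R) (c d : R) :
    c • wedgeList (l ++ v :: l') + d • wedgeList (l ++ l' ++ [w]) =
      wedgeList (l ++ (c • v + (d * (-1) ^ l'.length) • w) :: l') := by
  rw [wedgeList_concat]
  simp only [wedgeList, List.foldl_append, List.foldl_cons]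
  rw [wedge_foldl l', wedge_add_left, wedge_smul_left, wedge_smul_left, foldl_wedge_add,
    foldl_wedge_smul, foldl_wedge_smul, smul_smul]

/-- Amplitudes of exterior products depend only on the coordinates at the occupied sites. -/
lemma wedgeList_congr {l l' : List (ℕ → R)} {S : Finset ℕ}
    (h : List.Forall₂ (fun v w => ∀ s ∈ S, v s = w s) l l') : wedgeList l S = wedgeList l' S := by
  induction l using List.reverseRecOn generalizing l' S with
  | nil => cases h; rfl
  | append_singleton l v ih =>
    obtain ⟨l₁, l₂, h₁, h₂, rfl⟩ : ∃ l₁ l₂, List.Forall₂ (fun v w => ∀ s ∈ S, v s = w s) l l₁ ∧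
        List.Forall₂ (fun v w => ∀ s ∈ S, v s = w s) [v] l₂ ∧ l' = l₁ ++ l₂ := by
      refine ⟨l'.take l.length, l'.drop l.length, ?_, ?_, (List.take_append_drop _ _).symm⟩
      · have := List.forall₂_take l.length h
        simpa using this
      · have := List.forall₂_drop l.length h
        simpa using this
    obtain ⟨w, rfl⟩ : ∃ w, l₂ = [w] := by
      rw [List.forall₂_cons_left_iff] at h₂
      obtain ⟨b, u, -, hu, rfl⟩ := h₂
      rw [List.forall₂_nil_left_iff] at hu
      exact ⟨b, by rw [hu]⟩
    rw [wedgeList_concat, wedgeList_concat]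
    refine sum_congr rfl fun s hs => ?_
    rw [ih (h₁.imp fun a b hab t ht => hab t (mem_of_mem_erase ht))]
    rw [List.forall₂_cons] at h₂
    rw [h₂.1 s hs]

/-- The coefficients of an exterior product are the minors of the matrix of its factors. -/
lemma wedgeList_ofFn {m : ℕ} (F : Fin m → ℕ → R) (c : Fin m → ℕ) (hc : StrictAnti c) :
    wedgeList (List.ofFn F) (univ.image c) = (Matrix.of fun j k => F j (c k)).det := by
  induction m with
  | zero => simp [wedgeList, vac]
  | succ m ih =>
    rw [List.ofFn_succ', List.concat_eq_append, wedgeList_concat, wedge,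
      sum_image (fun _ _ _ _ h => hc.injective h), Matrix.det_succ_row _ (Fin.last m)]
    refine sum_congr rfl fun k _ => ?_
    have h1 : (univ.image c).erase (c k) = univ.image (c ∘ k.succAbove) := by
      ext x
      simp only [mem_erase, mem_image, mem_univ, true_and, Function.comp]
      constructor
      · rintro ⟨h, j, rfl⟩
        obtain ⟨i, rfl⟩ := Fin.exists_succAbove_eq (x := j) (y := k) (fun e => h (by rw [e]))
        exact ⟨i, rfl⟩
      · rintro ⟨i, rfl⟩
        exact ⟨fun e => Fin.succAbove_ne k i (hc.injective e), _, rfl⟩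
    have h2 : rightSign R (univ.image c) (c k) = (-1) ^ ((Fin.last m : ℕ) + (k : ℕ)) := by
      unfold rightSign
      have : (univ.image c).filter (· < c k) = (Ioi k).image c := by
        ext x
        simp only [mem_filter, mem_image, mem_univ, true_and, mem_Ioi]
        constructor
        · rintro ⟨⟨j, rfl⟩, h⟩
          exact ⟨j, hc.lt_iff_gt.1 h, rfl⟩
        · rintro ⟨j, h, rfl⟩
          exact ⟨⟨j, rfl⟩, hc h⟩
      rw [this, card_image_of_injective _ hc.injective, Fin.card_Ioi, Fin.val_last]
      have hk : (k : ℕ) ≤ m := Nat.lt_succ_iff.1 k.2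
      rw [show m + (k : ℕ) = (m + 1 - 1 - k) + 2 * k by omega, pow_add, pow_mul]
      simp
    rw [h1, h2, ih _ _ (hc.comp_strictMono (Fin.strictMono_succAbove k))]
    congr 2
    ext i j
    simp

end Wedge

/-! ### Two-site gates -/

section Gate

variable {R : Type*} [CommRing R]

/-- The action on amplitudes of a tetravalent vertex with weights `a₁ = a₂ = c₂ = 1`, `b₁`, `b₂`
and `c₁ = 1 + b₁ b₂`.  The site `k` stands for the right edge before and for the top edge after the
vertex has been passed, the site `k + 1` for the bottom edge before and for the left edge after. -/
def gate (k : ℕ) (b₁ b₂ : R) (Φ : Finset ℕ → R) (S : Finset ℕ) : R :=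
  if k ∈ S then
    if k + 1 ∈ S then Φ S else Φ S + b₁ * Φ (insert (k + 1) (S.erase k))
  else
    if k + 1 ∈ S then (1 + b₁ * b₂) * Φ S + b₂ * Φ (insert k (S.erase (k + 1))) else Φ S

/-- The action of a vertex on one-particle vectors. -/
def gateVec (k : ℕ) (b₁ b₂ : R) (v : ℕ → R) (s : ℕ) : R :=
  if s = k then v k + b₁ * v (k + 1)
  else if s = k + 1 then b₂ * v k + (1 + b₁ * b₂) * v (k + 1) else v s

lemma gate_vac (k : ℕ) (b₁ b₂ : R) : gate k b₁ b₂ vac = vac := by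
  funext S
  unfold gate vac
  split_ifs <;> simp_all

variable {k : ℕ} {S : Finset ℕ}

lemma gate_neither (b₁ b₂ : R) (Φ : Finset ℕ → R) (h : k ∉ S) (h' : k + 1 ∉ S) :
    gate k b₁ b₂ Φ S = Φ S := by
  simp [gate, h, h']

lemma gate_right (b₁ b₂ : R) (Φ : Finset ℕ → R) (h : k ∉ S) (h' : k + 1 ∉ S) :
    gate k b₁ b₂ Φ (insert k S) = Φ (insert k S) + b₁ * Φ (insert (k + 1) S) := by
  simp [gate, h, h']

lemma gate_left (b₁ b₂ : R) (Φ : Finset ℕ → R) (h : k ∉ S) (h' : k + 1 ∉ S) :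
    gate k b₁ b₂ Φ (insert (k + 1) S) =
      (1 + b₁ * b₂) * Φ (insert (k + 1) S) + b₂ * Φ (insert k S) := by
  simp [gate, h, h']

lemma gate_both (b₁ b₂ : R) (Φ : Finset ℕ → R) :
    gate k b₁ b₂ Φ (insert k (insert (k + 1) S)) = Φ (insert k (insert (k + 1) S)) := by
  simp [gate]

/-- A vertex acts on exterior products factor by factor.  This is where the free fermionic
condition `a₁ a₂ + b₁ b₂ = c₁ c₂` is used. -/
lemma gate_wedge (k : ℕ) (b₁ b₂ : R) (v : ℕ → R) (Φ : Finset ℕ → R) :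
    gate k b₁ b₂ (wedge v Φ) = wedge (gateVec k b₁ b₂ v) (gate k b₁ b₂ Φ) := by
  funext S
  obtain ⟨T, hT, hT', hS⟩ : ∃ T : Finset ℕ, k ∉ T ∧ k + 1 ∉ T ∧ (S = T ∨ S = insert k T ∨
      S = insert (k + 1) T ∨ S = insert k (insert (k + 1) T)) := by
    refine ⟨(S.erase k).erase (k + 1), by simp, by simp, ?_⟩
    by_cases h : k ∈ S <;> by_cases h' : k + 1 ∈ S
    · right; right; right
      rw [insert_erase (by simp [h']), insert_erase h]
    · right; left
      rw [erase_eq_of_notMem (a := k + 1) (by simp [h']), insert_erase h]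
    · right; right; left
      rw [erase_eq_of_notMem (a := k) h, insert_erase h']
    · left
      rw [erase_eq_of_notMem (a := k) h, erase_eq_of_notMem h']
  have hne : ∀ s ∈ T, s ≠ k ∧ s ≠ k + 1 := fun s hs =>
    ⟨fun e => hT (e ▸ hs), fun e => hT' (e ▸ hs)⟩
  have hg : ∀ s ∈ T, gateVec k b₁ b₂ v s = v s := fun s hs => by
    simp [gateVec, (hne s hs).1, (hne s hs).2]
  have hlt : ∀ s ∈ T, (k + 1 < s ↔ k < s) := fun s hs => by
    have := hne s hs; omega
  have he : ∀ s, k ∉ T.erase s ∧ k + 1 ∉ T.erase s := fun s =>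
    ⟨fun h => hT (mem_of_mem_erase h), fun h => hT' (mem_of_mem_erase h)⟩
  have gk : gateVec k b₁ b₂ v k = v k + b₁ * v (k + 1) := by simp [gateVec]
  have gk' : gateVec k b₁ b₂ v (k + 1) = b₂ * v k + (1 + b₁ * b₂) * v (k + 1) := by
    simp [gateVec]
  have hk : k ∉ insert (k + 1) T := by simp [hT]
  rcases hS with rfl | rfl | rfl | rfl
  · rw [gate_neither _ _ _ hT hT']
    refine sum_congr rfl fun s hs => ?_
    rw [hg s hs, gate_neither _ _ _ (he s).1 (he s).2]
  · rw [gate_right _ _ _ hT hT', wedge_insert _ _ hT, wedge_insert _ _ hT', wedge_insert _ _ hT,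
      rightSign_succ hT, gk, gate_neither _ _ _ hT hT', mul_add, mul_sum]
    rw [add_add_add_comm, ← sum_add_distrib]
    congr 1
    · ring
    · refine sum_congr rfl fun s hs => ?_
      rw [hg s hs, gate_right _ _ _ (he s).1 (he s).2]
      simp only [hlt s hs]
      ring
  · rw [gate_left _ _ _ hT hT', wedge_insert _ _ hT, wedge_insert _ _ hT', wedge_insert _ _ hT',
      rightSign_succ hT, gk', gate_neither _ _ _ hT hT', mul_add, mul_add, mul_sum, mul_sum]
    rw [add_add_add_comm, ← sum_add_distrib]
    congr 1
    · ring
    · refine sum_congr rfl fun s hs => ?_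
      rw [hg s hs, gate_left _ _ _ (he s).1 (he s).2]
      simp only [hlt s hs]
      ring
  · rw [gate_both, wedge_insert _ _ hk, wedge_insert _ _ hk, sum_insert hT', sum_insert hT',
      rightSign_insert hT', gk, gk', erase_insert hT', gate_left _ _ _ hT hT',
      gate_right _ _ _ hT hT', rightSign_insert hT', rightSign_succ hT, ← add_assoc, ← add_assoc]
    congr 1
    · simp only [Nat.lt_irrefl, Nat.lt_succ_self, if_true, if_false,
        show ¬ (k + 1 < k) by omega]
      ring
    · refine sum_congr rfl fun s hs => ?_
      rw [hg s hs, erase_insert_of_ne (hne s hs).2.symm, gate_both]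

end Gate

/-! ### Relabelling of sites -/

section Relabel

variable {R : Type*} [CommRing R]

/-- The order embedding of `ℕ` whose range misses exactly `m`. -/
def skip (m k : ℕ) : ℕ := if k < m then k else k + 1

lemma skip_strictMono (m : ℕ) : StrictMono (skip m) := by
  intro a b h
  unfold skip
  split_ifs <;> omega

lemma skip_ne (m k : ℕ) : skip m k ≠ m := by
  unfold skip
  split_ifs <;> omega

/-- The preimage of a set of sites under `skip m`: the site `m` is deleted. -/
noncomputable def unskip (m : ℕ) (S : Finset ℕ) : Finset ℕ :=
  S.preimage (skip m) (skip_strictMono m).injective.injOn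

lemma mem_unskip {m k : ℕ} {S : Finset ℕ} : k ∈ unskip m S ↔ skip m k ∈ S := by
  simp [unskip]

/-- Insertion of an empty site at `m`. -/
noncomputable def relabel (m : ℕ) (Φ : Finset ℕ → R) (S : Finset ℕ) : R :=
  if m ∈ S then 0 else Φ (unskip m S)

/-- Insertion of a vanishing coordinate at `m`. -/
def relabelVec (m : ℕ) (v : ℕ → R) (k : ℕ) : R :=
  if k < m then v k else if k = m then 0 else v (k - 1)

lemma relabelVec_skip (m : ℕ) (v : ℕ → R) (k : ℕ) : relabelVec m v (skip m k) = v k := by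
  unfold relabelVec skip
  split_ifs <;> first | rfl | omega

lemma image_unskip {m : ℕ} {S : Finset ℕ} (h : m ∉ S) : (unskip m S).image (skip m) = S := by
  ext x
  simp only [mem_image, mem_unskip]
  constructor
  · rintro ⟨a, ha, rfl⟩; exact ha
  · intro hx
    have hxm : x ≠ m := fun e => h (e ▸ hx)
    by_cases hlt : x < m
    · exact ⟨x, by simpa [skip, hlt] using hx, by simp [skip, hlt]⟩
    · have h1 : ¬ x - 1 < m := by omega
      have h2 : x - 1 + 1 = x := by omega
      exact ⟨x - 1, by simpa [skip, h1, h2] using hx, by simp [skip, h1, h2]⟩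

lemma relabel_vac (m : ℕ) : relabel m (vac : Finset ℕ → R) = vac := by
  funext S
  unfold relabel
  split_ifs with h
  · exact (if_neg (ne_empty_of_mem h)).symm
  · refine if_congr ?_ rfl rfl
    conv_rhs => rw [← image_unskip h, image_eq_empty]

lemma relabel_wedge (m : ℕ) (v : ℕ → R) (Φ : Finset ℕ → R) :
    relabel m (wedge v Φ) = wedge (relabelVec m v) (relabel m Φ) := by
  funext S
  by_cases h : m ∈ S
  · rw [relabel, if_pos h, wedge]
    symm
    refine sum_eq_zero fun s hs => ?_
    by_cases e : s = m
    · simp [relabelVec, e]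
    · rw [relabel, if_pos (mem_erase.2 ⟨fun h => e h.symm, h⟩), mul_zero]
  · rw [relabel, if_neg h, wedge, wedge]
    conv_rhs => rw [← image_unskip h]
    rw [sum_image fun _ _ _ _ e => (skip_strictMono m).injective e]
    refine sum_congr rfl fun s _ => ?_
    rw [image_unskip h, relabelVec_skip, relabel, if_neg fun h' => h (mem_of_mem_erase h')]
    congr 2
    · unfold rightSign
      have : S.filter (· < skip m s) = ((unskip m S).filter (· < s)).image (skip m) := by
        conv_lhs => rw [← image_unskip h, filter_image]
        simp only [(skip_strictMono m).lt_iff_lt]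
      rw [this, card_image_of_injective _ (skip_strictMono m).injective]
    · ext x
      simp only [mem_erase, mem_unskip, (skip_strictMono m).injective.ne_iff]

end Relabel

/-! ### Rows of vertices -/

section Multiplicative

variable {R : Type*} [CommRing R]

/-- The operator `T` on amplitudes is the second quantization of the map `g` on one-particle
vectors: it acts on exterior products factor by factor. -/
structure IsSecondQuantization (T : (Finset ℕ → R) → Finset ℕ → R) (g : (ℕ → R) → ℕ → R) :
    Prop where
  vac : T vac = vac
  wedge : ∀ v Φ, T (wedge v Φ) = BentIce.wedge (g v) (T Φ)

lemma IsSecondQuantization.wedgeList {T : (Finset ℕ → R) → Finset ℕ → R} {g : (ℕ → R) → ℕ → R}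
    (h : IsSecondQuantization T g) (l : List (ℕ → R)) :
    T (wedgeList l) = BentIce.wedgeList (l.map g) := by
  induction l using List.reverseRecOn with
  | nil => exact h.vac
  | append_singleton l v ih =>
    rw [wedgeList_concat, h.wedge, ih, List.map_append, List.map_singleton, wedgeList_concat]

lemma IsSecondQuantization.comp {T T' : (Finset ℕ → R) → Finset ℕ → R}
    {g g' : (ℕ → R) → ℕ → R} (h : IsSecondQuantization T g) (h' : IsSecondQuantization T' g') :
    IsSecondQuantization (T ∘ T') (g ∘ g') :=
  ⟨by simp [h.vac, h'.vac], fun v Φ => by simp [h.wedge, h'.wedge]⟩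

/-- The vertices in the columns `m, …, m + i - 1` of a row, from right to left.  Before, the right
end of the row occupies the site `m` and the bottom edge of column `c` the site `c + 1`; afterwards,
the top edge of column `c` occupies the site `c` and the left end of the row the site `m + i`. -/
def gates (m : ℕ) (b₁ b₂ : R) : ℕ → (Finset ℕ → R) → Finset ℕ → R
  | 0, Φ => Φ
  | i + 1, Φ => gate (m + i) b₁ b₂ (gates m b₁ b₂ i Φ)

/-- The action of a row of vertices on one-particle vectors. -/
def gatesVec (m : ℕ) (b₁ b₂ : R) : ℕ → (ℕ → R) → ℕ → R
  | 0, v => v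
  | i + 1, v => gateVec (m + i) b₁ b₂ (gatesVec m b₁ b₂ i v)

lemma isSecondQuantization_gates (m i : ℕ) (b₁ b₂ : R) :
    IsSecondQuantization (gates m b₁ b₂ i) (gatesVec m b₁ b₂ i) := by
  induction i with
  | zero => exact ⟨rfl, fun _ _ => rfl⟩
  | succ i ih =>
    exact IsSecondQuantization.comp (T := gate (m + i) b₁ b₂) (g := gateVec (m + i) b₁ b₂)
      ⟨gate_vac _ _ _, fun v Φ => gate_wedge _ _ _ v Φ⟩ ih

/-- The coordinates of a vector after a row; `H` is the amplitude on the horizontal edges. -/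
lemma gatesVec_apply (m : ℕ) (b₁ b₂ : R) (v f H : ℕ → R) (h₀ : v m = H m)
    (h₁ : ∀ s, m ≤ s → v (s + 1) = f s)
    (hH : ∀ k, m ≤ k → H (k + 1) = b₂ * H k + (1 + b₁ * b₂) * f k) (i s : ℕ) :
    gatesVec m b₁ b₂ i v s = if s < m then v s else if s < m + i then H s + b₁ * f s
      else if s = m + i then H s else v s := by
  induction i generalizing s with
  | zero =>
    simp only [gatesVec, add_zero]
    split_ifs with h1 h2 <;> simp_all
  | succ i ih =>
    simp only [gatesVec, gateVec, ih]
    rcases lt_trichotomy s (m + i) with h | rfl | h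
    · simp only [h.ne, (show s ≠ m + i + 1 by omega), if_false, h, if_true,
        (show s < m + (i + 1) by omega)]
    · simp [h₁ (m + i) (by omega)]
    · rcases (show s = m + i + 1 ∨ m + i + 1 < s by omega) with rfl | h'
      · have e : v (m + i + 1) = f (m + i) := h₁ _ (by omega)
        have e' := hH (m + i) (by omega)
        simp only [add_assoc] at e e'
        simp [add_assoc, e, e']
      · simp only [h.ne', h'.ne', if_false, (show ¬ s < m by omega), (show ¬ s < m + i by omega),
          (show ¬ s < m + (i + 1) by omega), (show s ≠ m + (i + 1) by omega)]

/-- Insertion of the right end of a row at the site `m`, occupied or empty according to `ε`. -/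
noncomputable def insertSite (m : ℕ) (ε : Prop) [Decidable ε] (Φ : Finset ℕ → R)
    (S : Finset ℕ) : R :=
  if (m ∈ S ↔ ε) then Φ (unskip m S) else 0

lemma insertSite_false (m : ℕ) (Φ : Finset ℕ → R) : insertSite m False Φ = relabel m Φ := by
  funext S
  by_cases h : m ∈ S <;> simp [insertSite, relabel, h]

lemma insertSite_true (m : ℕ) (Φ : Finset ℕ → R) (S : Finset ℕ) :
    insertSite m True Φ S = rightSign R S m * wedge (Pi.single m 1) (relabel m Φ) S := by
  have hsq : rightSign R S m * rightSign R S m = 1 := by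
    rw [rightSign, ← mul_pow]; simp
  by_cases h : m ∈ S
  · have h' : unskip m (S.erase m) = unskip m S := by
      ext x; simp [mem_unskip, skip_ne]
    rw [wedge, sum_eq_single_of_mem m h (fun b _ hb => by simp [hb])]
    simp only [insertSite, h, relabel, notMem_erase, if_false, if_true, Pi.single_eq_same, h']
    rw [mul_one, ← mul_assoc, hsq, one_mul]
  · rw [wedge, sum_eq_zero]
    · simp [insertSite, h]
    · intro s hs
      have : s ≠ m := fun e => h (e ▸ hs)
      simp [this]

lemma isSecondQuantization_relabel (m : ℕ) :
    IsSecondQuantization (relabel m : (Finset ℕ → R) → _) (relabelVec m) :=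
  ⟨relabel_vac m, relabel_wedge m⟩

/-- The right turn at a corner: the bottom site `0` becomes the right end of the central row, at the
site `1`, and a particle which takes this turn contributes the factor `ℓ`. -/
noncomputable def cornerSite (ℓ : R) (Φ : Finset ℕ → R) (S : Finset ℕ) : R :=
  (if 1 ∈ S then ℓ else 1) * relabel 0 Φ S

/-- The action of the corner on one-particle vectors. -/
def cornerVec (ℓ : R) (v : ℕ → R) (k : ℕ) : R :=
  (if k = 1 then ℓ else 1) * relabelVec 0 v k

lemma isSecondQuantization_cornerSite (ℓ : R) :
    IsSecondQuantization (cornerSite ℓ) (cornerVec ℓ) := by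
  constructor
  · funext S
    rw [cornerSite, relabel_vac]
    unfold BentIce.vac
    split_ifs <;> simp_all
  · intro v Φ
    funext S
    rw [cornerSite, relabel_wedge, BentIce.wedge, BentIce.wedge, mul_sum]
    refine sum_congr rfl fun s hs => ?_
    rw [cornerSite, cornerVec]
    by_cases h : s = 1
    · subst h
      simp only [hs, if_true, notMem_erase, if_false]
      ring
    · have : 1 ∈ S.erase s ↔ 1 ∈ S := by simp [Ne.symm h]
      simp only [h, if_false, this]
      ring

end Multiplicative

/-! ### The state sum of a row -/

section RowSum

variable {R : Type*} [CommRing R]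

/-- The weight of a vertex in terms of the presence of particles on its left, right, top and bottom
edges.  A particle is a vertical edge which points up or a horizontal edge which points left. -/
def localWeight (w : VertexWeights R) (l r t b : Bool) : R :=
  match l, r, t, b with
  | false, false, false, false => w.a₁
  | true, true, true, true => w.a₂
  | false, false, true, true => w.b₁
  | true, true, false, false => w.b₂
  | true, false, false, true => w.c₁
  | false, true, true, false => w.c₂
  | _, _, _, _ => 0

lemma vertexWeight_eq_localWeight (w : VertexWeights R) (H V : Finset (ℕ × ℕ)) (r k : ℕ) :
    vertexWeight w H V r k = localWeight w (decide ((r, k + 1) ∉ H)) (decide ((r, k) ∉ H))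
      (decide ((r, k) ∉ V)) (decide ((r + 1, k) ∉ V)) := by
  unfold vertexWeight localWeight
  by_cases h₁ : (r, k + 1) ∈ H <;> by_cases h₂ : (r, k) ∈ H <;> by_cases h₃ : (r, k) ∈ V <;>
    by_cases h₄ : (r + 1, k) ∈ V <;> simp [h₁, h₂, h₃, h₄]

/-- Free fermionic weights with `a₁ = a₂ = c₂ = 1`. -/
def freeWeights (b₁ b₂ : R) : VertexWeights R := ⟨1, 1, b₁, b₂, 1 + b₁ * b₂, 1⟩

/-- `S` with the occupation of the sites `k` and `k + 1` replaced by `ρ` and `β`. -/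
def setPair (k : ℕ) (ρ β : Bool) (S : Finset ℕ) : Finset ℕ :=
  (if ρ then {k} else ∅) ∪ (if β then {k + 1} else ∅) ∪ (S.erase k).erase (k + 1)

lemma mem_setPair {k : ℕ} {ρ β : Bool} {S : Finset ℕ} {x : ℕ} : x ∈ setPair k ρ β S ↔
    (x = k ∧ ρ = true) ∨ (x = k + 1 ∧ β = true) ∨ (x ≠ k ∧ x ≠ k + 1 ∧ x ∈ S) := by
  cases ρ <;> cases β <;> simp [setPair] <;> tauto

lemma mem_ite_singleton {ρ : Prop} [Decidable ρ] {x a : ℕ} :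
    x ∈ (if ρ then {a} else (∅ : Finset ℕ)) ↔ x = a ∧ ρ := by
  split_ifs <;> simp_all

lemma gate_eq_sum (k : ℕ) (b₁ b₂ : R) (Φ : Finset ℕ → R) (S : Finset ℕ) :
    gate k b₁ b₂ Φ S = ∑ ρ : Bool, ∑ β : Bool,
      localWeight (freeWeights b₁ b₂) (decide (k + 1 ∈ S)) ρ (decide (k ∈ S)) β *
        Φ (setPair k ρ β S) := by
  by_cases h : k ∈ S <;> by_cases h' : k + 1 ∈ S
  · have : setPair k true true S = S := by
      ext x; simp only [setPair, if_true, mem_union, mem_singleton, mem_erase]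
      by_cases e : x = k <;> by_cases e' : x = k + 1 <;> simp_all
    simp [gate, h, h', localWeight, freeWeights, this]
  · have e1 : setPair k true false S = S := by
      ext x; simp [setPair]
      by_cases e : x = k <;> by_cases e' : x = k + 1 <;> simp_all
    have e2 : setPair k false true S = insert (k + 1) (S.erase k) := by
      ext x; simp [setPair]
      by_cases e : x = k <;> by_cases e' : x = k + 1 <;> simp_all
    simp [gate, h, h', localWeight, freeWeights, e1, e2]
  · have e1 : setPair k true false S = insert k (S.erase (k + 1)) := by
      ext x; simp [setPair]
      by_cases e : x = k <;> by_cases e' : x = k + 1 <;> simp_all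
    have e2 : setPair k false true S = S := by
      ext x; simp [setPair]
      by_cases e : x = k <;> by_cases e' : x = k + 1 <;> simp_all
    simp [gate, h, h', localWeight, freeWeights, e1, e2]
    ring
  · have : setPair k false false S = S := by
      ext x; simp [setPair]
      by_cases e : x = k <;> by_cases e' : x = k + 1 <;> simp_all
    simp [gate, h, h', localWeight, freeWeights, this]

/-- The product of the weights of the vertices in the columns `c ∈ Ico m M` of a row with particles
on the horizontal edges `h`, the top edges `S` and the bottom edges `b`. -/
def rowWeight (w : VertexWeights R) (m M : ℕ) (h S b : Finset ℕ) : R :=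
  ∏ c ∈ Ico m M, localWeight w (decide (c + 1 ∈ h)) (decide (c ∈ h)) (decide (c ∈ S))
    (decide (c ∈ b))

/-- The sites occupied before a row, when `h` and `b` are the horizontal and bottom particles and
`S` is occupied after the row. -/
def rowInput (m i : ℕ) (h b S : Finset ℕ) : Finset ℕ :=
  S.filter (· < m) ∪ (if m ∈ h then {m} else ∅) ∪ b.image (· + 1) ∪ S.filter (m + i < ·)

lemma sum_powerset_Ico_succ (m i : ℕ) (f : Finset ℕ → R) :
    ∑ h ∈ (Ico m (m + (i + 1))).powerset, f h = ∑ ρ : Bool, ∑ h ∈ (Ico m (m + i)).powerset,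
      f (h ∪ if ρ then {m + i} else ∅) := by
  have : Ico m (m + (i + 1)) = insert (m + i) (Ico m (m + i)) := by
    ext x; simp only [mem_Ico, mem_insert]; omega
  rw [this, sum_powerset_insert (by simp)]
  simp only [Fintype.sum_bool, if_true, union_singleton, Bool.false_eq_true, if_false, union_empty]
  rw [add_comm]

lemma gates_eq_sum (m i : ℕ) (b₁ b₂ : R) (Ψ : Finset ℕ → R) (S : Finset ℕ) :
    gates m b₁ b₂ i Ψ S = ∑ h ∈ (Ico m (m + i)).powerset, ∑ b ∈ (Ico m (m + i)).powerset,
      rowWeight (freeWeights b₁ b₂) m (m + i) (h ∪ S.filter (· = m + i)) S b *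
        Ψ (rowInput m i (h ∪ S.filter (· = m + i)) b S) := by
  induction i generalizing S with
  | zero =>
    have : rowInput m 0 (∅ ∪ S.filter (· = m + 0)) ∅ S = S := by
      ext x
      simp only [rowInput, mem_union, mem_filter, image_empty, notMem_empty, empty_union, add_zero]
      rcases lt_trichotomy x m with hx | rfl | hx
      · simp [hx, asymm hx]
        intro h; split_ifs at h <;> simp_all
      · by_cases hxS : x ∈ S <;> simp [hxS]
      · simp [hx, asymm hx]
        split_ifs <;> simp_all [hx.ne']
    simp [gates, rowWeight]
    simpa using (congrArg Ψ this).symm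
  | succ i ih =>
    rw [gates, gate_eq_sum, sum_powerset_Ico_succ]
    simp only [sum_powerset_Ico_succ]
    refine sum_congr rfl fun ρ _ => ?_
    rw [sum_comm]
    refine sum_congr rfl fun β _ => ?_
    rw [ih, mul_sum]
    refine sum_congr rfl fun h hh => ?_
    rw [mul_sum]
    refine sum_congr rfl fun b hb => ?_
    rw [← mul_assoc]
    have hh' : ∀ x ∈ h, m ≤ x ∧ x < m + i := fun x hx => mem_Ico.1 (mem_powerset.1 hh hx)
    have hb' : ∀ x ∈ b, m ≤ x ∧ x < m + i := fun x hx => mem_Ico.1 (mem_powerset.1 hb hx)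
    have k1 : m + i ∉ h := fun hx => by have := hh' _ hx; omega
    have k2 : m + i + 1 ∉ h := fun hx => by have := hh' _ hx; omega
    have k3 : m + i ∉ b := fun hx => by have := hb' _ hx; omega
    congr 1
    · rw [rowWeight, rowWeight, ← add_assoc, prod_Ico_succ_top (by omega), mul_comm]
      congr 1
      · refine prod_congr rfl fun c hc => ?_
        have hc' := mem_Ico.1 hc
        congr 1 <;> rw [decide_eq_decide] <;>
          simp only [mem_union, mem_filter, mem_setPair, mem_ite_singleton] <;> grind
      · congr 1
        · rw [decide_eq_decide]
          simp only [mem_union, mem_filter, mem_ite_singleton]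
          grind
        · cases ρ <;> simp [k1]
        · cases β <;> simp [k3]
    · congr 1
      ext x
      simp only [rowInput, mem_union, mem_filter, mem_image, mem_setPair, mem_ite_singleton]
      grind

lemma filter_eq_empty_of_lt {S : Finset ℕ} {M : ℕ} (hS : ∀ s ∈ S, s < M) :
    S.filter (· = M) = ∅ :=
  filter_eq_empty_iff.2 fun s hs => (hS s hs).ne

lemma gates_insertSite_eq_sum (m i : ℕ) (b₁ b₂ : R) (ε : Prop) [Decidable ε] (Φ : Finset ℕ → R)
    {S : Finset ℕ} (hS : ∀ s ∈ S, s < m + i) :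
    gates m b₁ b₂ i (insertSite m ε Φ) S =
      ∑ h ∈ (Ico m (m + i)).powerset, ∑ b ∈ (Ico m (m + i)).powerset,
        rowWeight (freeWeights b₁ b₂) m (m + i) h S b *
          (if (m ∈ h ↔ ε) then Φ (S.filter (· < m) ∪ b) else 0) := by
  rw [gates_eq_sum]
  refine sum_congr rfl fun h _ => sum_congr rfl fun b hb => ?_
  rw [filter_eq_empty_of_lt hS, union_empty, insertSite]
  have hb' : ∀ x ∈ b, m ≤ x ∧ x < m + i := fun x hx => mem_Ico.1 (mem_powerset.1 hb hx)
  have e1 : m ∈ rowInput m i h b S ↔ m ∈ h := by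
    simp only [rowInput, mem_union, mem_filter, mem_image, mem_ite_singleton]
    grind
  have e2 : unskip m (rowInput m i h b S) = S.filter (· < m) ∪ b := by
    ext x
    simp only [mem_unskip, rowInput, mem_union, mem_filter, mem_image, mem_ite_singleton, skip]
    grind
  simp only [e1, e2]

lemma gates_cornerSite_eq_sum (i : ℕ) (b₁ b₂ ℓ : R) (Φ : Finset ℕ → R)
    {S : Finset ℕ} (hS : ∀ s ∈ S, s < 1 + i) (h0 : 0 ∉ S) :
    gates 1 b₁ b₂ i (cornerSite ℓ Φ) S =
      ∑ h ∈ (Ico 1 (1 + i)).powerset, ∑ b ∈ (Ico 1 (1 + i)).powerset,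
        rowWeight (freeWeights b₁ b₂) 1 (1 + i) h S b *
          ((if 1 ∈ h then ℓ else 1) * Φ ((if 1 ∈ h then {0} else ∅) ∪ b)) := by
  rw [gates_eq_sum]
  refine sum_congr rfl fun h _ => sum_congr rfl fun b hb => ?_
  rw [filter_eq_empty_of_lt hS, union_empty, cornerSite, relabel]
  have hb' : ∀ x ∈ b, 1 ≤ x ∧ x < 1 + i := fun x hx => mem_Ico.1 (mem_powerset.1 hb hx)
  have e0 : 0 ∉ rowInput 1 i h b S := by
    simp only [rowInput, mem_union, mem_filter, mem_image, mem_ite_singleton]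
    grind
  have e1 : 1 ∈ rowInput 1 i h b S ↔ 1 ∈ h := by
    simp only [rowInput, mem_union, mem_filter, mem_image, mem_ite_singleton]
    grind
  have e2 : unskip 0 (rowInput 1 i h b S) = (if 1 ∈ h then {0} else ∅) ∪ b := by
    ext x
    simp only [mem_unskip, rowInput, mem_union, mem_filter, mem_image, mem_ite_singleton, skip]
    grind
  simp only [e0, e1, e2, if_false]

/-- A row acts on the coefficients of configurations with a given part to the right of column `m`
separately. -/
lemma gates_mul_rightSign (m i : ℕ) (b₁ b₂ : R) (Ψ : Finset ℕ → R) (S : Finset ℕ) :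
    gates m b₁ b₂ i (fun S => rightSign R S m * Ψ S) S =
      rightSign R S m * gates m b₁ b₂ i Ψ S := by
  rw [gates_eq_sum, gates_eq_sum, mul_sum]
  refine sum_congr rfl fun h _ => ?_
  rw [mul_sum]
  refine sum_congr rfl fun b hb => ?_
  have : (rowInput m i (h ∪ S.filter (· = m + i)) b S).filter (· < m) = S.filter (· < m) := by
    have hb' : ∀ x ∈ b, m ≤ x ∧ x < m + i := fun x hx => mem_Ico.1 (mem_powerset.1 hb hx)
    ext x
    simp only [rowInput, mem_union, mem_filter, mem_image, mem_ite_singleton]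
    grind
  rw [rightSign, this, rightSign]
  ring

end RowSum

/-! ### One-particle generating functions -/

section Series

open PowerSeries

variable {R : Type*} [CommRing R]

/-- The geometric series `1 / (1 - b z)`. -/
noncomputable def geometric (b : R) : R⟦X⟧ := PowerSeries.mk fun n => b ^ n

lemma geometric_eq (b : R) : geometric b = 1 + C b * X * geometric b := by
  ext n
  rcases n with _ | n
  · simp [geometric]
  · rw [mul_assoc, map_add, coeff_C_mul, coeff_succ_X_mul]
    simp [geometric, pow_succ, mul_comm, coeff_one]

lemma one_sub_mul_geometric (b : R) : (1 - C b * X) * geometric b = 1 := by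
  linear_combination geometric_eq b

/-- The part of a power series of degree less than `m`. -/
noncomputable def lowPart (m : ℕ) (f : R⟦X⟧) : R⟦X⟧ :=
  PowerSeries.mk fun k => if k < m then coeff k f else 0

lemma coeff_lowPart (m k : ℕ) (f : R⟦X⟧) :
    coeff k (lowPart m f) = if k < m then coeff k f else 0 := by
  simp [lowPart]

/-- The action of a row, whose vertices lie in the columns from `m` on, on the generating function
of a one-particle vector: multiplication by `(z + b₁) / (1 - b₂ z)` in degrees at least `m`. -/
noncomputable def rowSeries (m : ℕ) (b₁ b₂ : R) (f : R⟦X⟧) : R⟦X⟧ :=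
  lowPart m f + (X + C b₁) * geometric b₂ * (f - lowPart m f)

/-- The action of the central row, together with the corner from which it is entered. -/
noncomputable def cornerSeries (b₁ b₂ ℓ : R) (f : R⟦X⟧) : R⟦X⟧ :=
  (X + C b₁) * geometric b₂ * (f - lowPart 1 f) + C (ℓ * coeff 0 f) * X * geometric b₂

/-- The coordinates of a one-particle vector given by its generating function. -/
noncomputable def toVec (f : R⟦X⟧) (k : ℕ) : R := coeff k f

/-- The exterior product of vectors given by generating functions. -/
noncomputable def wedgeSeries (l : List R⟦X⟧) : Finset ℕ → R := wedgeList (l.map toVec)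

lemma gatesVec_eq (m : ℕ) (b₁ b₂ : R) (v : ℕ → R) (f H : R⟦X⟧) (h₀ : v m = coeff m H)
    (h₁ : ∀ s, m ≤ s → v (s + 1) = coeff s f)
    (hH : ∃ a : R, ∃ g : R⟦X⟧, H = C a * X ^ m * geometric b₂ + C (1 + b₁ * b₂) * X * g *
      geometric b₂ ∧ ∀ k, m ≤ k → coeff k g = coeff k f)
    (i s : ℕ) (hs : s < m + i) :
    gatesVec m b₁ b₂ i v s = if s < m then v s else coeff s H + b₁ * coeff s f := by
  obtain ⟨a, g, hH, hg⟩ := hH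
  have key : H = C a * X ^ m + X * (C b₂ * H + C (1 + b₁ * b₂) * g) := by
    rw [hH]
    linear_combination (C a * X ^ m + C (1 + b₁ * b₂) * X * g) * geometric_eq b₂
  rw [gatesVec_apply m b₁ b₂ v (fun k => coeff k f) (fun k => coeff k H) h₀ h₁, if_pos hs]
  intro k hk
  conv_lhs => rw [key]
  rw [map_add, coeff_succ_X_mul, map_add, coeff_C_mul, coeff_C_mul, coeff_C_mul, hg k hk,
    coeff_X_pow, if_neg (by omega), mul_zero, zero_add]

lemma gatesVec_relabel (m : ℕ) (b₁ b₂ : R) (f : R⟦X⟧) (i s : ℕ) (hs : s < m + i) :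
    gatesVec m b₁ b₂ i (relabelVec m (toVec f)) s = toVec (rowSeries m b₁ b₂ f) s := by
  set g := f - lowPart m f with hg
  have hgk : ∀ k, coeff k g = if k < m then 0 else coeff k f := by
    intro k
    rw [hg, map_sub, coeff_lowPart]
    split_ifs <;> simp
  obtain ⟨g', hg'⟩ : X ^ m ∣ g := X_pow_dvd_iff.2 fun k hk => by rw [hgk, if_pos hk]
  set H := C (1 + b₁ * b₂) * X * g * geometric b₂ with hH
  have hdvd : X ^ (m + 1) ∣ H := ⟨C (1 + b₁ * b₂) * g' * geometric b₂, by rw [hH, hg']; ring⟩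
  have hHk : ∀ k, k < m + 1 → coeff k H = 0 := X_pow_dvd_iff.1 hdvd
  rw [gatesVec_eq m b₁ b₂ _ f H _ _ ⟨0, g, by simp [hH], fun k hk => by
    rw [hgk, if_neg (by omega)]⟩ i s hs]
  · have e : rowSeries m b₁ b₂ f = lowPart m f + (H + C b₁ * g) := by
      rw [rowSeries, hH, map_add, map_one, map_mul]
      linear_combination C b₁ * g * geometric_eq b₂
    rw [toVec, e, map_add, map_add, coeff_lowPart, coeff_C_mul, hgk]
    split_ifs with h
    · simp [hHk s (by omega), relabelVec, h, toVec]
    · simp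
  · simp [relabelVec, hHk m (by omega)]
  · intro s hs
    simp [relabelVec, (show ¬ s + 1 < m by omega), (show s + 1 ≠ m by omega), toVec]

lemma gatesVec_single (m : ℕ) (b₁ b₂ : R) (i s : ℕ) (hs : s < m + i) :
    gatesVec m b₁ b₂ i (Pi.single m 1) s = toVec (X ^ m * geometric b₂) s := by
  rw [gatesVec_eq m b₁ b₂ _ 0 (X ^ m * geometric b₂) _ _ ⟨1, 0, by simp, fun k hk => by simp⟩ i s
    hs]
  · split_ifs with h
    · simp [toVec, coeff_X_pow_mul', h.ne, not_le.2 h]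
    · simp [toVec]
  · simp [coeff_X_pow_mul', geometric]
  · intro s hs
    simp [(show s + 1 ≠ m by omega)]

lemma gatesVec_corner (b₁ b₂ ℓ : R) (f : R⟦X⟧) (i s : ℕ) (hs : s < 1 + i) :
    gatesVec 1 b₁ b₂ i (cornerVec ℓ (toVec f)) s = toVec (cornerSeries b₁ b₂ ℓ f) s := by
  set g := f - lowPart 1 f with hg
  have hgk : ∀ k, coeff k g = if k < 1 then 0 else coeff k f := by
    intro k
    rw [hg, map_sub, coeff_lowPart]
    split_ifs <;> simp
  obtain ⟨g', hg'⟩ : X ^ 1 ∣ g := X_pow_dvd_iff.2 fun k hk => by rw [hgk, if_pos hk]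
  set H := C (ℓ * coeff 0 f) * X ^ 1 * geometric b₂ + C (1 + b₁ * b₂) * X * g * geometric b₂
    with hH
  have hH' : H = X * (C (ℓ * coeff 0 f) * geometric b₂ +
      X * (C (1 + b₁ * b₂) * g' * geometric b₂)) := by rw [hH, hg']; ring
  have hH1 : coeff 1 H = ℓ * coeff 0 f := by
    rw [hH', show (1 : ℕ) = 0 + 1 from rfl, coeff_succ_X_mul, map_add, coeff_zero_X_mul,
      coeff_C_mul]
    simp [geometric]
  rw [gatesVec_eq 1 b₁ b₂ _ f H _ _ ⟨ℓ * coeff 0 f, g, hH, fun k hk => by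
    rw [hgk, if_neg (by omega)]⟩ i s hs]
  · have e : cornerSeries b₁ b₂ ℓ f = H + C b₁ * g := by
      rw [cornerSeries, hH, map_add, map_one, map_mul C b₁ b₂]
      linear_combination C b₁ * g * geometric_eq b₂
    rw [toVec, e, map_add (coeff s) H, coeff_C_mul, hgk]
    split_ifs with h
    · obtain rfl : s = 0 := by omega
      rw [hH', coeff_zero_X_mul]
      simp [cornerVec, relabelVec]
    · rfl
  · simp [cornerVec, relabelVec, hH1, toVec]
  · intro s hs
    simp [cornerVec, relabelVec, (show s ≠ 0 by omega), toVec]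

lemma wedgeList_map_congr {g : (ℕ → R) → ℕ → R} {g' : R⟦X⟧ → R⟦X⟧} {M : ℕ}
    (h : ∀ f, ∀ s < M, g (toVec f) s = toVec (g' f) s) {S : Finset ℕ} (hS : ∀ s ∈ S, s < M)
    (l : List R⟦X⟧) {l₁ l₂ : List (ℕ → R)}
    (h' : List.Forall₂ (fun v w => ∀ s ∈ S, v s = w s) l₁ l₂) :
    wedgeList ((l.map toVec).map g ++ l₁) S = wedgeList ((l.map g').map toVec ++ l₂) S := by
  refine wedgeList_congr (List.rel_append ?_ h')
  rw [List.map_map, List.map_map, List.forall₂_map_left_iff, List.forall₂_map_right_iff,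
    List.forall₂_same]
  exact fun f _ s hs => h f s (hS s hs)

variable {m i : ℕ} {S : Finset ℕ}

/-- A row whose right end carries no particle. -/
lemma gates_insertSite_false (hS : ∀ s ∈ S, s < m + i) (b₁ b₂ : R) (l : List R⟦X⟧) :
    gates m b₁ b₂ i (insertSite m False (wedgeSeries l)) S =
      wedgeSeries (l.map (rowSeries m b₁ b₂)) S := by
  rw [insertSite_false, wedgeSeries, wedgeSeries, (isSecondQuantization_relabel m).wedgeList,
    (isSecondQuantization_gates m i b₁ b₂).wedgeList, List.map_map]
  have := wedgeList_map_congr (g := gatesVec m b₁ b₂ i ∘ relabelVec m)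
    (g' := rowSeries m b₁ b₂) (fun f s hs => gatesVec_relabel m b₁ b₂ f i s hs) hS l
    List.Forall₂.nil
  simpa using this

/-- A row whose right end carries a particle. -/
lemma gates_insertSite_true (hS : ∀ s ∈ S, s < m + i) (b₁ b₂ : R) (l : List R⟦X⟧) :
    gates m b₁ b₂ i (insertSite m True (wedgeSeries l)) S =
      rightSign R S m *
        wedgeSeries (l.map (rowSeries m b₁ b₂) ++ [X ^ m * geometric b₂]) S := by
  have h1 : insertSite m True (wedgeSeries l) = fun S => rightSign R S m *
      wedgeList ((l.map toVec).map (relabelVec m) ++ [Pi.single m 1]) S := by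
    funext S
    rw [insertSite_true, wedgeSeries, (isSecondQuantization_relabel m).wedgeList,
      wedgeList_concat]
  rw [h1, gates_mul_rightSign, (isSecondQuantization_gates m i b₁ b₂).wedgeList, wedgeSeries,
    List.map_append, List.map_append, List.map_map]
  congr 1
  refine wedgeList_map_congr (g := gatesVec m b₁ b₂ i ∘ relabelVec m)
    (g' := rowSeries m b₁ b₂) (fun f s hs => gatesVec_relabel m b₁ b₂ f i s hs) hS l
    (List.Forall₂.cons (fun s hs => ?_) List.Forall₂.nil)
  exact gatesVec_single m b₁ b₂ i s (hS s hs)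

/-- The central row, entered from the corner. -/
lemma gates_cornerSite (hS : ∀ s ∈ S, s < 1 + i) (b₁ b₂ ℓ : R) (l : List R⟦X⟧) :
    gates 1 b₁ b₂ i (cornerSite ℓ (wedgeSeries l)) S =
      wedgeSeries (l.map (cornerSeries b₁ b₂ ℓ)) S := by
  rw [wedgeSeries, wedgeSeries, (isSecondQuantization_cornerSite ℓ).wedgeList,
    (isSecondQuantization_gates 1 i b₁ b₂).wedgeList, List.map_map]
  have := wedgeList_map_congr (g := gatesVec 1 b₁ b₂ i ∘ cornerVec ℓ)
    (g' := cornerSeries b₁ b₂ ℓ) (fun f s hs => gatesVec_corner b₁ b₂ ℓ f i s hs) hS l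
    List.Forall₂.nil
  simpa using this

lemma wedgeSeries_merge (l l' : List R⟦X⟧) (f g : R⟦X⟧) (c d : R) :
    c • wedgeSeries (l ++ f :: l') + d • wedgeSeries (l ++ l' ++ [g]) =
      wedgeSeries (l ++ (C c * f + C (d * (-1) ^ l'.length) * g) :: l') := by
  have e : toVec (C c * f + C (d * (-1) ^ l'.length) * g) =
      c • toVec f + (d * (-1) ^ (l'.map toVec).length) • toVec g := by
    funext k
    simp only [toVec, map_add, coeff_C_mul, List.length_map, Pi.add_apply, Pi.smul_apply,
      smul_eq_mul]
  simp only [wedgeSeries, List.map_append, List.map_cons, List.map_nil, e]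
  exact wedgeList_merge _ _ _ _ _ _

end Series

/-! ### Transfer operators -/

section Transfer

variable {R σ δ : Type*} [CommRing R]

/-- A transfer operator: the sum over all data `d` of a row, where `wt S d` is the weight of the row
below the configuration `S`, and `nx S d` is the configuration below the row. -/
def transfer (D : Finset δ) (wt : σ → δ → R) (nx : σ → δ → σ) (Φ : σ → R) (S : σ) : R :=
  ∑ d ∈ D, wt S d * Φ (nx S d)

/-- The composition of the `c` operators `T r, T (r + 1), …`, the last of which is applied first. -/
def compose {α : Type*} (T : ℕ → α → α) : ℕ → ℕ → α → α
  | _, 0 => id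
  | r, c + 1 => T r ∘ compose T (r + 1) c

lemma compose_succ' {α : Type*} (T : ℕ → α → α) (r c : ℕ) :
    compose T r (c + 1) = compose T r c ∘ T (r + c) := by
  induction c generalizing r with
  | zero => rfl
  | succ c ih =>
    rw [compose, ih (r + 1), ← Function.comp_assoc, ← compose, show r + 1 + c = r + (c + 1) by ring]

/-- The value of a tuple at a natural number, or the default value if it is out of range. -/
def extend [Inhabited δ] {c : ℕ} (d : Fin c → δ) (i : ℕ) : δ := if h : i < c then d ⟨i, h⟩ else default

lemma extend_cons_zero [Inhabited δ] {c : ℕ} (a : δ) (d : Fin c → δ) :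
    extend (Fin.cons a d : Fin (c + 1) → δ) 0 = a := by
  simp [extend]

lemma extend_cons_succ [Inhabited δ] {c : ℕ} (a : δ) (d : Fin c → δ) (i : ℕ) :
    extend (Fin.cons a d : Fin (c + 1) → δ) (i + 1) = extend d i := by
  unfold extend
  by_cases h : i < c
  · have h' : i + 1 < c + 1 := by omega
    rw [dif_pos h, dif_pos h']
    exact Fin.cons_succ (α := fun _ => δ) a d ⟨i, h⟩
  · rw [dif_neg h, dif_neg (by omega)]

/-- The successive configurations between the rows `r, r + 1, …`, from top to bottom. -/
def levels (nx : ℕ → σ → δ → σ) (r : ℕ) (S : σ) (d : ℕ → δ) : ℕ → σ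
  | 0 => S
  | i + 1 => nx (r + i) (levels nx r S d i) (d i)

lemma levels_cons [Inhabited δ] (nx : ℕ → σ → δ → σ) (r : ℕ) (S : σ) {c : ℕ} (a : δ)
    (d : Fin c → δ) (i : ℕ) :
    levels nx r S (extend (Fin.cons a d : Fin (c + 1) → δ)) (i + 1) =
      levels nx (r + 1) (nx r S a) (extend d) i := by
  induction i with
  | zero => simp [levels, extend_cons_zero]
  | succ i ih =>
    rw [levels, ih, extend_cons_succ, levels, show r + (i + 1) = r + 1 + i by ring]

lemma sum_piFinset_succ {c : ℕ} [DecidableEq δ] (D : Fin (c + 1) → Finset δ)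
    (f : (Fin (c + 1) → δ) → R) :
    ∑ d ∈ Fintype.piFinset D, f d =
      ∑ a ∈ D 0, ∑ d ∈ Fintype.piFinset (fun i => D (Fin.succ i)), f (Fin.cons a d) := by
  rw [← sum_product']
  refine sum_nbij' (fun d => (d 0, Fin.tail d)) (fun p => Fin.cons p.1 p.2) ?_ ?_ ?_ ?_ ?_
  · intro d hd
    rw [Fintype.mem_piFinset] at hd
    simp only [mem_product, Fintype.mem_piFinset]
    exact ⟨hd 0, fun i => hd i.succ⟩
  · rintro ⟨a, d⟩ h
    simp only [mem_product, Fintype.mem_piFinset] at h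
    rw [Fintype.mem_piFinset]
    intro i
    refine Fin.cases ?_ (fun i => ?_) i
    · exact h.1
    · exact h.2 i
  · intro d _; exact Fin.cons_self_tail d
  · rintro ⟨a, d⟩ _; simp
  · intro d _; rw [Fin.cons_self_tail]

lemma compose_transfer_eq_sum [Inhabited δ] [DecidableEq δ] (D : ℕ → Finset δ)
    (wt : ℕ → σ → δ → R) (nx : ℕ → σ → δ → σ) (r c : ℕ) (Φ : σ → R) (S : σ) :
    compose (fun r => transfer (D r) (wt r) (nx r)) r c Φ S =
      ∑ d ∈ Fintype.piFinset (fun i : Fin c => D (r + i)),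
        (∏ i ∈ range c, wt (r + i) (levels nx r S (extend d) i) (extend d i)) *
          Φ (levels nx r S (extend d) c) := by
  induction c generalizing r S with
  | zero => simp [compose, levels]
  | succ c ih =>
    rw [sum_piFinset_succ, compose, Function.comp, transfer]
    refine sum_congr (by simp) fun a _ => ?_
    rw [ih, mul_sum]
    refine sum_congr ?_ fun d _ => ?_
    · congr 1; funext i
      rw [Fin.val_succ, show r + 1 + (i : ℕ) = r + (i + 1) by ring]
    · rw [prod_range_succ', levels_cons, extend_cons_zero, ← mul_assoc, mul_comm (wt r S a)]
      congr 2
      refine prod_congr rfl fun i _ => ?_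
      rw [levels_cons, extend_cons_succ, show r + (i + 1) = r + 1 + i by ring]

end Transfer

/-! ### The partition function in terms of row operators -/

section Rows

variable {R : Type*} [CommRing R] (F : Family) (n L : ℕ)

/-- The right end of row `r` carries a particle, if `E` is the set of those `j` for which the arrow
of the `j`-th bend runs upwards. -/
def rightEnd (E : Finset ℕ) (r : ℕ) : Prop :=
  if r < n then r ∈ E else if numRows F n - 1 - r < n then numRows F n - 1 - r ∉ E else F = .BC

instance (E : Finset ℕ) (r : ℕ) : Decidable (rightEnd F n E r) := by
  unfold rightEnd; infer_instance

/-- The row which is entered from the corner of `ℭ`. -/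
def isCorner (r : ℕ) : Prop := F = .C ∧ r = n

instance (r : ℕ) : Decidable (isCorner F n r) := by unfold isCorner; infer_instance

/-- The possible particles on the horizontal edges and the bottom edges of row `r`. -/
def rowData (E : Finset ℕ) (r : ℕ) : Finset (Finset ℕ × Finset ℕ) :=
  ((Ico (lastColumn F n r) (L + 1)).powerset ×ˢ (Ico (lastColumn F n r) (L + 1)).powerset).filter
    fun d => isCorner F n r ∨ (lastColumn F n r ∈ d.1 ↔ rightEnd F n E r)

/-- The configuration below row `r`. -/
def rowNext (r : ℕ) (S : Finset ℕ) (d : Finset ℕ × Finset ℕ) : Finset ℕ :=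
  (if isCorner F n r then (if 1 ∈ d.1 then {0} else ∅) else S.filter (· < lastColumn F n r)) ∪ d.2

/-- The weight of row `r`, including the corner. -/
def fullRowWeight (W : BoltzmannWeights R n) (r : ℕ) (S : Finset ℕ) (d : Finset ℕ × Finset ℕ) : R :=
  rowWeight (W.atRow F r) (lastColumn F n r) (L + 1) d.1 S d.2 *
    (if isCorner F n r then (if 1 ∈ d.1 then W.cornerL else W.cornerR) else 1)

/-- The transfer operator of row `r`. -/
def rowTransfer (W : BoltzmannWeights R n) (E : Finset ℕ) (r : ℕ) :
    (Finset ℕ → R) → Finset ℕ → R :=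
  transfer (rowData F n L E r) (fullRowWeight F n L W r) (rowNext F n r)

variable {F n L}

lemma firstRow_le_iff {k r : ℕ} (hk : k ∈ columns F L) :
    firstRow F n k ≤ r ↔ lastColumn F n r ≤ k := by
  cases F <;> simp [columns, firstRow, lastColumn, halfColumn, minColumn, centralRows] at hk ⊢ <;>
    (try split_ifs) <;> omega

lemma mem_rowNext_of_le {r k : ℕ} {S : Finset ℕ} {d : Finset ℕ × Finset ℕ}
    (hk : lastColumn F n r ≤ k) : k ∈ rowNext F n r S d ↔ k ∈ d.2 := by
  unfold rowNext
  split_ifs with h h1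
  · have : k ≠ 0 := by
      rintro rfl
      obtain ⟨rfl, rfl⟩ := h
      simp [lastColumn, halfColumn, centralRows] at hk
    simp [this]
  · simp
  · simp [not_lt.2 hk]

/-- The state `(H, V)` and the row data `d` describe the same configuration, if the top of the
lattice is `S`. -/
structure Compatible (F : Family) (n L : ℕ) (S : Finset ℕ) (H V : Finset (ℕ × ℕ))
    (d : ℕ → Finset ℕ × Finset ℕ) : Prop where
  horizontal : ∀ r < numRows F n, ∀ e, lastColumn F n r ≤ e → e ≤ L + 1 →
    ((r, e) ∈ H ↔ e ∉ (d r).1)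
  vertical : ∀ l ≤ numRows F n, ∀ k ∈ columns F L, firstRow F n k ≤ l →
    ((l, k) ∈ V ↔ k ∉ levels (rowNext F n) 0 S d l)

variable {S : Finset ℕ} {H V : Finset (ℕ × ℕ)} {d : ℕ → Finset ℕ × Finset ℕ}

lemma mem_levels_succ {l k : ℕ} (hk : lastColumn F n l ≤ k) :
    k ∈ levels (rowNext F n) 0 S d (l + 1) ↔ k ∈ (d l).2 := by
  rw [levels, zero_add, mem_rowNext_of_le hk]

lemma columns_of_le {r k : ℕ} (h : lastColumn F n r ≤ k) (hk : k < L + 1) : k ∈ columns F L := by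
  rw [columns, mem_Icc]
  refine ⟨le_trans ?_ h, by omega⟩
  cases F <;> simp [lastColumn, halfColumn, minColumn]
  split_ifs <;> omega

lemma levels_subset (hS : ∀ k ∈ S, 1 ≤ k ∧ k ≤ L) {N : ℕ}
    (hd : ∀ r < N, (d r).2 ⊆ Ico (lastColumn F n r) (L + 1)) {l : ℕ} (hl : l ≤ N) :
    levels (rowNext F n) 0 S d l ⊆ columns F L := by
  induction l with
  | zero =>
    intro k hk
    have := hS k hk
    rw [columns, mem_Icc]
    cases F <;> simp [minColumn] <;> omega
  | succ l ih =>
    intro k hk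
    rw [levels, zero_add, rowNext, mem_union] at hk
    rcases hk with hk | hk
    · split_ifs at hk with h h1
      · rw [mem_singleton.1 hk, h.1]
        simp [columns, minColumn]
      · simp at hk
      · exact ih (by omega) (mem_of_mem_filter _ hk)
    · have := mem_Ico.1 (hd l hl hk)
      exact columns_of_le this.1 this.2

/-- Above the bottom half of the lattice, the occupation of a half column which does not start at
a corner is fixed. -/
lemma mem_levels_of_lt (hF : F ≠ .C) {k l : ℕ} (hl : l ≤ firstRow F n k)
    (hk : k ∈ columns F L)
    (hd : ∀ r < l, (d r).2 ⊆ Ico (lastColumn F n r) (L + 1)) :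
    k ∈ levels (rowNext F n) 0 S d l ↔ k ∈ S := by
  induction l with
  | zero => rfl
  | succ l ih =>
    have h1 : ¬ lastColumn F n l ≤ k := by
      rw [← firstRow_le_iff hk]; omega
    have h2 : k ∉ (d l).2 := fun h => h1 (mem_Ico.1 (hd l (by omega) h)).1
    have h3 : ¬ isCorner F n l := fun h => hF h.1
    rw [levels, zero_add, rowNext, if_neg h3, mem_union, mem_filter]
    simp only [h2, not_le.1 h1, or_false, and_true]
    exact ih (by omega) fun r hr => hd r (by omega)

lemma prod_vertices (f : ℕ → ℕ → R) :
    ∏ v ∈ vertices F n L, f v.1 v.2 =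
      ∏ r ∈ range (numRows F n), ∏ k ∈ Ico (lastColumn F n r) (L + 1), f r k := by
  rw [vertices, prod_filter, prod_product]
  refine prod_congr rfl fun r _ => ?_
  rw [← prod_filter]
  refine prod_congr ?_ fun _ _ => rfl
  ext k
  simp only [mem_filter, mem_Ico]
  constructor
  · rintro ⟨hk, h⟩
    exact ⟨(firstRow_le_iff hk).1 h, by have := mem_Icc.1 hk; omega⟩
  · rintro ⟨h, hk⟩
    have := columns_of_le h hk
    exact ⟨this, (firstRow_le_iff this).2 h⟩

lemma vertexWeight_of_compatible (hc : Compatible F n L S H V d) (w : VertexWeights R) {r k : ℕ}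
    (hr : r < numRows F n) (h : lastColumn F n r ≤ k) (hk : k < L + 1) :
    vertexWeight w H V r k = localWeight w (decide (k + 1 ∈ (d r).1)) (decide (k ∈ (d r).1))
      (decide (k ∈ levels (rowNext F n) 0 S d r)) (decide (k ∈ (d r).2)) := by
  have hcol := columns_of_le h hk
  have hf := (firstRow_le_iff (n := n) hcol).2 h
  rw [vertexWeight_eq_localWeight]
  congr 1 <;> rw [decide_eq_decide]
  · rw [hc.horizontal r hr (k + 1) (by omega) (by omega), not_not]
  · rw [hc.horizontal r hr k h (by omega), not_not]
  · rw [hc.vertical r (by omega) k hcol hf, not_not]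
  · rw [hc.vertical (r + 1) (by omega) k hcol (by omega), not_not, mem_levels_succ h]

lemma stateWeight_of_compatible (hc : Compatible F n L S H V d) (W : BoltzmannWeights R n)
    {E : Finset ℕ} (hm : ∀ r < numRows F n, lastColumn F n r ≤ L + 1)
    (hE : ∀ j < n, ((j, lastColumn F n j) ∈ H ↔ j ∉ E)) :
    stateWeight W F L H V = (∏ j : Fin n, if (j : ℕ) ∈ E then W.U j else W.D j) *
      ∏ r ∈ range (numRows F n), fullRowWeight F n L W r (levels (rowNext F n) 0 S d r) (d r) := by
  have h1 : ∏ v ∈ vertices F n L, vertexWeight (W.atRow F v.1) H V v.1 v.2 =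
      ∏ r ∈ range (numRows F n), rowWeight (W.atRow F r) (lastColumn F n r) (L + 1) (d r).1
        (levels (rowNext F n) 0 S d r) (d r).2 := by
    rw [prod_vertices (fun r k => vertexWeight (W.atRow F r) H V r k)]
    refine prod_congr rfl fun r hr => prod_congr rfl fun k hk => ?_
    have hk' := mem_Ico.1 hk
    exact vertexWeight_of_compatible hc _ (mem_range.1 hr) hk'.1 hk'.2
  have h2 : (∏ j : Fin n, if ((j : ℕ), lastColumn F n j) ∈ H then W.D j else W.U j) =
      ∏ j : Fin n, if (j : ℕ) ∈ E then W.U j else W.D j := by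
    refine prod_congr rfl fun j _ => ?_
    simp only [hE j j.2]
    split_ifs <;> rfl
  have h3 : (if F = .C then (if (n, lastColumn F n n) ∈ H then W.cornerR else W.cornerL) else 1) =
      ∏ r ∈ range (numRows F n),
        (if isCorner F n r then (if 1 ∈ (d r).1 then W.cornerL else W.cornerR) else 1) := by
    by_cases hF : F = .C
    · subst hF
      have hn : n < numRows .C n := by simp [numRows, centralRows]; omega
      rw [prod_eq_single_of_mem n (mem_range.2 hn)]
      · have := hc.horizontal n hn (lastColumn .C n n) le_rfl (hm n hn)
        have e : lastColumn .C n n = 1 := by simp [lastColumn, halfColumn, centralRows]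
        rw [e] at this ⊢
        by_cases h : 1 ∈ (d n).1 <;> simp [h, this, isCorner]
      · intro r _ hr
        simp [isCorner, hr]
    · rw [if_neg hF]
      symm
      exact prod_eq_one fun r _ => by simp [isCorner, hF]
  rw [stateWeight, h1, h2, h3]
  simp only [fullRowWeight, prod_mul_distrib]
  ring

lemma inDegree_eq_outDegree_of_ne_zero {w : VertexWeights R} {r k : ℕ}
    (h : vertexWeight w H V r k ≠ 0) : inDegree H V r k = outDegree H V r k := by
  unfold vertexWeight at h
  unfold inDegree outDegree
  by_cases h₁ : (r, k + 1) ∈ H <;> by_cases h₂ : (r, k) ∈ H <;> by_cases h₃ : (r, k) ∈ V <;>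
    by_cases h₄ : (r + 1, k) ∈ V <;> simp_all

end Rows

section Rows

variable {R : Type*} [CommRing R] {F : Family} {n : ℕ}

/-- The row data of a state. -/
def stateData (F : Family) (n L : ℕ) (H V : Finset (ℕ × ℕ)) (r : ℕ) : Finset ℕ × Finset ℕ :=
  ((Ico (lastColumn F n r) (L + 1)).filter fun e => (r, e) ∉ H,
    (Ico (lastColumn F n r) (L + 1)).filter fun k => (r + 1, k) ∉ V)

lemma halfColumn_of_firstRow {k l : ℕ} (h : firstRow F n k = l + 1) :
    l + 1 = n + centralRows F ∧ halfColumn F = some k := by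
  unfold firstRow at h
  split_ifs at h with h1
  exact ⟨h.symm, h1⟩

lemma compatible_stateData {p : ℕ} {lam : Fin p → ℕ}
    {H V : Finset (ℕ × ℕ)} {d : ℕ → Finset ℕ × Finset ℕ}
    (hm : ∀ r < numRows F n, lastColumn F n r ≤ greatestPart lam + 1)
    (ha : Admissible F n lam H V)
    (hd : ∀ r < numRows F n, d r = stateData F n (greatestPart lam) H V r) :
    Compatible F n (greatestPart lam) (univ.image lam) H V d := by
  set L := greatestPart lam with hL
  have hh : ∀ r < numRows F n, ∀ e, lastColumn F n r ≤ e → e ≤ L + 1 →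
      ((r, e) ∈ H ↔ e ∉ (d r).1) := by
    intro r hr e he he'
    rw [hd r hr]
    simp only [stateData, mem_filter, mem_Ico, not_and, not_not]
    rcases (show e < L + 1 ∨ e = L + 1 by omega) with h | rfl
    · exact ⟨fun h' _ => h', fun h' => h' ⟨he, h⟩⟩
    · exact ⟨fun _ h' => absurd h'.2 (lt_irrefl _), fun _ => ha.left r (mem_range.2 hr)⟩
  have hb : ∀ r < numRows F n, (d r).2 ⊆ Ico (lastColumn F n r) (L + 1) := by
    intro r hr
    rw [hd r hr]
    exact filter_subset _ _
  refine ⟨hh, ?_⟩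
  intro l hl k hk hf
  have htop : ¬(F = .C ∧ k = 0) → ((firstRow F n k, k) ∈ V ↔ k ∉ univ.image lam) := by
    intro h
    rw [ha.top k hk h]
    simp
  rcases l with _ | l
  · have h0 : firstRow F n k = 0 := by omega
    rw [h0] at htop
    refine htop ?_
    rintro ⟨rfl, rfl⟩
    simp [firstRow, halfColumn, centralRows] at h0
  · by_cases hf' : firstRow F n k ≤ l
    · have hle := (firstRow_le_iff hk).1 hf'
      have := mem_Icc.1 hk
      rw [mem_levels_succ hle, hd l (by omega)]
      simp only [stateData, mem_filter, mem_Ico, not_and, not_not]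
      exact ⟨fun h _ => h, fun h => h ⟨hle, by omega⟩⟩
    · have he : firstRow F n k = l + 1 := by omega
      by_cases hC : F = .C
      · subst hC
        obtain ⟨h1, h2⟩ := halfColumn_of_firstRow he
        simp only [halfColumn, Option.some.injEq, centralRows] at h1 h2
        subst h2
        obtain rfl : l = n := by omega
        have e1 : lastColumn .C l l = 1 := by simp [lastColumn, halfColumn, centralRows]
        have h3 := ha.corner rfl
        have h4 := hh l hl 1 e1.le (by omega)
        have h5 : 0 ∉ (d l).2 := fun h => by
          have := mem_Ico.1 (hb l hl h)
          omega
        rw [e1] at h3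
        rw [← h3, h4, levels, zero_add, rowNext, if_pos (show isCorner .C l l from ⟨rfl, rfl⟩),
          mem_union]
        simp only [h5, or_false, mem_ite_singleton, true_and]
      · rw [mem_levels_of_lt hC he.ge hk (fun r hr => hb r (by omega)), ← he]
        exact htop fun h => hC h.1

lemma admissible_of_compatible {p : ℕ} {lam : Fin p → ℕ} {H V : Finset (ℕ × ℕ)}
    {d : ℕ → Finset ℕ × Finset ℕ} {E : Finset ℕ} {W : BoltzmannWeights R n}
    (hc : Compatible F n (greatestPart lam) (univ.image lam) H V d)
    (hm : ∀ r < numRows F n, lastColumn F n r ≤ greatestPart lam + 1)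
    (hd : ∀ r < numRows F n, d r ∈ rowData F n (greatestPart lam) E r)
    (hbot : levels (rowNext F n) 0 (univ.image lam) d (numRows F n) = ∅)
    (hw : ∀ r < numRows F n, fullRowWeight F n (greatestPart lam) W r
      (levels (rowNext F n) 0 (univ.image lam) d r) (d r) ≠ 0) :
    Admissible F n lam H V := by
  set L := greatestPart lam with hL
  have hh : ∀ r < numRows F n, (d r).1 ⊆ Ico (lastColumn F n r) (L + 1) := fun r hr => by
    have := hd r hr
    simp only [rowData, mem_filter, mem_product, mem_powerset] at this
    exact this.1.1
  have hb : ∀ r < numRows F n, (d r).2 ⊆ Ico (lastColumn F n r) (L + 1) := fun r hr => by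
    have := hd r hr
    simp only [rowData, mem_filter, mem_product, mem_powerset] at this
    exact this.1.2
  have he : ∀ r < numRows F n, ¬ isCorner F n r →
      ((r, lastColumn F n r) ∈ H ↔ ¬ rightEnd F n E r) := fun r hr h => by
    have := hd r hr
    simp only [rowData, mem_filter, h, false_or] at this
    rw [hc.horizontal r hr _ le_rfl (hm r hr), this.2]
  constructor
  · rintro ⟨r, k⟩ hv
    simp only [vertices, mem_filter, mem_product, mem_range] at hv
    obtain ⟨⟨hr, hk⟩, hf⟩ := hv
    have hle := (firstRow_le_iff hk).1 hf
    have hlt := mem_Icc.1 hk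
    refine inDegree_eq_outDegree_of_ne_zero (w := W.atRow F r) fun h0 => hw r hr ?_
    rw [vertexWeight_of_compatible hc _ hr hle (by omega)] at h0
    rw [fullRowWeight, rowWeight, prod_eq_zero (mem_Ico.2 ⟨hle, by omega⟩) h0, zero_mul]
  · intro r hr
    rw [mem_range] at hr
    rw [hc.horizontal r hr _ (hm r hr) le_rfl]
    exact fun h => by have := mem_Ico.1 (hh r hr h); omega
  · intro k hk
    have hf : firstRow F n k ≤ numRows F n := by
      unfold firstRow numRows; split_ifs <;> omega
    rw [hc.vertical _ le_rfl k hk hf, hbot]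
    exact notMem_empty k
  · intro k hk hC
    have hf : firstRow F n k ≤ numRows F n := by
      unfold firstRow numRows; split_ifs <;> omega
    have hlev : k ∈ levels (rowNext F n) 0 (univ.image lam) d (firstRow F n k) ↔
        k ∈ univ.image lam := by
      by_cases hF : F = .C
      · have : firstRow F n k = 0 := by
          subst hF
          have : 0 ≠ k := fun h => hC ⟨rfl, h.symm⟩
          simp [firstRow, halfColumn, this]
        rw [this, levels]
      · exact mem_levels_of_lt hF le_rfl hk fun r hr => hb r (by omega)
    rw [hc.vertical _ hf k hk le_rfl, hlev]
    simp
  · intro j hj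
    rw [mem_range] at hj
    have hN : 2 * n ≤ numRows F n := by unfold numRows; omega
    have h1 := he j (by omega) (fun h => by have := h.2; omega)
    have h2 := he (numRows F n - 1 - j) (by omega) (fun h => by
      obtain ⟨rfl, h⟩ := h
      simp only [numRows, centralRows] at h
      omega)
    rw [h1, h2, rightEnd, rightEnd, if_pos hj, if_neg (by omega),
      show numRows F n - 1 - (numRows F n - 1 - j) = j by omega, if_pos hj]
    simp
  · rintro rfl
    have hN : numRows .Bstar n = 2 * n + 1 := rfl
    rw [he n (by omega) (fun h => by cases h.1), rightEnd, if_neg (by omega), if_neg (by omega)]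
    simp
  · rintro rfl
    have hN : numRows .BC n = 2 * n + 1 := rfl
    rw [he n (by omega) (fun h => by cases h.1), rightEnd, if_neg (by omega), if_neg (by omega)]
    simp
  · rintro rfl
    have hN : numRows .C n = 2 * n + 1 := rfl
    have e1 : lastColumn .C n n = 1 := by simp [lastColumn, halfColumn, centralRows]
    have h5 : 0 ∉ (d n).2 := fun h => by
      have := mem_Ico.1 (hb n (by omega) h)
      omega
    rw [hc.horizontal n (by omega) _ le_rfl (hm n (by omega)), e1,
      hc.vertical (n + 1) (by omega) 0 (by simp [columns, minColumn])
        (by simp [firstRow, halfColumn, centralRows]),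
      levels, zero_add, rowNext, if_pos (show isCorner .C n n from ⟨rfl, rfl⟩), mem_union]
    simp only [h5, or_false, mem_ite_singleton, true_and]

lemma stateData_mem_rowData {p : ℕ} {lam : Fin p → ℕ} {H V : Finset (ℕ × ℕ)} {E : Finset ℕ}
    (hm : ∀ r < numRows F n, lastColumn F n r ≤ greatestPart lam + 1)
    (ha : Admissible F n lam H V) (hE : ∀ j < n, ((j, lastColumn F n j) ∈ H ↔ j ∉ E))
    {r : ℕ} (hr : r < numRows F n) :
    stateData F n (greatestPart lam) H V r ∈ rowData F n (greatestPart lam) E r := by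
  have hc := compatible_stateData hm ha (d := stateData F n (greatestPart lam) H V)
    fun _ _ => rfl
  rw [rowData, mem_filter, mem_product, mem_powerset, mem_powerset]
  refine ⟨⟨filter_subset _ _, filter_subset _ _⟩, ?_⟩
  by_cases hcor : isCorner F n r
  · exact Or.inl hcor
  right
  rw [← not_iff_not, ← hc.horizontal r hr _ le_rfl (hm r hr)]
  have hN : numRows F n = 2 * n + centralRows F := rfl
  by_cases h1 : r < n
  · rw [rightEnd, if_pos h1, hE r h1]
  · by_cases h2 : numRows F n - 1 - r < n
    · have hb := ha.bend _ (mem_range.2 h2)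
      rw [show numRows F n - 1 - (numRows F n - 1 - r) = r by omega] at hb
      have := hE _ h2
      rw [rightEnd, if_neg h1, if_pos h2]
      tauto
    · have hcen : centralRows F = 1 ∧ r = n := by
        have : centralRows F ≤ 1 := by cases F <;> simp [centralRows]
        omega
      obtain ⟨hcen, rfl⟩ := hcen
      rw [rightEnd, if_neg h1, if_neg h2]
      cases F <;> simp [centralRows] at hcen
      · simpa using ha.central_Bstar rfl
      · exact absurd ⟨rfl, rfl⟩ hcor
      · simpa using ha.central_BC rfl

/-- The partition function as a sum over the directions `E` of the bends of products of transfer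
operators. -/
theorem partitionFunction_eq_sum {p : ℕ} (lam : Fin p → ℕ) (hlam : ∀ j, 1 ≤ lam j)
    (hm : ∀ r < numRows F n, lastColumn F n r ≤ greatestPart lam + 1)
    (W : BoltzmannWeights R n) :
    partitionFunction W F lam = ∑ E ∈ (range n).powerset,
      (∏ j : Fin n, if (j : ℕ) ∈ E then W.U j else W.D j) *
        compose (rowTransfer F n (greatestPart lam) W E) 0 (numRows F n) vac
          (univ.image lam) := by
  classical
  set L := greatestPart lam with hL
  have hS : ∀ k ∈ univ.image lam, 1 ≤ k ∧ k ≤ L := by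
    intro k hk
    obtain ⟨j, -, rfl⟩ := mem_image.1 hk
    exact ⟨hlam j, le_sup (f := lam) (mem_univ j)⟩
  rw [partitionFunction, ← sum_fiberwise_of_maps_to (t := (range n).powerset)
    (g := fun s => (range n).filter fun j => (j, lastColumn F n j) ∉ s.1)
    fun s _ => mem_powerset.2 (filter_subset _ _)]
  refine sum_congr rfl fun E hE => ?_
  have hEn : ∀ j ∈ E, j < n := fun j hj => mem_range.1 (mem_powerset.1 hE hj)
  rw [show compose (rowTransfer F n L W E) = compose fun r => transfer (rowData F n L E r)
    (fullRowWeight F n L W r) (rowNext F n r) from rfl, compose_transfer_eq_sum, mul_sum]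
  -- states with the bends `E`
  have hst : ∀ s, s ∈ (states F n lam).filter
      (fun s => (range n).filter (fun j => (j, lastColumn F n j) ∉ s.1) = E) ↔
      (s.1 ⊆ horizontalEdges F n L ∧ s.2 ⊆ verticalEdges F n L) ∧ Admissible F n lam s.1 s.2 ∧
        ∀ j < n, ((j, lastColumn F n j) ∈ s.1 ↔ j ∉ E) := by
    intro s
    simp only [states, mem_filter, mem_product, mem_powerset, and_assoc]
    refine and_congr_right fun _ => and_congr_right fun _ => and_congr_right fun _ => ?_
    constructor
    · rintro rfl j hj
      simp [hj]
    · intro h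
      ext j
      simp only [mem_filter, mem_range]
      constructor
      · rintro ⟨hj, h'⟩
        rw [h j hj, not_not] at h'
        exact h'
      · intro hj
        exact ⟨hEn j hj, by rw [h j (hEn j hj), not_not]; exact hj⟩
  have hext : ∀ s : Finset (ℕ × ℕ) × Finset (ℕ × ℕ), ∀ r < numRows F n,
      extend (fun i : Fin (numRows F n) => stateData F n L s.1 s.2 i) r =
        stateData F n L s.1 s.2 r := fun s r hr => by
    rw [extend, dif_pos hr]
  have hcomp : ∀ s : Finset (ℕ × ℕ) × Finset (ℕ × ℕ), Admissible F n lam s.1 s.2 →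
      Compatible F n L (univ.image lam) s.1 s.2
      (extend fun i : Fin (numRows F n) => stateData F n L s.1 s.2 i) := fun s ha =>
    compatible_stateData hm ha (hext s)
  refine sum_bij_ne_zero (fun s _ _ => fun i => stateData F n L s.1 s.2 i) ?_ ?_ ?_ ?_
  · intro s hs _
    rw [hst] at hs
    rw [Fintype.mem_piFinset]
    intro i
    rw [zero_add]
    exact stateData_mem_rowData hm hs.2.1 hs.2.2 i.2
  · -- a state is determined by its data
    intro s hs _ s' hs' _ h
    rw [hst] at hs hs'
    have c1 := hcomp s hs.2.1
    have c2 := hcomp s' hs'.2.1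
    have h' : (fun i : Fin (numRows F n) => stateData F n L s.1 s.2 i) =
      fun i : Fin (numRows F n) => stateData F n L s'.1 s'.2 i := h
    rw [← h'] at c2
    refine Prod.ext ?_ ?_
    · ext ⟨r, e⟩
      by_cases hmem : (r, e) ∈ horizontalEdges F n L
      · have hmem' := hmem
        simp only [horizontalEdges, mem_filter, mem_product, mem_range] at hmem'
        rw [c1.horizontal r hmem'.1.1 e hmem'.2 (by omega),
          c2.horizontal r hmem'.1.1 e hmem'.2 (by omega)]
      · exact ⟨fun h => absurd (hs.1.1 h) hmem, fun h => absurd (hs'.1.1 h) hmem⟩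
    · ext ⟨l, k⟩
      by_cases hmem : (l, k) ∈ verticalEdges F n L
      · have hmem' := hmem
        simp only [verticalEdges, mem_filter, mem_product, mem_range] at hmem'
        rw [c1.vertical l (by omega) k hmem'.1.2 hmem'.2,
          c2.vertical l (by omega) k hmem'.1.2 hmem'.2]
      · exact ⟨fun h => absurd (hs.1.2 h) hmem, fun h => absurd (hs'.1.2 h) hmem⟩
  · -- data of nonzero weight come from a state
    intro d hd hne
    rw [Fintype.mem_piFinset] at hd
    simp only [zero_add] at hd hne
    have hd' : ∀ r < numRows F n, extend d r ∈ rowData F n L E r := fun r hr => by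
      rw [extend, dif_pos hr]; exact hd ⟨r, hr⟩
    have hsub : ∀ r < numRows F n, (extend d r).1 ⊆ Ico (lastColumn F n r) (L + 1) ∧
        (extend d r).2 ⊆ Ico (lastColumn F n r) (L + 1) := fun r hr => by
      have := hd' r hr
      simp only [rowData, mem_filter, mem_product, mem_powerset] at this
      exact this.1
    set H := (horizontalEdges F n L).filter fun q => q.2 ∉ (extend d q.1).1 with hHdef
    set V := (verticalEdges F n L).filter fun q =>
      q.2 ∉ levels (rowNext F n) 0 (univ.image lam) (extend d) q.1 with hVdef
    have hc : Compatible F n L (univ.image lam) H V (extend d) := by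
      constructor
      · intro r hr e he he'
        rw [hHdef, mem_filter]
        have : (r, e) ∈ horizontalEdges F n L := by
          simp only [horizontalEdges, mem_filter, mem_product, mem_range]
          exact ⟨⟨hr, by omega⟩, he⟩
        simp [this]
      · intro l hl k hk hf
        rw [hVdef, mem_filter]
        have : (l, k) ∈ verticalEdges F n L := by
          simp only [verticalEdges, mem_filter, mem_product, mem_range]
          exact ⟨⟨by omega, hk⟩, hf⟩
        simp [this]
    have hw : ∀ r < numRows F n, fullRowWeight F n L W r
        (levels (rowNext F n) 0 (univ.image lam) (extend d) r) (extend d r) ≠ 0 := by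
      intro r hr h0
      refine hne ?_
      rw [prod_eq_zero (mem_range.2 hr) h0, zero_mul, mul_zero]
    have hbot : levels (rowNext F n) 0 (univ.image lam) (extend d) (numRows F n) = ∅ := by
      by_contra h0
      refine hne ?_
      rw [vac, if_neg h0, mul_zero, mul_zero]
    have ha : Admissible F n lam H V := admissible_of_compatible hc hm hd' hbot hw
    have hEH : ∀ j < n, ((j, lastColumn F n j) ∈ H ↔ j ∉ E) := by
      intro j hj
      have hjN : j < numRows F n := by unfold numRows; omega
      have := hd' j hjN
      have hcor : ¬ isCorner F n j := fun h => by have := h.2; omega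
      simp only [rowData, mem_filter, hcor, false_or, rightEnd, if_pos hj] at this
      rw [hc.horizontal j hjN _ le_rfl (hm j hjN), this.2]
    have hdata : (fun i : Fin (numRows F n) => stateData F n L H V i) = d := by
      funext i
      have hi : extend d i = d i := by rw [extend, dif_pos i.2]
      have hs := hsub i i.2
      rw [hi] at hs
      refine Prod.ext ?_ ?_
      · ext e
        simp only [stateData, mem_filter]
        constructor
        · rintro ⟨h, h'⟩
          rw [mem_Ico] at h
          rw [hc.horizontal i i.2 e h.1 (by omega), not_not, hi] at h'
          exact h'
        · intro h
          have h1 := hs.1 h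
          refine ⟨h1, ?_⟩
          rw [mem_Ico] at h1
          rw [hc.horizontal i i.2 e h1.1 (by omega), not_not, hi]
          exact h
      · ext k
        simp only [stateData, mem_filter]
        constructor
        · rintro ⟨h, h'⟩
          rw [mem_Ico] at h
          have hcol := columns_of_le h.1 h.2
          have hf := (firstRow_le_iff hcol).2 h.1
          rw [hc.vertical (i + 1) i.2 k hcol (by omega), not_not, mem_levels_succ h.1, hi] at h'
          exact h'
        · intro h
          have h1 := hs.2 h
          refine ⟨h1, ?_⟩
          rw [mem_Ico] at h1
          have hcol := columns_of_le h1.1 h1.2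
          have hf := (firstRow_le_iff hcol).2 h1.1
          rw [hc.vertical (i + 1) i.2 k hcol (by omega), not_not, mem_levels_succ h1.1, hi]
          exact h
    refine ⟨(H, V), (hst _).2 ⟨⟨filter_subset _ _, filter_subset _ _⟩, ha, hEH⟩, ?_, hdata⟩
    rw [stateWeight_of_compatible hc W hm hEH]
    rw [vac, if_pos hbot, mul_one] at hne
    exact hne
  · intro s hs _
    rw [hst] at hs
    have hc := hcomp s hs.2.1
    rw [stateWeight_of_compatible hc W hm hs.2.2]
    have hbot : levels (rowNext F n) 0 (univ.image lam)
        (extend fun i : Fin (numRows F n) => stateData F n L s.1 s.2 i) (numRows F n) = ∅ := by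
      rw [eq_empty_iff_forall_notMem]
      intro k hk
      have hcol : k ∈ columns F L := levels_subset hS (N := numRows F n)
        (fun r hr => by rw [hext s r hr]; exact filter_subset _ _) le_rfl hk
      have hf : firstRow F n k ≤ numRows F n := by
        unfold firstRow numRows; split_ifs <;> omega
      exact (hc.vertical _ le_rfl k hcol hf).1 (hs.2.1.bottom k hcol) hk
    simp only [zero_add]
    rw [vac, if_pos hbot, mul_one]

end Rows

/-! ### Transfer operators on exterior products -/

section TransferWedge

variable {R : Type*} [CommRing R] {F : Family} {n L : ℕ}

/-- The label of the rightmost column which meets the rows above the bottom half. -/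
def topColumn (F : Family) : ℕ :=
  match halfColumn F with
  | some l => l + 1
  | none => minColumn F

lemma lastColumn_eq (F : Family) (n r : ℕ) :
    lastColumn F n r = if r < n + centralRows F then topColumn F else minColumn F := by
  cases F <;> simp [lastColumn, topColumn, halfColumn, minColumn]

/-- The configurations which can occur above row `r`: those whose particles lie on columns of the
model, with `q` particles on the half column when `r` is in the top half. -/
def Reachable (F : Family) (n L q r : ℕ) (S : Finset ℕ) : Prop :=
  S ⊆ columns F L ∧ (r < n + centralRows F → #(S.filter (· < topColumn F)) = q)

lemma Reachable.next {q r : ℕ} {S : Finset ℕ} (h : Reachable F n L q r S) {E : Finset ℕ}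
    {d : Finset ℕ × Finset ℕ} (hd : d ∈ rowData F n L E r) :
    Reachable F n L q (r + 1) (rowNext F n r S d) := by
  simp only [rowData, mem_filter, mem_product, mem_powerset] at hd
  constructor
  · intro k hk
    rw [rowNext, mem_union] at hk
    rcases hk with hk | hk
    · split_ifs at hk with h1 h2
      · rw [mem_singleton.1 hk, h1.1]
        simp [columns, minColumn]
      · simp at hk
      · exact h.1 (mem_of_mem_filter _ hk)
    · have := mem_Ico.1 (hd.1.2 hk)
      exact columns_of_le this.1 this.2
  · intro hr
    have hcor : ¬ isCorner F n r := by
      rintro ⟨rfl, rfl⟩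
      simp [centralRows] at hr
    have hlast := lastColumn_eq F n r
    rw [if_pos (by omega)] at hlast
    rw [← h.2 (by omega), rowNext, if_neg hcor, filter_union, hlast, filter_filter]
    have : d.2.filter (· < topColumn F) = ∅ := by
      rw [filter_eq_empty_iff]
      intro k hk
      have := mem_Ico.1 (hd.1.2 hk)
      omega
    rw [this, union_empty]
    congr 1
    ext x
    simp

lemma Reachable.lt {q r : ℕ} {S : Finset ℕ} (h : Reachable F n L q r S) : ∀ s ∈ S, s < L + 1 :=
  fun s hs => by
    have := mem_Icc.1 (h.1 hs)
    omega

lemma rowTransfer_congr (W : BoltzmannWeights R n) (E : Finset ℕ) {q r : ℕ}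
    {Φ Ψ : Finset ℕ → R} (hΦ : ∀ S, Reachable F n L q (r + 1) S → Φ S = Ψ S) {S : Finset ℕ}
    (hS : Reachable F n L q r S) : rowTransfer F n L W E r Φ S = rowTransfer F n L W E r Ψ S :=
  sum_congr rfl fun _ hd => by rw [hΦ _ (hS.next hd)]

lemma rowTransfer_congr_bends (W : BoltzmannWeights R n) {E E' : Finset ℕ} {r : ℕ}
    (h : rightEnd F n E r ↔ rightEnd F n E' r) :
    rowTransfer F n L W E r = rowTransfer F n L W E' r := by
  unfold rowTransfer rowData
  simp only [h]

lemma rowTransfer_sum (W : BoltzmannWeights R n) (E : Finset ℕ) (r : ℕ) {ι : Type*} (s : Finset ι)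
    (c : ι → R) (Φ : ι → Finset ℕ → R) (S : Finset ℕ) :
    rowTransfer F n L W E r (fun S => ∑ i ∈ s, c i * Φ i S) S =
      ∑ i ∈ s, c i * rowTransfer F n L W E r (Φ i) S := by
  simp only [rowTransfer, transfer, mul_sum]
  rw [sum_comm]
  exact sum_congr rfl fun i _ => sum_congr rfl fun d _ => by ring

lemma compose_rowTransfer_congr (W : BoltzmannWeights R n) (E : Finset ℕ) {q : ℕ} (r c : ℕ)
    {Φ Ψ : Finset ℕ → R} (hΦ : ∀ S, Reachable F n L q (r + c) S → Φ S = Ψ S) {S : Finset ℕ}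
    (hS : Reachable F n L q r S) :
    compose (rowTransfer F n L W E) r c Φ S = compose (rowTransfer F n L W E) r c Ψ S := by
  induction c generalizing r S with
  | zero => exact hΦ S hS
  | succ c ih =>
    refine rowTransfer_congr W E (fun S hS => ?_) hS
    exact ih (r + 1) (by rwa [show r + 1 + c = r + (c + 1) by ring]) hS

lemma compose_congr {α : Type*} {T T' : ℕ → α → α} {r c : ℕ}
    (h : ∀ i, r ≤ i → i < r + c → T i = T' i) : compose T r c = compose T' r c := by
  induction c generalizing r with
  | zero => rfl
  | succ c ih =>
    rw [compose, compose, h r le_rfl (by omega), ih fun i hi hi' => h i (by omega) (by omega)]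

lemma rowTransfer_eq_gates (W : BoltzmannWeights R n) (E : Finset ℕ) {r : ℕ} {b₁ b₂ : R}
    (hw : W.atRow F r = freeWeights b₁ b₂) (hcor : ¬ isCorner F n r)
    (hm : lastColumn F n r ≤ L + 1) (Φ : Finset ℕ → R) {S : Finset ℕ} (hS : ∀ s ∈ S, s < L + 1) :
    rowTransfer F n L W E r Φ S =
      gates (lastColumn F n r) b₁ b₂ (L + 1 - lastColumn F n r)
        (insertSite (lastColumn F n r) (rightEnd F n E r) Φ) S := by
  have hi : lastColumn F n r + (L + 1 - lastColumn F n r) = L + 1 := by omega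
  rw [gates_insertSite_eq_sum _ _ _ _ _ _ (by rwa [hi]), hi, rowTransfer, transfer, rowData,
    sum_filter, sum_product]
  refine sum_congr rfl fun h _ => sum_congr rfl fun b _ => ?_
  simp only [hcor, false_or, fullRowWeight, if_false, mul_one, rowNext, hw]
  split_ifs <;> simp

lemma rowTransfer_eq_corner {n : ℕ} (W : BoltzmannWeights R n) (E : Finset ℕ) {b₁ b₂ : R}
    (hw : W.atRow .C n = freeWeights b₁ b₂) (hR : W.cornerR = 1) (Φ : Finset ℕ → R)
    {S : Finset ℕ} (hS : ∀ s ∈ S, s < L + 1) (h0 : 0 ∉ S) :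
    rowTransfer .C n L W E n Φ S = gates 1 b₁ b₂ L (cornerSite W.cornerL Φ) S := by
  have e1 : lastColumn .C n n = 1 := by simp [lastColumn, halfColumn, centralRows]
  have hcor : isCorner .C n n := ⟨rfl, rfl⟩
  rw [gates_cornerSite_eq_sum _ _ _ _ _ (by rwa [add_comm]) h0, rowTransfer, transfer, rowData,
    e1, add_comm 1 L, sum_filter, sum_product]
  refine sum_congr rfl fun h _ => sum_congr rfl fun b _ => ?_
  simp only [hcor, true_or, fullRowWeight, if_true, rowNext, hw, hR, e1]
  ring

/-- A row without corner on exterior products. -/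
lemma rowTransfer_wedgeSeries (W : BoltzmannWeights R n) (E : Finset ℕ) {r : ℕ} {b₁ b₂ : R}
    (hw : W.atRow F r = freeWeights b₁ b₂) (hcor : ¬ isCorner F n r)
    (hm : lastColumn F n r ≤ L + 1) (l : List (PowerSeries R)) {S : Finset ℕ}
    (hS : ∀ s ∈ S, s < L + 1) :
    rowTransfer F n L W E r (wedgeSeries l) S =
      if rightEnd F n E r then rightSign R S (lastColumn F n r) *
        wedgeSeries (l.map (rowSeries (lastColumn F n r) b₁ b₂) ++
          [PowerSeries.X ^ lastColumn F n r * geometric b₂]) S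
      else wedgeSeries (l.map (rowSeries (lastColumn F n r) b₁ b₂)) S := by
  have hi : lastColumn F n r + (L + 1 - lastColumn F n r) = L + 1 := by omega
  rw [rowTransfer_eq_gates W E hw hcor hm _ hS]
  split_ifs with h
  · rw [← gates_insertSite_true (by rwa [hi])]
    congr 2
    simp [h]
  · rw [← gates_insertSite_false (by rwa [hi])]
    congr 2
    simp [h]

end TransferWedge

/-! ### The nested sum over the bends -/

section Nested

open PowerSeries

variable {R : Type*} [CommRing R]

/-- The operator on generating functions by which the vectors below a sequence of nested pairs of
rows are transported above them.  A pair of rows is given by its weights `(b₁, b₂)` in the upper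
row, the outermost pair comes first, and `A` is the operator of the central row. -/
noncomputable def transport (mt mb : ℕ) (A : R⟦X⟧ → R⟦X⟧) : List (R × R) → R⟦X⟧ → R⟦X⟧
  | [], f => A f
  | p :: ps, f =>
    rowSeries mt p.1 p.2 (transport mt mb A ps (rowSeries mb p.2 p.1 f))

/-- The vectors created by a sequence of nested pairs of rows, where `δ` is the weight `D` of the
bends, `σ` a sign, and `G` the list of vectors created by the central row.  Each pair creates one
vector, the sum of the contributions of the two possible directions of its bend. -/
noncomputable def created (mt mb : ℕ) (δ σ : R) (A : R⟦X⟧ → R⟦X⟧) (G : List R⟦X⟧) :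
    List (R × R) → List R⟦X⟧
  | [] => G
  | p :: ps =>
    (C δ * rowSeries mt p.1 p.2 (transport mt mb A ps (X ^ mb * geometric p.1)) +
      C (σ * (-1) ^ (ps.length + G.length)) * (X ^ mt * geometric p.2)) ::
      (created mt mb δ σ A G ps).map (rowSeries mt p.1 p.2)

lemma length_created (mt mb : ℕ) (δ σ : R) (A : R⟦X⟧ → R⟦X⟧) (G : List R⟦X⟧)
    (ps : List (R × R)) : (created mt mb δ σ A G ps).length = ps.length + G.length := by
  induction ps with
  | nil => simp [created]
  | cons p ps ih => simp [created, ih]; ring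

variable {F : Family} {n L : ℕ}

/-- The sum over the directions of the bends `j, …, n - 1` of the composition of the operators of
all rows between row `j` and its mirror image maps an exterior product to an exterior product: by
induction from the innermost bend outwards, each bend transports the old factors and contributes one
new factor, since its two directions produce exterior products which differ in one vector. -/
lemma nested_sum (W : BoltzmannWeights R n) (b : ℕ → R × R) (δ : R) (q : ℕ)
    (A : R⟦X⟧ → R⟦X⟧) (G : List R⟦X⟧)
    (hm : ∀ r < numRows F n, lastColumn F n r ≤ L + 1)
    (htop : ∀ j < n, W.atRow F j = freeWeights (b j).1 (b j).2)
    (hbot : ∀ j < n, W.atRow F (numRows F n - 1 - j) = freeWeights (b j).2 (b j).1)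
    (hcen : ∀ E l S, Reachable F n L q n S →
      compose (rowTransfer F n L W E) n (centralRows F) (wedgeSeries l) S =
        wedgeSeries (l.map A ++ G) S)
    (k : ℕ) : ∀ (j : ℕ), j + k = n → ∀ (l : List R⟦X⟧) (S : Finset ℕ),
      Reachable F n L q j S →
      ∑ E ∈ (Ico j n).powerset, (∏ i ∈ Ico j n, if i ∈ E then 1 else δ) *
        compose (rowTransfer F n L W E) j (numRows F n - 2 * j) (wedgeSeries l) S =
      wedgeSeries (l.map (transport (topColumn F) (minColumn F) A ((List.range' j k).map b)) ++
        created (topColumn F) (minColumn F) δ ((-1) ^ q) A G ((List.range' j k).map b)) S := by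
  induction k with
  | zero =>
    intro j hj l S hS
    obtain rfl : j = n := by omega
    have e : numRows F j - 2 * j = centralRows F := by unfold numRows; omega
    simp only [Ico_self, powerset_empty, sum_singleton, prod_empty, one_mul, e,
      hcen ∅ l S hS, List.range'_zero, List.map_nil, created]
    rfl
  | succ k ih =>
    intro j hj l S hS
    have hjn : j < n := by omega
    have hN : numRows F n = 2 * n + centralRows F := rfl
    have hc1 : ¬ isCorner F n j := fun h => by have := h.2; omega
    have hc2 : ¬ isCorner F n (numRows F n - 1 - j) := by
      rintro ⟨rfl, h⟩
      simp only [numRows, centralRows] at h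
      omega
    have hl1 : lastColumn F n j = topColumn F := by rw [lastColumn_eq, if_pos (by omega)]
    have hl2 : lastColumn F n (numRows F n - 1 - j) = minColumn F := by
      rw [lastColumn_eq, if_neg (by omega)]
    have hIco : Ico j n = insert j (Ico (j + 1) n) := by
      ext x; simp only [mem_Ico, mem_insert]; omega
    have hjmem : j ∉ Ico (j + 1) n := by simp
    set f₁ := rowSeries (topColumn F) (b j).1 (b j).2 with hf₁
    set l' := l.map (rowSeries (minColumn F) (b j).2 (b j).1) with hl'
    set w' : R⟦X⟧ := X ^ minColumn F * geometric (b j).1 with hw'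
    -- the rows `j` and `N - 1 - j` are split off
    have hsplit : ∀ E : Finset ℕ, compose (rowTransfer F n L W E) j (numRows F n - 2 * j) =
        rowTransfer F n L W E j ∘ compose (rowTransfer F n L W E) (j + 1)
          (numRows F n - 2 * (j + 1)) ∘ rowTransfer F n L W E (numRows F n - 1 - j) := by
      intro E
      rw [show numRows F n - 2 * j = (numRows F n - 2 * (j + 1)) + 1 + 1 by omega, compose,
        compose_succ',
        show j + 1 + (numRows F n - 2 * (j + 1)) = numRows F n - 1 - j by omega]
    have hinner : ∀ (E E' : Finset ℕ), (∀ i, i ≠ j → (i ∈ E ↔ i ∈ E')) →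
        compose (rowTransfer F n L W E) (j + 1) (numRows F n - 2 * (j + 1)) =
        compose (rowTransfer F n L W E') (j + 1) (numRows F n - 2 * (j + 1)) := by
      intro E E' h
      refine compose_congr fun r hr hr' => rowTransfer_congr_bends W ?_
      unfold rightEnd
      rw [h r (by omega), h (numRows F n - 1 - r) (by omega)]
    have hbottom : ∀ (E : Finset ℕ) (S : Finset ℕ),
        Reachable F n L q (numRows F n - 1 - j) S →
        rowTransfer F n L W E (numRows F n - 1 - j) (wedgeSeries l) S =
          wedgeSeries (l' ++ if j ∈ E then [] else [w']) S := by
      intro E S hS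
      have hsign : rightSign R S (minColumn F) = 1 := by
        unfold rightSign
        rw [filter_eq_empty_iff.2, card_empty, pow_zero]
        intro s hs
        have := mem_Icc.1 (hS.1 hs)
        omega
      have hre : rightEnd F n E (numRows F n - 1 - j) ↔ j ∉ E := by
        rw [rightEnd, if_neg (by omega),
          show numRows F n - 1 - (numRows F n - 1 - j) = j by omega, if_pos hjn]
      rw [rowTransfer_wedgeSeries W E (hbot j hjn) hc2 (hm _ (by omega)) l hS.lt, hl2, hsign]
      simp only [hre]
      by_cases h : j ∈ E <;> simp [h, hl', hw']
    set B := transport (topColumn F) (minColumn F) A ((List.range' (j + 1) k).map b) with hB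
    set G' := created (topColumn F) (minColumn F) δ ((-1) ^ q) A G
      ((List.range' (j + 1) k).map b) with hG'
    -- the inner sum, for a fixed direction of the outer bend
    have hsum : ∀ E₀ : Finset ℕ, (∀ i, i ≠ j → i ∉ E₀) →
        ∑ E ∈ (Ico (j + 1) n).powerset, (∏ i ∈ Ico (j + 1) n, if i ∈ E then 1 else δ) *
          compose (rowTransfer F n L W (E₀ ∪ E)) j (numRows F n - 2 * j) (wedgeSeries l) S =
        rowTransfer F n L W E₀ j
          (wedgeSeries ((l' ++ if j ∈ E₀ then [] else [w']).map B ++ G')) S := by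
      intro E₀ hE₀
      have h1 : ∀ S, Reachable F n L q (j + 1) S →
          wedgeSeries ((l' ++ if j ∈ E₀ then [] else [w']).map B ++ G') S =
          ∑ E ∈ (Ico (j + 1) n).powerset, (∏ i ∈ Ico (j + 1) n, if i ∈ E then 1 else δ) *
            compose (rowTransfer F n L W E) (j + 1) (numRows F n - 2 * (j + 1))
              (wedgeSeries (l' ++ if j ∈ E₀ then [] else [w'])) S := fun S hS =>
        (ih (j + 1) (by omega) _ S hS).symm
      rw [rowTransfer_congr W E₀ h1 hS, rowTransfer_sum]
      refine sum_congr rfl fun E hE => ?_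
      congr 1
      have hjE : j ∉ E := fun h => hjmem (mem_powerset.1 hE h)
      rw [hsplit, Function.comp, Function.comp, rowTransfer_congr_bends W (E' := E₀)
        (by simp [rightEnd, hjn, hjE]), hinner (E₀ ∪ E) E fun i hi => by simp [hE₀ i hi]]
      refine rowTransfer_congr W E₀ (fun S hS => ?_) hS
      refine compose_rowTransfer_congr W E _ _ (fun S hS => ?_) hS
      rw [show j + 1 + (numRows F n - 2 * (j + 1)) = numRows F n - 1 - j by omega] at hS
      rw [hbottom _ S hS]
      simp [hjE]
    have hσ : rightSign R S (topColumn F) = (-1) ^ q := by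
      rw [rightSign, hS.2 (by omega)]
    have htopw : ∀ (E₀ : Finset ℕ) (l : List R⟦X⟧),
        rowTransfer F n L W E₀ j (wedgeSeries l) S =
          if j ∈ E₀ then (-1) ^ q * wedgeSeries (l.map f₁ ++
            [X ^ topColumn F * geometric (b j).2]) S else wedgeSeries (l.map f₁) S := by
      intro E₀ l
      rw [rowTransfer_wedgeSeries W E₀ (htop j hjn) hc1 (hm _ (by omega)) l hS.lt, hl1, hσ]
      simp only [show rightEnd F n E₀ j ↔ j ∈ E₀ by rw [rightEnd, if_pos hjn], hf₁]
    have hD := hsum ∅ (by simp)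
    have hU := hsum {j} (by simp)
    rw [htopw] at hD hU
    simp only [notMem_empty, if_false, empty_union, mem_singleton, if_true,
      List.append_nil] at hD hU
    rw [hIco, sum_powerset_insert hjmem]
    have e1 : ∀ E ∈ (Ico (j + 1) n).powerset,
        (∏ i ∈ insert j (Ico (j + 1) n), if i ∈ E then 1 else δ) =
          δ * ∏ i ∈ Ico (j + 1) n, if i ∈ E then 1 else δ := by
      intro E hE
      rw [prod_insert hjmem, if_neg fun h => hjmem (mem_powerset.1 hE h)]
    have e2 : ∀ E ∈ (Ico (j + 1) n).powerset,
        (∏ i ∈ insert j (Ico (j + 1) n), if i ∈ insert j E then 1 else δ) =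
          ∏ i ∈ Ico (j + 1) n, if i ∈ E then 1 else δ := by
      intro E hE
      rw [prod_insert hjmem, if_pos (mem_insert_self _ _), one_mul]
      refine prod_congr rfl fun i hi => ?_
      have : i ≠ j := fun h => hjmem (h ▸ hi)
      simp [this]
    have e3 : ∑ E ∈ (Ico (j + 1) n).powerset,
        (∏ i ∈ insert j (Ico (j + 1) n), if i ∈ E then 1 else δ) *
          compose (rowTransfer F n L W E) j (numRows F n - 2 * j) (wedgeSeries l) S =
        δ * wedgeSeries (((l' ++ [w']).map B ++ G').map f₁) S := by
      rw [← hD, mul_sum]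
      refine sum_congr rfl fun E hE => ?_
      rw [e1 E hE, mul_assoc]
    have e4 : ∑ E ∈ (Ico (j + 1) n).powerset,
        (∏ i ∈ insert j (Ico (j + 1) n), if i ∈ insert j E then 1 else δ) *
          compose (rowTransfer F n L W (insert j E)) j (numRows F n - 2 * j) (wedgeSeries l) S =
        (-1) ^ q * wedgeSeries ((l'.map B ++ G').map f₁ ++
            [X ^ topColumn F * geometric (b j).2]) S := by
      rw [← hU]
      refine sum_congr rfl fun E hE => ?_
      rw [e2 E hE, insert_eq]
    rw [e3, e4]
    have hmerge := congrFun (wedgeSeries_merge ((l'.map B).map f₁) (G'.map f₁) (f₁ (B w'))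
      (X ^ topColumn F * geometric (b j).2) δ ((-1) ^ q)) S
    simp only [Pi.add_apply, Pi.smul_apply, smul_eq_mul] at hmerge
    rw [List.range'_succ, List.map_cons, created, ← hG', ← hB]
    have hlen : ((List.range' (j + 1) k).map b).length + G.length = (G'.map f₁).length := by
      simp only [List.length_map, hG', length_created]
    rw [hlen]
    have hlist : l.map (transport (topColumn F) (minColumn F) A
        (b j :: (List.range' (j + 1) k).map b)) = (l'.map B).map f₁ := by
      simp only [hl', List.map_map]
      rfl
    rw [hlist]
    refine Eq.trans ?_ hmerge
    simp only [List.map_append, List.map_cons, List.map_nil, List.append_assoc, List.cons_append,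
      List.nil_append]

end Nested

end BentIce

namespace BentIce

open Finset PowerSeries

/-! ### The deformation weights -/

section Deformation

variable {R : Type*} [CommRing R]

/-- The weights `(b₁, b₂)` in row `j`, extended by zero. -/
def layer (I : R) {n : ℕ} (t : Fin n → R) (x : Fin n → Rˣ) (j : ℕ) : R × R :=
  if h : j < n then
    (I * t ⟨j, h⟩ * (x ⟨j, h⟩ : R), I * t ⟨j, h⟩ * ((x ⟨j, h⟩)⁻¹ : Rˣ)) else 0

/-- The weight `D` of the bends. -/
def bendWeight (I : R) (F : Family) : R :=
  match F with
  | .B | .C => I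
  | .Bstar | .Cstar | .D | .BC => 1

variable {I : R} (hI : I ^ 2 = -1) {F : Family} {n : ℕ} (t : Fin n → R) (x : Fin n → Rˣ)
  (tc xc : R)

include hI in
lemma atRow_top {j : ℕ} (hj : j < n) : (deformationWeights I F t x tc xc).atRow F j =
    freeWeights (layer I t x j).1 (layer I t x j).2 := by
  have h : 1 + I * t ⟨j, hj⟩ * (x ⟨j, hj⟩ : R) * (I * t ⟨j, hj⟩ * ((x ⟨j, hj⟩)⁻¹ : Rˣ)) =
      1 - t ⟨j, hj⟩ ^ 2 := by
    linear_combination t ⟨j, hj⟩ ^ 2 * hI + I ^ 2 * t ⟨j, hj⟩ ^ 2 * (x ⟨j, hj⟩).mul_inv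
  simp only [BoltzmannWeights.atRow, hj, dif_pos, deformationWeights, freeWeights, layer, h]

include hI in
lemma atRow_bottom {j : ℕ} (hj : j < n) :
    (deformationWeights I F t x tc xc).atRow F (numRows F n - 1 - j) =
      freeWeights (layer I t x j).2 (layer I t x j).1 := by
  have h := atRow_top (F := F) hI t x tc xc hj
  have h1 : ¬ numRows F n - 1 - j < n := by unfold numRows; omega
  have h2 : numRows F n - 1 - (numRows F n - 1 - j) = j := by unfold numRows; omega
  rw [BoltzmannWeights.atRow, dif_pos hj] at h
  rw [BoltzmannWeights.atRow, dif_neg h1]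
  simp only [h2, hj, dif_pos, h]
  simp [VertexWeights.bar, freeWeights, mul_comm]

include hI in
lemma atRow_central (hc : centralRows F = 1) :
    (deformationWeights I F t x tc xc).atRow F n = freeWeights (I * tc * xc) (I * tc * xc) := by
  have h1 : ¬ numRows F n - 1 - n < n := by unfold numRows; omega
  have h : 1 + I * tc * xc * (I * tc * xc) = 1 - tc ^ 2 * xc ^ 2 := by
    linear_combination tc ^ 2 * xc ^ 2 * hI
  rw [BoltzmannWeights.atRow, dif_neg (lt_irrefl n), dif_neg h1]
  simp only [deformationWeights, freeWeights, h]

include hI in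
/-- The partition function is a coefficient of an exterior product of vectors, one for each bend and
possibly one for the central row. -/
lemma Z_eq_wedgeSeries {p q : ℕ} (lam : Fin p → ℕ) (hlam : ∀ j, 1 ≤ lam j)
    (hm : ∀ r < numRows F n, lastColumn F n r ≤ greatestPart lam + 1)
    (hq : #((univ.image lam).filter (· < topColumn F)) = q) {σ : R} (hσ : (-1) ^ q = σ)
    (A : R⟦X⟧ → R⟦X⟧) (G : List R⟦X⟧)
    (hcen : ∀ E l S, Reachable F n (greatestPart lam) q n S →
      compose (rowTransfer F n (greatestPart lam) (deformationWeights I F t x tc xc) E) n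
        (centralRows F) (wedgeSeries l) S = wedgeSeries (l.map A ++ G) S) :
    Z I F t x tc xc lam = wedgeSeries (created (topColumn F) (minColumn F) (bendWeight I F)
      σ A G ((List.range' 0 n).map (layer I t x))) (univ.image lam) := by
  have hS : Reachable F n (greatestPart lam) q 0 (univ.image lam) := by
    refine ⟨fun k hk => ?_, fun _ => hq⟩
    obtain ⟨j, -, rfl⟩ := mem_image.1 hk
    rw [columns, mem_Icc]
    refine ⟨le_trans ?_ (hlam j), le_sup (f := lam) (mem_univ j)⟩
    cases F <;> simp [minColumn]
  have := nested_sum (deformationWeights I F t x tc xc) (layer I t x) (bendWeight I F) q A G hm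
    (fun j hj => atRow_top hI t x tc xc hj) (fun j hj => atRow_bottom hI t x tc xc hj) hcen n 0
    (zero_add n) [] _ hS
  simp only [List.map_nil, List.nil_append] at this
  rw [Z, partitionFunction_eq_sum lam hlam hm, ← hσ, ← this, ← range_eq_Ico]
  refine sum_congr rfl fun E _ => ?_
  congr 1
  rw [prod_range]
  refine prod_congr rfl fun i _ => ?_
  cases F <;> rfl

lemma compose_one (W : BoltzmannWeights R n) (E : Finset ℕ) (L r : ℕ) :
    compose (rowTransfer F n L W E) r 1 = rowTransfer F n L W E r := rfl

lemma one_le_of_image {p : ℕ} {lam : Fin p → ℕ} (hlam : ∀ j, 1 ≤ lam j) :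
    #((univ.image lam).filter (· < 1)) = 0 := by
  rw [card_eq_zero, filter_eq_empty_iff]
  intro k hk
  obtain ⟨j, -, rfl⟩ := mem_image.1 hk
  have := hlam j
  omega

variable {p : ℕ} {lam : Fin p → ℕ}

lemma lastColumn_le (hF : F ≠ .D) (r : ℕ) : lastColumn F n r ≤ greatestPart lam + 1 := by
  cases F <;> simp [lastColumn, halfColumn, minColumn] at hF ⊢
  all_goals split_ifs <;> omega

lemma rightSign_one_of_reachable {L r : ℕ} {S : Finset ℕ} (ht : topColumn F = 1)
    (h : Reachable F n L 0 r S) (hr : r < n + centralRows F) : rightSign R S 1 = 1 := by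
  rw [rightSign, ← ht, h.2 hr, pow_zero]

include hI in
lemma Z_B (hlam : ∀ j, 1 ≤ lam j) : Z I .B t x tc xc lam =
    wedgeSeries (created 1 1 I 1 id [] ((List.range' 0 n).map (layer I t x)))
      (univ.image lam) :=
  Z_eq_wedgeSeries (F := .B) hI t x tc xc lam hlam (fun r _ => lastColumn_le (by decide) r)
    (one_le_of_image hlam) (pow_zero _) id [] fun E l S _ => by simp [compose, centralRows]

include hI in
lemma Z_Bstar (hlam : ∀ j, 1 ≤ lam j) : Z I .Bstar t x tc xc lam =
    wedgeSeries (created 1 1 1 1 (rowSeries 1 (I * tc * xc) (I * tc * xc)) []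
      ((List.range' 0 n).map (layer I t x))) (univ.image lam) := by
  have hm := fun r (_ : r < numRows .Bstar n) =>
    lastColumn_le (F := .Bstar) (n := n) (lam := lam) (by decide) r
  refine Z_eq_wedgeSeries (F := .Bstar) hI t x tc xc lam hlam hm (one_le_of_image hlam) (pow_zero _) _ []
    fun E l S hS => ?_
  rw [show centralRows .Bstar = 1 from rfl, compose_one,
    rowTransfer_wedgeSeries _ E (atRow_central hI t x tc xc rfl) (fun h => by cases h.1)
      (lastColumn_le (by decide) n) l hS.lt, if_neg]
  · simp [lastColumn, halfColumn, minColumn]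
  · have : ¬ numRows .Bstar n - 1 - n < n := by simp only [numRows, centralRows]; omega
    rw [rightEnd, if_neg (lt_irrefl n), if_neg this]
    decide

include hI in
lemma Z_BC (hlam : ∀ j, 1 ≤ lam j) : Z I .BC t x tc xc lam =
    wedgeSeries (created 1 1 1 1 (rowSeries 1 (I * tc * xc) (I * tc * xc))
      [X ^ 1 * geometric (I * tc * xc)]
      ((List.range' 0 n).map (layer I t x))) (univ.image lam) := by
  have hm := fun r (_ : r < numRows .BC n) =>
    lastColumn_le (F := .BC) (n := n) (lam := lam) (by decide) r
  refine Z_eq_wedgeSeries (F := .BC) hI t x tc xc lam hlam hm (one_le_of_image hlam) (pow_zero _) _ _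
    fun E l S hS => ?_
  have e1 : lastColumn .BC n n = 1 := by simp [lastColumn, halfColumn, minColumn]
  rw [show centralRows .BC = 1 from rfl, compose_one,
    rowTransfer_wedgeSeries _ E (atRow_central hI t x tc xc rfl) (fun h => by cases h.1)
      (lastColumn_le (by decide) n) l hS.lt, if_pos, e1,
    rightSign_one_of_reachable rfl hS (by simp [centralRows]), one_mul]
  · have : ¬ numRows .BC n - 1 - n < n := by simp only [numRows, centralRows]; omega
    rw [rightEnd, if_neg (lt_irrefl n), if_neg this]

include hI in
lemma Z_C (hlam : ∀ j, 1 ≤ lam j) : Z I .C t x tc xc lam =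
    wedgeSeries (created 1 0 I 1 (cornerSeries (I * tc * xc) (I * tc * xc)
      (1 - I * (I * tc * xc))) [] ((List.range' 0 n).map (layer I t x))) (univ.image lam) := by
  have hm := fun r (_ : r < numRows .C n) =>
    lastColumn_le (F := .C) (n := n) (lam := lam) (by decide) r
  refine Z_eq_wedgeSeries (F := .C) hI t x tc xc lam hlam hm (one_le_of_image hlam) (pow_zero _) _ []
    fun E l S hS => ?_
  have h0 : 0 ∉ S := fun h => by
    have := hS.2 (by simp [centralRows])
    rw [card_eq_zero, filter_eq_empty_iff] at this
    exact this h (by simp [topColumn, halfColumn])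
  rw [show centralRows .C = 1 from rfl, compose_one,
    rowTransfer_eq_corner _ E (atRow_central hI t x tc xc rfl) rfl _ hS.lt h0,
    gates_cornerSite (by rw [add_comm]; exact hS.lt), List.append_nil]
  rfl

include hI in
lemma Z_Cstar (hlam : ∀ j, 1 ≤ lam j) : Z I .Cstar t x tc xc lam =
    wedgeSeries (created 1 0 1 1 id [] ((List.range' 0 n).map (layer I t x)))
      (univ.image lam) :=
  Z_eq_wedgeSeries (F := .Cstar) hI t x tc xc lam hlam (fun r _ => lastColumn_le (by decide) r)
    (one_le_of_image hlam) (pow_zero _) id [] fun E l S _ => by simp [compose, centralRows]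

include hI in
lemma Z_D {lam : Fin n → ℕ} (hlam : ∀ j, 1 ≤ lam j) {q : ℕ}
    (hq : #((univ.image lam).filter (· < 2)) = q) : Z I .D t x tc xc lam =
    wedgeSeries (created 2 1 1 ((-1) ^ q) id [] ((List.range' 0 n).map (layer I t x)))
      (univ.image lam) := by
  refine Z_eq_wedgeSeries (F := .D) hI t x tc xc lam hlam (fun r hr => ?_) hq rfl id []
    fun E l S _ => by simp [compose, centralRows]
  have hn : 0 < n := by
    simp only [numRows, centralRows] at hr
    omega
  have h1 : lam ⟨0, hn⟩ ≤ greatestPart lam := le_sup (f := lam) (mem_univ _)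
  have h2 := hlam ⟨0, hn⟩
  have h3 : lastColumn .D n r ≤ 2 := by simp only [lastColumn, halfColumn]; split_ifs <;> omega
  omega

end Deformation

/-! ### Rational form of the generating functions -/

section Bracket

variable {A : Type*} [CommRing A]

/-- The numerator of `∏_{i < k < n} (z + b_k) (z + b'_k) / ((1 - b_k z) (1 - b'_k z))`. -/
def upperProd (b b' : ℕ → A) (n : ℕ) (z : A) (i : ℕ) : A :=
  ∏ k ∈ Ico (i + 1) n, (z + b k) * (z + b' k)

/-- The denominator of `∏_{i < k < n} (z + b_k) (z + b'_k) / ((1 - b_k z) (1 - b'_k z))`. -/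
def lowerProd (b b' : ℕ → A) (n : ℕ) (z : A) (i : ℕ) : A :=
  ∏ k ∈ Ico (i + 1) n, (1 - b k * z) * (1 - b' k * z)

/-- The sum of the contributions of the two directions of the `i`-th bend, up to the factor
`hProd b z i` and a common denominator; `P` and `Q` depend on the family. -/
def bracket (b b' : ℕ → A) (n : ℕ) (z P Q : A) (i : ℕ) : A :=
  P * (z + b i) * upperProd b b' n z i + Q * (1 - b i * z) * lowerProd b b' n z i

/-- The product of `(z + b_l) (1 - b_l z)` over `j ≤ l < i`. -/
def hProd (b : ℕ → A) (z : A) (j i : ℕ) : A := ∏ l ∈ Ico j i, (z + b l) * (1 - b l * z)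

lemma hProd_self (b : ℕ → A) (z : A) (j : ℕ) : hProd b z j j = 1 := by simp [hProd]

lemma hProd_succ (b : ℕ → A) (z : A) {j i : ℕ} (h : j < i) :
    hProd b z j i = (z + b j) * (1 - b j * z) * hProd b z (j + 1) i := by
  rw [hProd, hProd, prod_eq_prod_Ico_succ_bot h]

end Bracket

section Rational

variable {R : Type*} [CommRing R]

lemma lowPart_of_dvd {m : ℕ} {f : R⟦X⟧} (h : X ^ m ∣ f) : lowPart m f = 0 := by
  ext k
  rw [coeff_lowPart, map_zero]
  split_ifs with hk
  · exact X_pow_dvd_iff.1 h k hk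
  · rfl

lemma rowSeries_mul (m : ℕ) (b₁ b₂ : R) (φ : R⟦X⟧) :
    rowSeries m b₁ b₂ (X ^ m * φ) = X ^ m * ((X + C b₁) * geometric b₂ * φ) := by
  rw [rowSeries, lowPart_of_dvd (dvd_mul_right _ _)]
  ring

lemma lowPart_succ_mul (m : ℕ) (c : R) {ρ : R⟦X⟧} (hρ : constantCoeff ρ = 0) :
    lowPart (m + 1) (X ^ m * (C c + ρ)) = X ^ m * C c := by
  obtain ⟨ρ', rfl⟩ := X_dvd_iff.2 hρ
  ext k
  rw [coeff_lowPart, coeff_X_pow_mul', coeff_X_pow_mul']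
  rcases lt_trichotomy k m with h | rfl | h
  · simp [not_le.2 h]
  · simp
  · rw [if_neg (by omega), if_pos h.le, coeff_C, if_neg (by omega)]

lemma rowSeries_succ_mul (m : ℕ) (b₁ b₂ c : R) {ρ : R⟦X⟧} (hρ : constantCoeff ρ = 0) :
    rowSeries (m + 1) b₁ b₂ (X ^ m * (C c + ρ)) =
      X ^ m * (C c + (X + C b₁) * geometric b₂ * ρ) := by
  rw [rowSeries, lowPart_succ_mul m c hρ]
  ring

lemma constantCoeff_geometric (b : R) : constantCoeff (geometric b) = 1 := by
  rw [← coeff_zero_eq_constantCoeff_apply]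
  simp [geometric]

variable (b : ℕ → R × R) (n : ℕ)

/-- The weights `b₁` as constant power series. -/
noncomputable def fstC (k : ℕ) : R⟦X⟧ := C (b k).1

/-- The weights `b₂` as constant power series. -/
noncomputable def sndC (k : ℕ) : R⟦X⟧ := C (b k).2

/-- The common denominator of the pairs of rows `j, …, n - 1`. -/
noncomputable def denominator (j : ℕ) : R⟦X⟧ :=
  ∏ k ∈ Ico j n, (1 - fstC b k * X) * (1 - sndC b k * X)

lemma lowerProd_eq_denominator (j : ℕ) :
    lowerProd (fstC b) (sndC b) n X j = denominator b n (j + 1) := rfl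

variable {n}

lemma denominator_succ {j : ℕ} (h : j < n) :
    denominator b n j =
      (1 - fstC b j * X) * (1 - sndC b j * X) * denominator b n (j + 1) := by
  rw [denominator, denominator, prod_eq_prod_Ico_succ_bot h]

lemma one_sub_fstC (k : ℕ) : (1 - fstC b k * X) * geometric (b k).1 = 1 :=
  one_sub_mul_geometric _

lemma one_sub_sndC (k : ℕ) : (1 - sndC b k * X) * geometric (b k).2 = 1 :=
  one_sub_mul_geometric _

variable {b} {A : R⟦X⟧ → R⟦X⟧} {G : List R⟦X⟧} {nc dc ε : R⟦X⟧} {θ : R}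

section Full

/-- Transport in a model without half column. -/
lemma transport_full (hA : ∀ φ, ∃ ψ, A (X ^ 1 * φ) = X ^ 1 * ψ ∧ dc * ψ = nc * φ) (k : ℕ) :
    ∀ j, j + k = n → ∀ φ, ∃ ψ,
      transport 1 1 A ((List.range' j k).map b) (X ^ 1 * φ) = X ^ 1 * ψ ∧
      dc * denominator b n j * ψ =
        (∏ l ∈ Ico j n, (X + fstC b l) * (X + sndC b l)) * nc * φ := by
  induction k with
  | zero =>
    intro j hj φ
    obtain rfl : j = n := by omega
    obtain ⟨ψ, h1, h2⟩ := hA φ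
    exact ⟨ψ, h1, by simp [denominator, h2]⟩
  | succ k ih =>
    intro j hj φ
    have hjn : j < n := by omega
    obtain ⟨ψ, h1, h2⟩ := ih (j + 1) (by omega) ((X + C (b j).2) * geometric (b j).1 * φ)
    refine ⟨(X + C (b j).1) * geometric (b j).2 * ψ, ?_, ?_⟩
    · rw [List.range'_succ, List.map_cons, transport, rowSeries_mul, h1, rowSeries_mul]
    · rw [denominator_succ b hjn, prod_eq_prod_Ico_succ_bot hjn]
      change _ = ((X + C (b j).1) * (X + C (b j).2)) * _ * _ * _
      have e1 := one_sub_fstC b j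
      have e2 := one_sub_sndC b j
      set g1 := geometric (b j).1
      set g2 := geometric (b j).2
      set P := ∏ l ∈ Ico (j + 1) n, (X + fstC b l) * (X + sndC b l)
      calc _ = (1 - fstC b j * X) * (X + C (b j).1) * ((1 - sndC b j * X) * g2) *
            (dc * denominator b n (j + 1) * ψ) := by ring
        _ = (X + C (b j).1) * (X + C (b j).2) * P * nc * φ * ((1 - fstC b j * X) * g1) := by
            rw [h2, e2]; ring
        _ = _ := by rw [e1]; ring

/-- The generating functions of the vectors created in a model without half column are
`z N / (Q dc)`, where `Q` is the common denominator of all pairs of rows and `N` is given by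
`bracket`. -/
lemma created_full (hA : ∀ φ, ∃ ψ, A (X ^ 1 * φ) = X ^ 1 * ψ ∧ dc * ψ = nc * φ)
    (hdc : constantCoeff dc = 1) (δ σ : R) (br : ℕ → R⟦X⟧)
    (hbr : ∀ i < n, br i = bracket (fstC b) (sndC b) n X (C δ * nc)
      (C (σ * (-1) ^ (n - 1 - i + G.length)) * dc) i)
    (hG₁ : G.length ≤ 1)
    (hG : List.Forall₂ (fun f N => dc * f = X ^ 1 * N) G ((List.range' n G.length).map br))
    (k : ℕ) : ∀ j, j + k = n → List.Forall₂ (fun f N => dc * denominator b n j * f = X ^ 1 * N)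
      (created 1 1 δ σ A G ((List.range' j k).map b))
      ((List.range' j (k + G.length)).map fun i => hProd (fstC b) X j i * br i) := by
  induction k with
  | zero =>
    intro j hj
    obtain rfl : j = n := by omega
    simp only [List.range'_zero, List.map_nil, created, denominator, Ico_self, prod_empty, mul_one,
      zero_add]
    rw [List.forall₂_map_right_iff] at hG ⊢
    rw [List.forall₂_iff_get] at hG ⊢
    refine ⟨hG.1, fun i h₁ h₂ => ?_⟩
    have := hG.2 i h₁ h₂
    rw [this]
    obtain rfl : i = 0 := by
      have : i < G.length := h₁
      omega
    simp [hProd_self]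
  | succ k ih =>
    intro j hj
    have hjn : j < n := by omega
    have ih' := ih (j + 1) (by omega)
    rw [List.range'_succ, List.map_cons, created, show k + 1 + G.length = k + G.length + 1 by ring,
      List.range'_succ, List.map_cons]
    have e1 := one_sub_fstC b j
    have e2 := one_sub_sndC b j
    refine List.Forall₂.cons ?_ ?_
    · obtain ⟨ψ, h1, h2⟩ := transport_full (n := n) (b := b) hA k (j + 1) (by omega) (geometric (b j).1)
      rw [h1, rowSeries_mul, hProd_self, hbr j hjn, bracket, one_mul, denominator_succ b hjn,
        lowerProd_eq_denominator, upperProd]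
      simp only [List.length_map, List.length_range']
      rw [show n - 1 - j = k by omega]
      set g1 := geometric (b j).1
      set g2 := geometric (b j).2
      set P := ∏ l ∈ Ico (j + 1) n, (X + fstC b l) * (X + sndC b l)
      set s := C (σ * (-1) ^ (k + G.length))
      change _ = X ^ 1 * (C δ * nc * (X + C (b j).1) * P + _)
      calc _ = X ^ 1 * ((1 - sndC b j * X) * g2) * (C δ * (1 - fstC b j * X) * (X + C (b j).1) *
            (dc * denominator b n (j + 1) * ψ) +
            s * dc * (1 - fstC b j * X) * denominator b n (j + 1)) := by ring
        _ = X ^ 1 * (C δ * (X + C (b j).1) * P * nc * ((1 - fstC b j * X) * g1) +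
            s * dc * (1 - fstC b j * X) * denominator b n (j + 1)) := by rw [e2, h2]; ring
        _ = _ := by rw [e1]; ring
    · have : (List.range' (j + 1) (k + G.length)).map (fun i => hProd (fstC b) X j i * br i) =
          ((List.range' (j + 1) (k + G.length)).map
            fun i => hProd (fstC b) X (j + 1) i * br i).map
              fun N => (X + fstC b j) * (1 - fstC b j * X) * N := by
        rw [List.map_map]
        refine List.map_congr_left fun i hi => ?_
        rw [List.mem_range'_1] at hi
        rw [hProd_succ _ _ (by omega), Function.comp, mul_assoc]
      rw [this, List.forall₂_map_right_iff, List.forall₂_map_left_iff]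
      refine ih'.imp fun f N h => ?_
      have h0 : X ^ 1 ∣ f := by
        rw [pow_one, X_dvd_iff]
        have := congrArg constantCoeff h
        simp only [map_mul, hdc, pow_one, constantCoeff_X, zero_mul] at this
        have hden : constantCoeff (denominator b n (j + 1)) = 1 := by
          simp [denominator, map_prod, fstC, sndC]
        rw [hden] at this
        simpa using this
      obtain ⟨g, rfl⟩ := h0
      rw [rowSeries_mul, denominator_succ b hjn]
      change _ = X ^ 1 * ((X + C (b j).1) * (1 - fstC b j * X) * N)
      set g2 := geometric (b j).2
      calc _ = ((1 - sndC b j * X) * g2) * ((1 - fstC b j * X) * (X + C (b j).1)) *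
            (dc * denominator b n (j + 1) * (X ^ 1 * g)) := by ring
        _ = _ := by rw [e2, h]; ring

end Full

section Half

/-- Transport in a model with half column, whose label is `m`. -/
lemma transport_half {m : ℕ}
    (hA : ∀ φ, ∃ ρ, A (X ^ m * φ) = X ^ m * (C (θ * constantCoeff φ) + ρ) ∧
      constantCoeff ρ = 0 ∧ dc * ρ = nc * φ + C (constantCoeff φ) * ε) (k : ℕ) :
    ∀ j, j + k = n → ∀ φ, ∃ ρ,
      transport (m + 1) m A ((List.range' j k).map b) (X ^ m * φ) =
        X ^ m * (C (θ * ((∏ l ∈ Ico j n, (b l).2) * constantCoeff φ)) + ρ) ∧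
      constantCoeff ρ = 0 ∧
      dc * denominator b n j * ρ =
        (∏ l ∈ Ico j n, (X + fstC b l) * (X + sndC b l)) * nc * φ +
        C ((∏ l ∈ Ico j n, (b l).2) * constantCoeff φ) * ε * hProd (fstC b) X j n := by
  induction k with
  | zero =>
    intro j hj φ
    obtain rfl : j = n := by omega
    obtain ⟨ρ, h1, h2, h3⟩ := hA φ
    exact ⟨ρ, by simpa [transport] using h1, h2, by simp [denominator, h3, hProd_self]⟩
  | succ k ih =>
    intro j hj φ
    have hjn : j < n := by omega
    obtain ⟨ρ, h1, h2, h3⟩ := ih (j + 1) (by omega) ((X + C (b j).2) * geometric (b j).1 * φ)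
    have hc : (∏ l ∈ Ico (j + 1) n, (b l).2) *
        constantCoeff ((X + C (b j).2) * geometric (b j).1 * φ) =
        (∏ l ∈ Ico j n, (b l).2) * constantCoeff φ := by
      rw [prod_eq_prod_Ico_succ_bot hjn]
      simp only [map_mul, map_add, constantCoeff_X, constantCoeff_C, constantCoeff_geometric]
      ring
    rw [hc] at h1 h3
    refine ⟨(X + C (b j).1) * geometric (b j).2 * ρ, ?_, by simp [h2], ?_⟩
    · rw [List.range'_succ, List.map_cons, transport, rowSeries_mul, h1, rowSeries_succ_mul _ _ _ _ h2]
    · rw [denominator_succ b hjn, prod_eq_prod_Ico_succ_bot hjn, hProd_succ _ _ hjn]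
      change _ = ((X + C (b j).1) * (X + C (b j).2)) * _ * _ * _ +
        _ * ((X + C (b j).1) * (1 - fstC b j * X) * _)
      have e1 := one_sub_fstC b j
      have e2 := one_sub_sndC b j
      set g1 := geometric (b j).1
      set g2 := geometric (b j).2
      set P := ∏ l ∈ Ico (j + 1) n, (X + fstC b l) * (X + sndC b l)
      set c := C ((∏ l ∈ Ico j n, (b l).2) * constantCoeff φ)
      calc _ = (1 - fstC b j * X) * (X + C (b j).1) * ((1 - sndC b j * X) * g2) *
            (dc * denominator b n (j + 1) * ρ) := by ring
        _ = (X + C (b j).1) * (X + C (b j).2) * P * nc * φ * ((1 - fstC b j * X) * g1) +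
            (1 - fstC b j * X) * (X + C (b j).1) * (c * ε * hProd (fstC b) X (j + 1) n) := by
            rw [h3, e2]; ring
        _ = _ := by rw [e1]; ring

/-- The generating functions of the vectors created in a model with half column.  The half column
is met only by the lower row of each pair, so the lowest coefficient is multiplied by `b₂` there and
left alone in the upper row; it is split off, and `ρ` is the remaining part divided by `z ^ m`. -/
lemma created_half {m : ℕ}
    (hA : ∀ φ, ∃ ρ, A (X ^ m * φ) = X ^ m * (C (θ * constantCoeff φ) + ρ) ∧
      constantCoeff ρ = 0 ∧ dc * ρ = nc * φ + C (constantCoeff φ) * ε) (δ σ : R) (k : ℕ) :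
    ∀ j, j + k = n → List.Forall₂ (fun f i => ∃ ρ,
        f = X ^ m * (C (δ * θ * ∏ l ∈ Ico (i + 1) n, (b l).2) + ρ) ∧ constantCoeff ρ = 0 ∧
        dc * denominator b n j * ρ = hProd (fstC b) X j i *
          bracket (fstC b) (sndC b) n X (C δ * nc) (C (σ * (-1) ^ (n - 1 - i)) * X * dc) i +
          C (δ * ∏ l ∈ Ico (i + 1) n, (b l).2) * ε * hProd (fstC b) X j n)
      (created (m + 1) m δ σ A [] ((List.range' j k).map b)) (List.range' j k) := by
  induction k with
  | zero => intro j hj; exact List.Forall₂.nil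
  | succ k ih =>
    intro j hj
    have hjn : j < n := by omega
    have ih' := ih (j + 1) (by omega)
    rw [List.range'_succ, List.map_cons, created]
    have e1 := one_sub_fstC b j
    have e2 := one_sub_sndC b j
    refine List.Forall₂.cons ?_ ?_
    · obtain ⟨ρ, h1, h2, h3⟩ :=
        transport_half (n := n) (b := b) hA k (j + 1) (by omega) (geometric (b j).1)
      rw [constantCoeff_geometric, mul_one] at h1 h3
      rw [h1, rowSeries_succ_mul _ _ _ _ h2]
      refine ⟨C δ * ((X + C (b j).1) * geometric (b j).2 * ρ) +
        C (σ * (-1) ^ k) * (X * geometric (b j).2), ?_, by simp [h2], ?_⟩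
      · simp only [List.length_map, List.length_range', List.length_nil, add_zero, map_mul]
        ring
      · rw [hProd_self, bracket, one_mul, denominator_succ b hjn,
          lowerProd_eq_denominator, upperProd, show n - 1 - j = k by omega, hProd_succ _ _ hjn,
          map_mul C δ]
        set g1 := geometric (b j).1
        set g2 := geometric (b j).2
        set P := ∏ l ∈ Ico (j + 1) n, (X + fstC b l) * (X + sndC b l)
        set s := C (σ * (-1) ^ k)
        set c := C (∏ l ∈ Ico (j + 1) n, (b l).2)
        change _ = C δ * nc * (X + C (b j).1) * P + _ +
          C δ * c * ε * ((X + C (b j).1) * (1 - fstC b j * X) * _)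
        calc _ = ((1 - sndC b j * X) * g2) * (C δ * (1 - fstC b j * X) * (X + C (b j).1) *
              (dc * denominator b n (j + 1) * ρ) +
              s * X * dc * (1 - fstC b j * X) * denominator b n (j + 1)) := by ring
          _ = C δ * (X + C (b j).1) * P * nc * ((1 - fstC b j * X) * g1) +
              C δ * (1 - fstC b j * X) * (X + C (b j).1) * (c * ε * hProd (fstC b) X (j + 1) n) +
              s * X * dc * (1 - fstC b j * X) * denominator b n (j + 1) := by rw [e2, h3]; ring
          _ = _ := by rw [e1]; ring
    · rw [List.forall₂_map_left_iff]
      have ih'' := List.forall₂_iff_get.1 ih'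
      rw [List.forall₂_iff_get]
      refine ⟨ih''.1, fun a ha₁ ha₂ => ?_⟩
      have hi := List.get_mem (List.range' (j + 1) k) ⟨a, ha₂⟩
      rw [List.mem_range'_1] at hi
      obtain ⟨ρ, h1, h2, h3⟩ := ih''.2 a ha₁ ha₂
      set i := (List.range' (j + 1) k).get ⟨a, ha₂⟩
      refine ⟨(X + C (b j).1) * geometric (b j).2 * ρ, ?_, by simp [h2], ?_⟩
      · rw [h1, rowSeries_succ_mul _ _ _ _ h2]
      · rw [denominator_succ b hjn, hProd_succ _ _ (show j < i by omega), hProd_succ _ _ hjn]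
        set g2 := geometric (b j).2
        calc _ = ((1 - sndC b j * X) * g2) * ((1 - fstC b j * X) * (X + C (b j).1)) *
              (dc * denominator b n (j + 1) * ρ) := by ring
          _ = ((1 - fstC b j * X) * (X + fstC b j)) *
              (dc * denominator b n (j + 1) * ρ) := by rw [e2, one_mul]; rfl
          _ = _ := by rw [h3]; ring

end Half

end Rational

/-! ### Coefficients of exterior products as determinants -/

section Extraction

variable {R : Type*} [CommRing R]

lemma wedgeSeries_eq_det {N : ℕ} {lam : Fin N → ℕ} (hlam : StrictAnti lam) {l : List R⟦X⟧}
    {r : R⟦X⟧ → ℕ → Prop} (h : List.Forall₂ r l (List.range' 0 N)) :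
    ∃ f : Fin N → R⟦X⟧, (∀ i, r (f i) i) ∧
      wedgeSeries l (univ.image lam) = (Matrix.of fun i k => coeff (lam k) (f i)).det := by
  have hl : l.length = N := by simpa using h.length_eq
  subst hl
  refine ⟨fun i => l.get i, fun i => ?_, ?_⟩
  · have := (List.forall₂_iff_get.1 h).2 i i.2 (by simp)
    simpa using this
  · have := wedgeList_ofFn (fun i => toVec (l.get i)) lam hlam
    rw [← Function.comp_def toVec, ← List.map_ofFn, List.ofFn_get] at this
    exact this

/-- If every `f i` is a combination of the series `E l` in the degrees `lam k`, the determinant of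
their coefficients factors. -/
lemma det_coeff_eq {N : ℕ} (lam : Fin N → ℕ) (f E : Fin N → R⟦X⟧) (M : Matrix (Fin N) (Fin N) R)
    (h : ∀ i k, coeff (lam k) (f i) = coeff (lam k) (∑ l, C (M i l) * E l)) :
    (Matrix.of fun i k => coeff (lam k) (f i)).det =
      M.det * (Matrix.of fun l k => coeff (lam k) (E l)).det := by
  rw [← Matrix.det_mul]
  congr 1
  ext i k
  simp [h, Matrix.mul_apply, coeff_C_mul]

/-- The leading coefficients of series of pairwise different orders. -/
lemma det_coeff_rho {N : ℕ} (E : Fin N → R⟦X⟧)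
    (h : ∀ l : Fin N, ∃ g, E l = X ^ (N - l : ℕ) * g ∧ constantCoeff g = 1) :
    (Matrix.of fun l k => coeff (rho N k) (E l)).det = 1 := by
  rw [Matrix.det_of_isLowerTriangular]
  · refine prod_eq_one fun l _ => ?_
    obtain ⟨g, h1, h2⟩ := h l
    rw [Matrix.of_apply, h1, rho, coeff_X_pow_mul', if_pos le_rfl, Nat.sub_self,
      coeff_zero_eq_constantCoeff_apply, h2]
  · intro l k hlk
    obtain ⟨g, h1, h2⟩ := h l
    have : (l : ℕ) < k := hlk
    rw [Matrix.of_apply, h1, rho, coeff_X_pow_mul', if_neg (by omega)]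

end Extraction

end BentIce

namespace BentIce

open Finset Polynomial

/-! ### Forms in `1 - X ^ 2` and `X` -/

section Forms

variable {S : Type*} [CommRing S]

/-- The polynomials which are homogeneous of degree `N - 1` in `1 - X ^ 2` and `X`. -/
noncomputable def forms (S : Type*) [CommRing S] (N : ℕ) : Submodule S S[X] :=
  Submodule.span S (Set.range fun l : Fin N => (1 - X ^ 2) ^ (l : ℕ) * X ^ (N - 1 - l))

lemma basis_mem_forms {N l : ℕ} (h : l < N) : (1 - X ^ 2) ^ l * X ^ (N - 1 - l) ∈ forms S N :=
  Submodule.subset_span ⟨⟨l, h⟩, rfl⟩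

lemma X_mul_mem_forms {N : ℕ} {p : S[X]} (h : p ∈ forms S N) : X * p ∈ forms S (N + 1) := by
  suffices forms S N ≤ (forms S (N + 1)).comap (LinearMap.mulLeft S X) from this h
  rw [forms, Submodule.span_le]
  rintro _ ⟨l, rfl⟩
  have hl := l.2
  have := basis_mem_forms (S := S) (show (l : ℕ) < N + 1 by omega)
  rw [show N + 1 - 1 - (l : ℕ) = N - 1 - l + 1 by omega, pow_succ (X : S[X]) (N - 1 - l), ← mul_assoc,
    mul_comm _ X] at this
  exact this

lemma one_sub_sq_mul_mem_forms {N : ℕ} {p : S[X]} (h : p ∈ forms S N) :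
    (1 - X ^ 2) * p ∈ forms S (N + 1) := by
  suffices forms S N ≤ (forms S (N + 1)).comap (LinearMap.mulLeft S (1 - X ^ 2)) from this h
  rw [forms, Submodule.span_le]
  rintro _ ⟨l, rfl⟩
  have hl := l.2
  have := basis_mem_forms (S := S) (show (l : ℕ) + 1 < N + 1 by omega)
  rw [show N + 1 - 1 - ((l : ℕ) + 1) = N - 1 - l by omega, pow_succ', mul_assoc] at this
  exact this

lemma C_mul_mem_forms {N : ℕ} {p : S[X]} (c : S) (h : p ∈ forms S N) : C c * p ∈ forms S N := by
  rw [← smul_eq_C_mul]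
  exact Submodule.smul_mem _ _ h

lemma neg_one_pow_mul_mem_forms {N : ℕ} {p : S[X]} (m : ℕ) (h : p ∈ forms S N) :
    (-1) ^ m * p ∈ forms S N := by
  have := C_mul_mem_forms ((-1) ^ m) h
  rwa [C_pow, C_neg, C_1] at this

lemma hProd_succ_top {A : Type*} [CommRing A] (b : ℕ → A) (z : A) (i : ℕ) :
    hProd b z 0 (i + 1) = (z + b i) * (1 - b i * z) * hProd b z 0 i := by
  rw [hProd, prod_Ico_succ_top (Nat.zero_le i), mul_comm, hProd]

lemma linear_mul_mem_forms {N : ℕ} {p : S[X]} (β : S) (h : p ∈ forms S N) :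
    (X + C β) * (1 - C β * X) * p ∈ forms S (N + 1) := by
  have e : (X + C β) * (1 - C β * X) * p =
      C β * ((1 - X ^ 2) * p) + C (1 - β ^ 2) * (X * p) := by
    rw [C_sub, C_1, C_pow]
    ring
  rw [e]
  exact Submodule.add_mem _ (C_mul_mem_forms _ (one_sub_sq_mul_mem_forms h))
    (C_mul_mem_forms _ (X_mul_mem_forms h))

lemma hProd_mul_mem_forms (β : ℕ → S) (i : ℕ) {N M : ℕ} (hM : N + i = M) {p : S[X]}
    (h : p ∈ forms S N) : hProd (fun k => C (β k)) X 0 i * p ∈ forms S M := by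
  subst hM
  induction i with
  | zero => simpa [hProd_self] using h
  | succ i ih =>
    rw [hProd_succ_top, mul_assoc, ← add_assoc]
    exact linear_mul_mem_forms _ ih

lemma exists_coeff_of_mem_forms {N : ℕ} {p : S[X]} (h : p ∈ forms S N) :
    ∃ c : Fin N → S, p = ∑ l, C (c l) * ((1 - X ^ 2) ^ (l : ℕ) * X ^ (N - 1 - l)) := by
  rw [forms, Submodule.mem_span_range_iff_exists_fun] at h
  obtain ⟨c, rfl⟩ := h
  exact ⟨c, by simp [smul_eq_C_mul]⟩

/-- The last coefficient of a form is its value at `0`. -/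
lemma eval_zero_form {N : ℕ} (c : Fin (N + 1) → S) :
    (∑ l, C (c l) * ((1 - X ^ 2) ^ (l : ℕ) * X ^ (N + 1 - 1 - l)) : S[X]).eval 0 =
      c (Fin.last N) := by
  rw [eval_finsetSum, Fin.sum_univ_castSucc, sum_eq_zero]
  · simp
  · intro l _
    have : N - (l : ℕ) ≠ 0 := by have := l.2; omega
    simp [this]

lemma exists_X_mul_of_eval_zero {N : ℕ} {p : S[X]} (h : p ∈ forms S (N + 1))
    (h0 : p.eval 0 = 0) : ∃ q ∈ forms S N, p = X * q := by
  obtain ⟨c, rfl⟩ := exists_coeff_of_mem_forms h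
  rw [eval_zero_form] at h0
  refine ⟨∑ l : Fin N, C (c l.castSucc) * ((1 - X ^ 2) ^ (l : ℕ) * X ^ (N - 1 - l)),
    Submodule.sum_mem _ fun l _ => C_mul_mem_forms _ (basis_mem_forms l.2), ?_⟩
  rw [Fin.sum_univ_castSucc, h0, C_0, zero_mul, add_zero, mul_sum]
  refine sum_congr rfl fun l _ => ?_
  have hl := l.2
  rw [Fin.val_castSucc, show N + 1 - 1 - (l : ℕ) = N - 1 - l + 1 by omega, pow_succ]
  ring

/-- A pair `x = a + X ^ 2 b`, `y = ± (a - b)` with forms `a` and `b`.  Products of `m` reciprocal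
quadratic polynomials are of this kind. -/
def IsSplitPair (m : ℕ) (x y : S[X]) : Prop :=
  ∃ a ∈ forms S (m + 1), ∃ b ∈ forms S m, x = a + X ^ 2 * b ∧ y = (-1) ^ m * (a - b)

lemma isSplitPair_one : IsSplitPair 0 (1 : S[X]) 1 :=
  ⟨1, by simpa using basis_mem_forms (S := S) (show 0 < 1 by omega), 0, zero_mem _, by simp, by simp⟩

/-- The pair `(1 - b X) (1 - b' X)`, `(X + b) (X + b')` is again of the form
`a + X ^ 2 c`, `c - a`; the products are rearranged by means of `X ^ 4 = X ^ 2 - X ^ 2 (1 - X ^ 2)`. -/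
lemma IsSplitPair.mul {m : ℕ} {x y : S[X]} (h : IsSplitPair m x y) (b b' : S) :
    IsSplitPair (m + 1) ((1 - C b * X) * (1 - C b' * X) * x)
      ((X + C b) * (X + C b') * y) := by
  obtain ⟨p, hp, q, hq, rfl, rfl⟩ := h
  set α : S[X] := (1 - X ^ 2) - C (b + b') * X with hα
  set γ : S[X] := C (1 + b * b') with hγ
  have hαmem : ∀ {N : ℕ} {f : S[X]}, f ∈ forms S N → α * f ∈ forms S (N + 1) := fun hf => by
    rw [hα, sub_mul, mul_assoc]
    exact Submodule.sub_mem _ (one_sub_sq_mul_mem_forms hf) (C_mul_mem_forms _ (X_mul_mem_forms hf))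
  refine ⟨α * p + γ * (X * (X * q)), Submodule.add_mem _ (hαmem hp)
    (C_mul_mem_forms _ (X_mul_mem_forms (X_mul_mem_forms hq))),
    γ * p + α * q - γ * ((1 - X ^ 2) * q), Submodule.sub_mem _ (Submodule.add_mem _
      (C_mul_mem_forms _ hp) (hαmem hq)) (C_mul_mem_forms _ (one_sub_sq_mul_mem_forms hq)), ?_, ?_⟩
  · simp only [hα, hγ, C_add, C_mul, C_1]
    ring
  · simp only [hα, hγ, C_add, C_mul, C_1]
    ring

lemma isSplitPair_prod (β β' : ℕ → S) (n i : ℕ) :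
    IsSplitPair (n - 1 - i) (lowerProd (fun k => C (β k)) (fun k => C (β' k)) n X i)
      (upperProd (fun k => C (β k)) (fun k => C (β' k)) n X i) := by
  have key : ∀ s : Finset ℕ, IsSplitPair #s
      (∏ k ∈ s, (1 - C (β k) * X) * (1 - C (β' k) * X))
      (∏ k ∈ s, (X + C (β k)) * (X + C (β' k))) := fun s => by
    induction s using Finset.induction with
    | empty => simpa using isSplitPair_one
    | insert a s ha ih =>
      rw [prod_insert ha, prod_insert ha, card_insert_of_notMem ha]
      exact ih.mul _ _
  have := key (Ico (i + 1) n)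
  rwa [Nat.card_Ico, show n - (i + 1) = n - 1 - i by omega] at this

end Forms

/-! ### Values of the products at special points -/

section Evaluation

variable {A B : Type*} [CommRing A] [CommRing B]

lemma map_hProd (φ : A →+* B) (b : ℕ → A) (z : A) (j i : ℕ) :
    φ (hProd b z j i) = hProd (fun k => φ (b k)) (φ z) j i := by
  simp [hProd, map_prod]

lemma map_bracket (φ : A →+* B) (b b' : ℕ → A) (n : ℕ) (z P Q : A) (i : ℕ) :
    φ (bracket b b' n z P Q i) =
      bracket (fun k => φ (b k)) (fun k => φ (b' k)) n (φ z) (φ P) (φ Q) i := by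
  simp [bracket, upperProd, lowerProd, map_prod]

/-- The product of `(1 + b_i b_k) (1 + b_i b'_k)` over `i < k < n`. -/
def pairFactor (b b' : ℕ → A) (n i : ℕ) : A :=
  ∏ k ∈ Ico (i + 1) n, (1 + b i * b k) * (1 + b i * b' k)

lemma map_pairFactor (φ : A →+* B) (b b' : ℕ → A) (n i : ℕ) :
    φ (pairFactor b b' n i) = pairFactor (fun k => φ (b k)) (fun k => φ (b' k)) n i := by
  simp [pairFactor, map_prod]

lemma hProd_neg_eq_zero (b : ℕ → A) {j i : ℕ} (h : j < i) : hProd b (-b j) 0 i = 0 :=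
  prod_eq_zero (mem_Ico.2 ⟨Nat.zero_le j, h⟩) (by ring)

lemma hProd_neg (b : ℕ → A) (i : ℕ) :
    hProd b (-b i) 0 i = ∏ l ∈ range i, (b l - b i) * (1 + b l * b i) := by
  rw [hProd, range_eq_Ico]
  exact prod_congr rfl fun l _ => by ring

lemma bracket_neg (b b' : ℕ → A) (n : ℕ) (P Q : A) (i : ℕ) :
    bracket b b' n (-b i) P Q i = Q * (1 + b i ^ 2) * pairFactor b b' n i := by
  have : lowerProd b b' n (-b i) i = pairFactor b b' n i := prod_congr rfl fun k _ => by ring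
  rw [bracket, this]
  ring

lemma hProd_zero (b : ℕ → A) (i : ℕ) : hProd b 0 0 i = ∏ l ∈ range i, b l := by
  rw [hProd, range_eq_Ico]
  exact prod_congr rfl fun l _ => by ring

lemma hProd_zero_mul_upperProd (b b' : ℕ → A) {n i : ℕ} (h : i < n) :
    hProd b 0 0 i * (b i * upperProd b b' n 0 i) =
      (∏ k ∈ Ico (i + 1) n, b' k) * hProd b 0 0 n := by
  have e : upperProd b b' n 0 i = (∏ k ∈ Ico (i + 1) n, b k) * ∏ k ∈ Ico (i + 1) n, b' k := by
    simp [upperProd, prod_mul_distrib]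
  rw [e, hProd_zero, hProd_zero, range_eq_Ico, range_eq_Ico,
    ← prod_Ico_consecutive b (Nat.zero_le i) h.le, prod_eq_prod_Ico_succ_bot h]
  ring

end Evaluation

/-! ### The brackets are multiples of forms -/

section BracketForms

variable {S : Type*} [CommRing S] (β β' : ℕ → S) (βc : S) {I : S} (n i : ℕ)

local notation "Br" => bracket (fun k => C (β k)) (fun k => C (β' k)) n X

/-- If `(x, y)` is the split pair of the products of `bracket`, then `bracket` is a combination of
the two forms of the pair, in which a common factor depending on the family appears. -/
lemma bracket_forms_B (hI : I ^ 2 = -1) : ∃ g ∈ forms S (n - 1 - i + 1),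
    Br (C I) ((-1) ^ (n - 1 - i)) i = (1 + C I * X) * g := by
  obtain ⟨p, hp, q, hq, hx, hy⟩ := isSplitPair_prod β β' n i
  have hI' : (C I : S[X]) ^ 2 = -1 := by rw [← C_pow, hI, C_neg, C_1]
  set m := n - 1 - i
  refine ⟨(-1) ^ m * (C (1 + I * β i) * p - (C (I + β i) * (X * q) +
    C (β i * I) * ((1 - X ^ 2) * q))), neg_one_pow_mul_mem_forms _ (Submodule.sub_mem _
    (C_mul_mem_forms _ hp) (Submodule.add_mem _ (C_mul_mem_forms _ (X_mul_mem_forms hq))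
    (C_mul_mem_forms _ (one_sub_sq_mul_mem_forms hq)))), ?_⟩
  rw [bracket, hx, hy]
  simp only [C_add, C_mul, C_1]
  linear_combination ((-1) ^ m * (-X * C (β i) * p + (X ^ 2 + C (β i) * X * (1 - X ^ 2)) * q)) * hI'

lemma bracket_forms_Bstar : ∃ g ∈ forms S (n - 1 - i + 1),
    Br (X + C βc) ((-1) ^ (n - 1 - i) * (1 - C βc * X)) i = (1 + X ^ 2) * g := by
  obtain ⟨p, hp, q, hq, hx, hy⟩ := (isSplitPair_prod β β' n i).mul (β i) βc
  set m := n - 1 - i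
  refine ⟨(-1) ^ m * q, neg_one_pow_mul_mem_forms _ hq, ?_⟩
  rw [bracket]
  linear_combination hy + (-1) ^ m * hx

lemma bracket_forms_BC : ∃ g ∈ forms S (n - 1 - i + 1 + 1),
    Br (X + C βc) ((-1) ^ (n - 1 - i + 1) * (1 - C βc * X)) i = 1 * g := by
  obtain ⟨p, hp, q, hq, hx, hy⟩ := (isSplitPair_prod β β' n i).mul (β i) βc
  set m := n - 1 - i
  refine ⟨(-1) ^ (m + 1) * (C 2 * p - (1 - X ^ 2) * q), neg_one_pow_mul_mem_forms _
    (Submodule.sub_mem _ (C_mul_mem_forms _ hp) (one_sub_sq_mul_mem_forms hq)), ?_⟩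
  rw [bracket, C_ofNat]
  linear_combination hy + (-1) ^ (m + 1) * hx

lemma bracket_forms_C (hI : I ^ 2 = -1) : ∃ g ∈ forms S (n - 1 - i + 1 + 1),
    Br (C I * (X + C βc)) ((-1) ^ (n - 1 - i) * X * (1 - C βc * X)) i = (1 + C I * X) * g := by
  obtain ⟨p, hp, q, hq, hx, hy⟩ := (isSplitPair_prod β β' n i).mul (β i) βc
  have hI' : (C I : S[X]) ^ 2 = -1 := by rw [← C_pow, hI, C_neg, C_1]
  set m := n - 1 - i
  refine ⟨(-1) ^ m * (C I * ((1 - X ^ 2) * q) + X * q - C I * p), neg_one_pow_mul_mem_forms _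
    (Submodule.sub_mem _ (Submodule.add_mem _ (C_mul_mem_forms _ (one_sub_sq_mul_mem_forms hq))
    (X_mul_mem_forms hq)) (C_mul_mem_forms _ hp)), ?_⟩
  rw [bracket]
  linear_combination C I * hy + (-1) ^ m * X * hx +
    ((-1) ^ m * (X * p - X * (1 - X ^ 2) * q)) * hI'

lemma bracket_forms_Cstar : ∃ g ∈ forms S (n - 1 - i + 1 + 1),
    Br 1 ((-1) ^ (n - 1 - i) * X) i = 1 * g := by
  obtain ⟨p, hp, q, hq, hx, hy⟩ := isSplitPair_prod β β' n i
  set m := n - 1 - i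
  refine ⟨(-1) ^ m * (C 2 * (X * p) + C (β i) * ((1 - X ^ 2) * p) - (X * ((1 - X ^ 2) * q) +
    C (β i) * ((1 - X ^ 2) * ((1 - X ^ 2) * q) + C 2 * (X * (X * q))))),
    neg_one_pow_mul_mem_forms _ (Submodule.sub_mem _ (Submodule.add_mem _
    (C_mul_mem_forms _ (X_mul_mem_forms hp)) (C_mul_mem_forms _ (one_sub_sq_mul_mem_forms hp)))
    (Submodule.add_mem _ (X_mul_mem_forms (one_sub_sq_mul_mem_forms hq)) (C_mul_mem_forms _
    (Submodule.add_mem _ (one_sub_sq_mul_mem_forms (one_sub_sq_mul_mem_forms hq))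
    (C_mul_mem_forms _ (X_mul_mem_forms (X_mul_mem_forms hq))))))), ?_⟩
  rw [bracket, hx, hy, C_ofNat]
  ring

lemma bracket_forms_D : ∃ g ∈ forms S (n - 1 - i + 1),
    Br 1 (-(-1) ^ (n - 1 - i) * X) i = (1 + X ^ 2) * g := by
  obtain ⟨p, hp, q, hq, hx, hy⟩ := isSplitPair_prod β β' n i
  set m := n - 1 - i
  refine ⟨(-1) ^ m * (C (β i) * p - (X * q + C (β i) * ((1 - X ^ 2) * q))),
    neg_one_pow_mul_mem_forms _ (Submodule.sub_mem _ (C_mul_mem_forms _ hp) (Submodule.add_mem _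
    (X_mul_mem_forms hq) (C_mul_mem_forms _ (one_sub_sq_mul_mem_forms hq)))), ?_⟩
  rw [bracket, hx, hy]
  ring

end BracketForms

/-! ### Determinants of coefficient matrices -/

section Determinant

variable {S : Type*} [CommRing S]

lemma prod_range_eq_prod_Iio {N : ℕ} (i : Fin N) (f : ℕ → S) :
    ∏ l ∈ range i, f l = ∏ l ∈ Iio i, f l := by
  rw [← Nat.Iio_eq_range, ← Fin.map_valEmbedding_Iio, prod_map]
  rfl

lemma prod_range_prod_pair {N : ℕ} (β : ℕ → S) :
    ∏ i : Fin N, ((∏ l ∈ range i, (β l - β i) * (1 + β l * β i)) * (-1) ^ (N - 1 - i : ℕ)) =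
      ∏ i : Fin N, ∏ j ∈ Ioi i, (β j - β i) * (1 + β i * β j) := by
  have e : ∏ i : Fin N, ∏ l ∈ range i, (β l - β i) * (1 + β l * β i) =
      ∏ l : Fin N, ∏ i ∈ Ioi l, (β l - β i) * (1 + β l * β i) := by
    rw [prod_congr rfl fun i _ => prod_range_eq_prod_Iio i _]
    exact prod_comm' (by simp)
  rw [prod_mul_distrib, e, ← prod_mul_distrib]
  refine prod_congr rfl fun i _ => ?_
  rw [← Fin.card_Ioi, ← prod_const, ← prod_mul_distrib]
  exact prod_congr rfl fun j _ => by ring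

/-- Polynomials `P_i = κ ∑_l M_{il} (1 - X ^ 2) ^ l X ^ {N - 1 - l}` with `P_i(-β_j) = 0` for
`j < i` have `det M` determined by the values `P_i(-β_i)`: multiply `M` with the projective
Vandermonde matrix of the points `-β_j`. -/
theorem exists_matrix_of_forms {N : ℕ} (β : ℕ → S) (κ : S[X]) (P : Fin N → S[X]) (v : Fin N → S)
    (hP : ∀ i, ∃ g ∈ forms S N, P i = κ * g)
    (h0 : ∀ i j, j < i → (P i).eval (-β j) = 0)
    (hv : ∀ i, (P i).eval (-β i) = (∏ l ∈ range i, (β l - β i) * (1 + β l * β i)) *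
      (-1) ^ (N - 1 - i : ℕ) * κ.eval (-β i) * v i)
    (h₁ : ∀ i j : Fin N, i < j → β j - β i ∈ nonZeroDivisors S)
    (h₂ : ∀ i j : Fin N, 1 + β i * β j ∈ nonZeroDivisors S)
    (h₃ : ∀ i : Fin N, κ.eval (-β i) ∈ nonZeroDivisors S) :
    ∃ M : Matrix (Fin N) (Fin N) S, M.det = ∏ i, v i ∧
      ∀ i, P i = κ * ∑ l, C (M i l) * ((1 - X ^ 2) ^ (l : ℕ) * X ^ (N - 1 - l)) := by
  choose g hg hPg using hP
  choose M hM using fun i => exists_coeff_of_mem_forms (hg i)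
  refine ⟨Matrix.of M, ?_, fun i => by rw [hPg, hM]; rfl⟩
  -- the projective Vandermonde matrix evaluates forms at the points `-β j`
  set V := Matrix.projVandermonde (fun j : Fin N => 1 - β j ^ 2) (fun j => -β j) with hV
  set D := Matrix.diagonal fun j : Fin N => κ.eval (-β j) with hD
  have hentry : ∀ i j, (Matrix.of M * V.transpose * D) i j = (P i).eval (-β j) := by
    intro i j
    rw [hD, Matrix.mul_diagonal, Matrix.mul_apply, hPg, hM, eval_mul, eval_finsetSum, mul_comm]
    congr 1
    refine sum_congr rfl fun l _ => ?_
    rw [Matrix.transpose_apply, hV, Matrix.projVandermonde_apply]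
    simp [Fin.rev, Nat.sub_sub, Nat.add_comm]
  have hdet : (Matrix.of M * V.transpose * D).det = ∏ i : Fin N, (P i).eval (-β i) := by
    rw [Matrix.det_of_isUpperTriangular]
    · exact prod_congr rfl fun i _ => hentry i i
    · intro i j hij
      rw [hentry, h0 i j hij]
  have hVdet : V.det = ∏ i : Fin N, ∏ j ∈ Ioi i, (β j - β i) * (1 + β i * β j) := by
    rw [hV, Matrix.det_projVandermonde]
    exact prod_congr rfl fun i _ => prod_congr rfl fun j _ => by ring
  rw [Matrix.det_mul, Matrix.det_mul, Matrix.det_transpose, hVdet, Matrix.det_diagonal,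
    prod_congr rfl fun i _ => hv i, prod_mul_distrib, prod_mul_distrib,
    prod_range_prod_pair, mul_assoc, mul_comm] at hdet
  refine (mul_cancel_left_mem_nonZeroDivisors (mul_mem ?_ ?_)).1 hdet
  · exact prod_mem fun i _ => prod_mem fun j hj => mul_mem (h₁ i j (mem_Ioi.1 hj)) (h₂ i j)
  · exact prod_mem fun i _ => h₃ i

end Determinant

section Deform

variable {R : Type*} [CommRing R] (β : ℕ → R)

/-- A deformation of `β` over the polynomial ring.  Since its entries and their differences are
monic up to sign, the factors which have to be cancelled in the computation of the determinants are
regular, even if `R` has zero divisors; evaluation at `0` recovers `β`. -/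
noncomputable def deform (i : ℕ) : R[X] := C (β i) + X ^ (i + 1)

lemma eval_zero_deform (i : ℕ) : (deform β i).eval 0 = β i := by simp [deform]

lemma deform_monic (i : ℕ) : (deform β i).Monic := by
  rw [deform, add_comm]
  exact monic_X_pow_add_C _ (by omega)

lemma natDegree_deform [Nontrivial R] (i : ℕ) : (deform β i).natDegree = i + 1 := by
  rw [deform, add_comm, natDegree_X_pow_add_C]

lemma deform_sub_mem {i j : ℕ} (h : i < j) :
    deform β j - deform β i ∈ nonZeroDivisors R[X] := by
  nontriviality R
  refine Monic.mem_nonZeroDivisors ((deform_monic β j).sub_of_left ?_)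
  exact degree_lt_degree (by rw [natDegree_deform, natDegree_deform]; omega)

lemma monic_add_C {p : R[X]} (hp : p.Monic) (hd : 0 < p.natDegree) (c : R) : (p + C c).Monic :=
  hp.add_of_left (degree_C_le.trans_lt (natDegree_pos_iff_degree_pos.1 hd))

lemma one_add_deform_mul_mem (i j : ℕ) :
    1 + deform β i * deform β j ∈ nonZeroDivisors R[X] := by
  nontriviality R
  refine Monic.mem_nonZeroDivisors ?_
  rw [add_comm, ← C_1]
  refine monic_add_C ((deform_monic β i).mul (deform_monic β j)) ?_ 1
  rw [(deform_monic β i).natDegree_mul (deform_monic β j), natDegree_deform]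
  omega

lemma neg_deform_mem (i : ℕ) : -deform β i ∈ nonZeroDivisors R[X] := by
  rw [← neg_one_mul]
  exact mul_mem (IsUnit.mem_nonZeroDivisors isUnit_one.neg) (deform_monic β i).mem_nonZeroDivisors

lemma one_add_C_mul_neg_deform_mem {I : R} (hI : I ^ 2 = -1) (i : ℕ) :
    1 + C I * -deform β i ∈ nonZeroDivisors R[X] := by
  nontriviality R
  have hI' : (C I : R[X]) ^ 2 = -1 := by rw [← C_pow, hI, C_neg, C_1]
  have e : 1 + C I * -deform β i = -C I * (deform β i + C I) := by linear_combination hI'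
  rw [e]
  refine mul_mem (IsUnit.mem_nonZeroDivisors (IsUnit.of_mul_eq_one (C I) ?_))
    (monic_add_C (deform_monic β i) (by rw [natDegree_deform]; omega) I).mem_nonZeroDivisors
  linear_combination -hI'

end Deform

/-! ### The coefficient matrices of the numerators -/

section Numerator

variable {S T : Type*} [CommRing S] [CommRing T] (β β' : ℕ → S) (n : ℕ)

/-- The numerator of the `i`-th created vector; the last term only occurs in the models with a half
column. -/
noncomputable def numerator (P Q e : S[X]) (i : ℕ) : S[X] :=
  hProd (fun k => C (β k)) X 0 i * bracket (fun k => C (β k)) (fun k => C (β' k)) n X P Q i +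
    e * hProd (fun k => C (β k)) X 0 n

lemma map_numerator (φ : S →+* T) (P Q e : S[X]) (i : ℕ) :
    (numerator β β' n P Q e i).map φ =
      numerator (fun k => φ (β k)) (fun k => φ (β' k)) n (P.map φ) (Q.map φ) (e.map φ) i := by
  simp only [← coe_mapRingHom, numerator, map_add, map_mul, map_hProd, map_bracket]
  simp

lemma eval_numerator (P Q e : S[X]) (i : ℕ) (z : S) :
    (numerator β β' n P Q e i).eval z =
      hProd β z 0 i * bracket β β' n z (P.eval z) (Q.eval z) i + e.eval z * hProd β z 0 n := by
  simp only [← coe_evalRingHom, numerator, map_add, map_mul, map_hProd, map_bracket]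
  simp

variable {n}

lemma eval_numerator_of_lt (P Q e : S[X]) {i j : ℕ} (hj : j < i) (hi : i < n) :
    (numerator β β' n P Q e i).eval (-β j) = 0 := by
  rw [eval_numerator, hProd_neg_eq_zero β hj, hProd_neg_eq_zero β (hj.trans hi)]
  ring

lemma eval_numerator_self (P Q e : S[X]) {i : ℕ} (hi : i < n) :
    (numerator β β' n P Q e i).eval (-β i) = (∏ l ∈ range i, (β l - β i) * (1 + β l * β i)) *
      (Q.eval (-β i) * (1 + β i ^ 2) * pairFactor β β' n i) := by
  rw [eval_numerator, hProd_neg_eq_zero β hi, hProd_neg, bracket_neg]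
  ring

lemma eval_zero_numerator (P Q e : S[X]) {i : ℕ} (hi : i < n) (hQ : Q.eval 0 = 0) :
    (numerator β β' n P Q e i).eval 0 =
      (P.eval 0 * ∏ k ∈ Ico (i + 1) n, β' k + e.eval 0) * ∏ l ∈ range n, β l := by
  have := hProd_zero_mul_upperProd β β' hi
  rw [hProd_zero β n] at this
  rw [eval_numerator, bracket, hQ, hProd_zero β n, zero_add]
  linear_combination P.eval 0 * this

lemma numerator_mem_of_bracket {P Q κ : S[X]} {N i : ℕ} (hi : i ≤ N)
    (h : ∃ g ∈ forms S (N - i),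
      bracket (fun k => C (β k)) (fun k => C (β' k)) n X P Q i = κ * g) :
    ∃ g ∈ forms S N, numerator β β' n P Q 0 i = κ * g := by
  obtain ⟨g, hg, h⟩ := h
  refine ⟨_, hProd_mul_mem_forms β i (Nat.sub_add_cancel hi) hg, ?_⟩
  rw [numerator, h]
  ring

/-- In the models with a half column, the numerators vanish at `0`, which lowers the degree. -/
lemma numerator_mem_of_bracket_half {P Q κ : S[X]} {i : ℕ} (hi : i < n) (c : S)
    (h : ∃ g ∈ forms S (n - 1 - i + 1 + 1),
      bracket (fun k => C (β k)) (fun k => C (β' k)) n X P Q i = κ * g)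
    (hQ : Q.eval 0 = 0) (hκ : κ.eval 0 = 1)
    (hc : P.eval 0 * ∏ k ∈ Ico (i + 1) n, β' k + c = 0) :
    ∃ g ∈ forms S n, numerator β β' n P Q (C c * κ) i = κ * X * g := by
  obtain ⟨g, hg, h⟩ := h
  have h1 := hProd_mul_mem_forms β i (show n - 1 - i + 1 + 1 + i = n + 1 by omega) hg
  have h2 := hProd_mul_mem_forms β n (show 1 + n = n + 1 by omega)
    (basis_mem_forms (S := S) (show 0 < 1 by omega))
  have h3 := Submodule.add_mem _ h1 (C_mul_mem_forms c h2)
  have e : numerator β β' n P Q (C c * κ) i = κ * (hProd (fun k => C (β k)) X 0 i * g +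
      C c * (hProd (fun k => C (β k)) X 0 n * ((1 - X ^ 2) ^ 0 * X ^ (1 - 1 - 0)))) := by
    rw [numerator, h]
    ring
  have h0 := congrArg (eval 0) e
  rw [eval_zero_numerator _ _ _ _ _ hi hQ, eval_mul, eval_mul, eval_C, hκ, mul_one, hc, zero_mul,
    one_mul] at h0
  obtain ⟨q, hq, hq'⟩ := exists_X_mul_of_eval_zero h3 h0.symm
  exact ⟨q, hq, by rw [e, hq', mul_assoc]⟩

end Numerator

section Specialise

variable {R : Type*} [CommRing R] (β β' : ℕ → R) (n : ℕ)

lemma map_eval_zero_map_C (p : R[X]) : (p.map C).map (evalRingHom 0) = p := by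
  rw [Polynomial.map_map, show (evalRingHom (0 : R)).comp C = RingHom.id R from RingHom.ext fun a => by simp,
    Polynomial.map_id]

/-- The linear combination of the basis of the forms given by a row of a matrix. -/
noncomputable def formRow {S : Type*} [CommRing S] {N : ℕ} (M : Matrix (Fin N) (Fin N) S)
    (i : Fin N) : S[X] :=
  ∑ l, C (M i l) * ((1 - X ^ 2) ^ (l : ℕ) * X ^ (N - 1 - l))

lemma map_formRow {S T : Type*} [CommRing S] [CommRing T] (φ : S →+* T) {N : ℕ}
    (M : Matrix (Fin N) (Fin N) S) (i : Fin N) :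
    (formRow M i).map φ = formRow (φ.mapMatrix M) i := by
  simp [formRow, Polynomial.map_sum]

/-- The coefficient matrices of the numerators over the polynomial ring, for the deformed
parameters. -/
theorem exists_matrix_deform (P κ : R[X]) (Q e : ℕ → R[X]) (w : ℕ → R[X])
    (hP : ∀ i < n, ∃ g ∈ forms R[X] n, numerator (deform β) (fun k => C (β' k)) n
      (P.map C) ((Q i).map C) ((e i).map C) i = κ.map C * g)
    (hQ : ∀ i < n, ((Q i).map C).eval (-deform β i) * (1 + deform β i ^ 2) =
      (-1) ^ (n - 1 - i) * (κ.map C).eval (-deform β i) * w i)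
    (hκ : ∀ i < n, (κ.map C).eval (-deform β i) ∈ nonZeroDivisors R[X]) :
    ∃ M : Matrix (Fin n) (Fin n) R[X],
      M.det = ∏ i : Fin n, (w i * pairFactor (deform β) (fun k => C (β' k)) n i) ∧
      ∀ i : Fin n, numerator (deform β) (fun k => C (β' k)) n
        (P.map C) ((Q i).map C) ((e i).map C) i = κ.map C * formRow M i := by
  refine exists_matrix_of_forms (deform β) (κ.map C) _ _ (fun i => hP i i.2)
    (fun i j hj => eval_numerator_of_lt _ _ _ _ _ hj i.2) (fun i => ?_)
    (fun i j h => deform_sub_mem β h) (fun i j => one_add_deform_mul_mem β i j)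
    (fun i => hκ i i.2)
  rw [eval_numerator_self _ _ _ _ _ i.2, hQ i i.2]
  ring

/-- The coefficient matrices of the numerators, obtained from those of the deformed parameters by
specialisation. -/
theorem exists_matrix_specialise (P κ : R[X]) (Q e : ℕ → R[X]) (w : ℕ → R[X])
    (hP : ∀ i < n, ∃ g ∈ forms R[X] n, numerator (deform β) (fun k => C (β' k)) n
      (P.map C) ((Q i).map C) ((e i).map C) i = κ.map C * g)
    (hQ : ∀ i < n, ((Q i).map C).eval (-deform β i) * (1 + deform β i ^ 2) =
      (-1) ^ (n - 1 - i) * (κ.map C).eval (-deform β i) * w i)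
    (hκ : ∀ i < n, (κ.map C).eval (-deform β i) ∈ nonZeroDivisors R[X]) :
    ∃ M : Matrix (Fin n) (Fin n) R,
      M.det = ∏ i : Fin n, ((w i).eval 0 * pairFactor β β' n i) ∧
      ∀ i : Fin n, numerator β β' n P (Q i) (e i) i = κ * formRow M i := by
  obtain ⟨M, hM, hP⟩ := exists_matrix_deform β β' n P κ Q e w hP hQ hκ
  refine ⟨(evalRingHom 0).mapMatrix M, ?_, fun i => ?_⟩
  · rw [← RingHom.map_det, hM, map_prod]
    refine prod_congr rfl fun i _ => ?_
    rw [map_mul, map_pairFactor]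
    simp [eval_zero_deform]
  · have := congrArg (Polynomial.map (evalRingHom 0)) (hP i)
    rw [map_numerator, Polynomial.map_mul (evalRingHom 0), map_formRow] at this
    simpa only [map_eval_zero_map_C, coe_evalRingHom, eval_zero_deform, eval_C] using this

variable {I : R} (βc : R)

lemma C_sq_eq (hI : I ^ 2 = -1) : (C I : R[X]) ^ 2 = -1 := by rw [← C_pow, hI, C_neg, C_1]

lemma exists_matrix_B (hI : I ^ 2 = -1) : ∃ M : Matrix (Fin n) (Fin n) R,
    M.det = ∏ i : Fin n, ((1 + I * β i) * pairFactor β β' n i) ∧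
    ∀ i : Fin n, numerator β β' n (C I) ((-1) ^ (n - 1 - i : ℕ)) 0 i =
      (1 + C I * X) * formRow M i := by
  have hI' := C_sq_eq hI
  have := exists_matrix_specialise β β' n (C I) (1 + C I * X) (fun i => (-1) ^ (n - 1 - i)) 0
    (fun i => 1 + C I * deform β i) (fun i hi => ?_) (fun i _ => ?_) (fun i _ => ?_)
  · simpa [eval_zero_deform] using this
  · have h := bracket_forms_B (deform β) (fun k => C (β' k)) n i hI'
    rw [show n - 1 - i + 1 = n - i by omega] at h
    simpa using numerator_mem_of_bracket _ _ hi.le h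
  · simp
    linear_combination (-1) ^ (n - 1 - i) * deform β i ^ 2 * hI'
  · simpa using one_add_C_mul_neg_deform_mem β hI i

lemma exists_matrix_Bstar : ∃ M : Matrix (Fin n) (Fin n) R,
    M.det = ∏ i : Fin n, ((1 + βc * β i) * pairFactor β β' n i) ∧
    ∀ i : Fin n, numerator β β' n (X + C βc) ((-1) ^ (n - 1 - i : ℕ) * (1 - C βc * X)) 0 i =
      (1 + X ^ 2) * formRow M i := by
  have := exists_matrix_specialise β β' n (X + C βc) (1 + X ^ 2)
    (fun i => (-1) ^ (n - 1 - i) * (1 - C βc * X)) 0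
    (fun i => 1 + C βc * deform β i) (fun i hi => ?_) (fun i _ => ?_) (fun i _ => ?_)
  · simpa [eval_zero_deform] using this
  · have h := bracket_forms_Bstar (deform β) (fun k => C (β' k)) (C βc) n i
    rw [show n - 1 - i + 1 = n - i by omega] at h
    simpa using numerator_mem_of_bracket _ _ hi.le h
  · simp
    ring
  · simpa [sq] using one_add_deform_mul_mem β i i

lemma exists_matrix_C (hI : I ^ 2 = -1) : ∃ M : Matrix (Fin n) (Fin n) R,
    M.det = ∏ i : Fin n, ((1 + I * β i) * (1 + βc * β i) * pairFactor β β' n i) ∧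
    ∀ i : Fin n, numerator β β' n (C I * (X + C βc))
      ((-1) ^ (n - 1 - i : ℕ) * X * (1 - C βc * X))
      (C (-(I * βc * ∏ k ∈ Ico (i + 1 : ℕ) n, β' k)) * (1 + C I * X)) i =
      (1 + C I * X) * X * formRow M i := by
  have hI' := C_sq_eq hI
  have := exists_matrix_specialise β β' n (C I * (X + C βc)) ((1 + C I * X) * X)
    (fun i => (-1) ^ (n - 1 - i) * X * (1 - C βc * X))
    (fun i => C (-(I * βc * ∏ k ∈ Ico (i + 1 : ℕ) n, β' k)) * (1 + C I * X))
    (fun i => (1 + C I * deform β i) * (1 + C βc * deform β i))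
    (fun i hi => ?_) (fun i _ => ?_) (fun i _ => ?_)
  · simpa [eval_zero_deform] using this
  · have h := bracket_forms_C (deform β) (fun k => C (β' k)) (C βc) n i hI'
    have h2 := numerator_mem_of_bracket_half _ _ hi
      (C (-(I * βc * ∏ k ∈ Ico (i + 1 : ℕ) n, β' k))) h (by simp) (by simp)
      (by simp [map_prod])
    simp only [Polynomial.map_mul, Polynomial.map_add, Polynomial.map_sub, Polynomial.map_pow,
      Polynomial.map_neg, Polynomial.map_one, map_C, map_X]
    exact h2
  · simp
    linear_combination (-1) ^ (n - 1 - i) * deform β i ^ 3 * (1 + C βc * deform β i) * hI'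
  · have := mul_mem (one_add_C_mul_neg_deform_mem β hI i) (neg_deform_mem β i)
    simpa using this

lemma exists_matrix_Cstar : ∃ M : Matrix (Fin n) (Fin n) R,
    M.det = ∏ i : Fin n, ((1 + β i ^ 2) * pairFactor β β' n i) ∧
    ∀ i : Fin n, numerator β β' n 1 ((-1) ^ (n - 1 - i : ℕ) * X)
      (C (-∏ k ∈ Ico (i + 1 : ℕ) n, β' k)) i = X * formRow M i := by
  have := exists_matrix_specialise β β' n 1 X
    (fun i => (-1) ^ (n - 1 - i) * X) (fun i => C (-∏ k ∈ Ico (i + 1 : ℕ) n, β' k))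
    (fun i => 1 + deform β i ^ 2) (fun i hi => ?_) (fun i _ => ?_) (fun i _ => ?_)
  · simpa [eval_zero_deform] using this
  · have h := bracket_forms_Cstar (deform β) (fun k => C (β' k)) n i
    have h2 := numerator_mem_of_bracket_half _ _ hi (C (-∏ k ∈ Ico (i + 1 : ℕ) n, β' k)) h
      (by simp) (by simp) (by simp [map_prod])
    simp only [mul_one, one_mul] at h2
    simp only [Polynomial.map_mul, Polynomial.map_pow, Polynomial.map_neg, Polynomial.map_one, map_C, map_X]
    exact h2
  · simp
  · simpa using neg_deform_mem β i

/-- The last column of the matrix in the case of `𝔇` with `1 ∈ λ` is divisible by `∏ β`, and this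
factor, which also occurs in the determinant, can be cancelled in the deformation. -/
lemma exists_matrix_D : ∃ M : Matrix (Fin (n + 1)) (Fin (n + 1)) R,
    M.det = ∏ i : Fin (n + 1), pairFactor β β' (n + 1) i ∧
    (∀ i, M i (Fin.last n) = ∏ k ∈ Ico (i + 1 : ℕ) (n + 1), β' k) ∧
    ∀ i : Fin (n + 1), numerator β β' (n + 1) 1 (-(-1) ^ (n + 1 - 1 - i : ℕ) * X) 0 i =
      (1 + X ^ 2) *
        formRow (M.updateCol (Fin.last n) ((∏ k ∈ range (n + 1), β k) • M.col (Fin.last n))) i := by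
  have key := exists_matrix_deform β β' (n + 1) 1 (1 + X ^ 2)
    (fun i => -(-1) ^ (n + 1 - 1 - i) * X) 0 (deform β) (fun i hi => ?_) (fun i _ => ?_)
    (fun i _ => ?_)
  · obtain ⟨M, hM, hP⟩ := key
    set T := ∏ k ∈ range (n + 1), deform β k with hT
    set c : Fin (n + 1) → R[X] := fun i => ∏ k ∈ Ico (i + 1 : ℕ) (n + 1), C (β' k) with hc
    have hlast : M.col (Fin.last n) = T • c := by
      ext1 i
      have := congrArg (eval 0) (hP i)
      rw [eval_zero_numerator _ _ _ _ _ i.2 (by simp), eval_mul, formRow, eval_zero_form] at this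
      simp only [Polynomial.map_one, eval_one, one_mul, Pi.zero_apply, Polynomial.map_zero,
        eval_zero, add_zero, Polynomial.map_add, Polynomial.map_pow, Polynomial.map_X, eval_add,
        eval_pow, eval_X, ne_eq, OfNat.ofNat_ne_zero, not_false_eq_true, zero_pow] at this
      rw [Matrix.col_apply, ← this, Pi.smul_apply, smul_eq_mul, mul_comm]
    have hM' : M = (M.updateCol (Fin.last n) c).updateCol (Fin.last n) (T • c) := by
      rw [Matrix.updateCol_idem, ← hlast]
      exact (Matrix.updateCol_eq_self M _).symm
    have hdet : (M.updateCol (Fin.last n) c).det =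
        ∏ i : Fin (n + 1), pairFactor (deform β) (fun k => C (β' k)) (n + 1) i := by
      have h := congrArg Matrix.det hM'
      rw [Matrix.det_updateCol_smul, Matrix.updateCol_idem, hM, prod_mul_distrib,
        Fin.prod_univ_eq_prod_range (deform β)] at h
      refine ((mul_cancel_left_mem_nonZeroDivisors ?_).1 h).symm
      exact prod_mem fun i _ => (deform_monic β i).mem_nonZeroDivisors
    refine ⟨(evalRingHom 0).mapMatrix (M.updateCol (Fin.last n) c), ?_, fun i => ?_, fun i => ?_⟩
    · rw [← RingHom.map_det, hdet, map_prod]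
      refine prod_congr rfl fun i _ => ?_
      rw [map_pairFactor]
      simp [eval_zero_deform]
    · simp [hc, eval_prod]
    · have := congrArg (Polynomial.map (evalRingHom 0)) (hP i)
      rw [map_numerator, Polynomial.map_mul (evalRingHom 0), map_formRow] at this
      simp only [map_eval_zero_map_C, coe_evalRingHom, eval_zero_deform, eval_C, Pi.zero_apply]
        at this
      rw [this]
      congr 2
      ext a b
      rcases eq_or_ne b (Fin.last n) with rfl | hb
      · have := congrFun hlast a
        rw [Matrix.col_apply] at this
        simp [this, hT, hc, eval_prod, eval_zero_deform]
      · simp [hb]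
  · have h := bracket_forms_D (deform β) (fun k => C (β' k)) (n + 1) i
    rw [show n + 1 - 1 - i + 1 = n + 1 - i by omega] at h
    simpa using numerator_mem_of_bracket _ _ hi.le h
  · simp
    ring
  · simpa [sq] using one_add_deform_mul_mem β i i

/-- In the model `𝔅ℭ` the central row contributes the additional numerator
`∏ (X + β_l) (1 - β_l X)`. -/
lemma exists_matrix_BC : ∃ M : Matrix (Fin (n + 1)) (Fin (n + 1)) R,
    M.det = ∏ i : Fin n, ((1 + β i ^ 2) * (1 + βc * β i) * pairFactor β β' n i) ∧
    ∀ i : Fin (n + 1), (if (i : ℕ) < n then numerator β β' n (X + C βc)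
      ((-1) ^ (n - 1 - i + 1 : ℕ) * (1 - C βc * X)) 0 i else
      hProd (fun k => C (β k)) X 0 i) = formRow M i := by
  have key := exists_matrix_of_forms (N := n + 1) (deform β) 1
    (fun i => if (i : ℕ) < n then numerator (deform β) (fun k => C (β' k)) n (X + C (C βc))
      ((-1) ^ (n - 1 - i + 1 : ℕ) * (1 - C (C βc) * X)) 0 i else
      hProd (fun k => C (deform β k)) X 0 i)
    (fun i => if (i : ℕ) < n then (1 + deform β i ^ 2) * (1 + C βc * deform β i) *
      pairFactor (deform β) (fun k => C (β' k)) n i else 1)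
    (fun i => ?_) (fun i j hj => ?_) (fun i => ?_)
    (fun i j h => deform_sub_mem β h) (fun i j => one_add_deform_mul_mem β i j)
    (fun i => by simp)
  · obtain ⟨M, hM, hP⟩ := key
    refine ⟨(evalRingHom 0).mapMatrix M, ?_, fun i => ?_⟩
    · rw [← RingHom.map_det, hM, Fin.prod_univ_castSucc, map_mul, map_prod]
      simp only [Fin.val_castSucc, Fin.is_lt, if_true, Fin.val_last, lt_irrefl, if_false, map_one,
        mul_one]
      refine prod_congr rfl fun i _ => ?_
      rw [map_mul, map_pairFactor]
      simp [eval_zero_deform]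
    · have := congrArg (Polynomial.map (evalRingHom 0)) (hP i)
      rw [one_mul, ← formRow, map_formRow] at this
      rw [← this]
      split_ifs with h
      · rw [map_numerator]
        simp [eval_zero_deform]
      · rw [← coe_mapRingHom, map_hProd]
        simp [eval_zero_deform]
  · split_ifs with h
    · have h' := bracket_forms_BC (deform β) (fun k => C (β' k)) (C βc) n i
      rw [show n - 1 - i + 1 + 1 = n + 1 - i by omega] at h'
      exact numerator_mem_of_bracket _ _ i.2.le h'
    · have h1 := hProd_mul_mem_forms (deform β) i (show 1 + (i : ℕ) = n + 1 by omega)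
        (basis_mem_forms (S := R[X]) (show 0 < 1 by omega))
      exact ⟨_, h1, by simp⟩
  · have hj' : (j : ℕ) < i := hj
    split_ifs with h
    · exact eval_numerator_of_lt _ _ _ _ _ hj h
    · rw [← coe_evalRingHom, map_hProd]
      simpa using hProd_neg_eq_zero (deform β) hj'
  · split_ifs with h
    · rw [eval_numerator_self _ _ _ _ _ h, show n + 1 - 1 - (i : ℕ) = n - 1 - i + 1 by omega]
      simp
      ring
    · rw [show n + 1 - 1 - (i : ℕ) = 0 by omega, ← coe_evalRingHom, map_hProd]
      simpa using hProd_neg (deform β) i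

end Specialise

end BentIce

namespace BentIce

open Finset PowerSeries

/-! ### Partition functions as products of determinants -/

section Product

variable {R : Type*} [CommRing R]

/-- The inclusion of polynomials into power series. -/
noncomputable abbrev toSeries : Polynomial R →+* R⟦X⟧ := Polynomial.coeToPowerSeries.ringHom

lemma toSeries_C (a : R) : toSeries (Polynomial.C a) = C a := by simp

lemma toSeries_X : toSeries (Polynomial.X : Polynomial R) = X := by simp

lemma toSeries_numerator (b : ℕ → R × R) (n : ℕ) (P Q e : Polynomial R) (i : ℕ) :
    toSeries (numerator (fun k => (b k).1) (fun k => (b k).2) n P Q e i) =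
      hProd (fstC b) X 0 i * bracket (fstC b) (sndC b) n X (toSeries P) (toSeries Q) i +
        toSeries e * hProd (fstC b) X 0 n := by
  rw [numerator, map_add, map_mul, map_mul, map_hProd, map_hProd, map_bracket, toSeries_X]
  simp only [toSeries_C]
  rfl

lemma toSeries_formRow {N : ℕ} (M : Matrix (Fin N) (Fin N) R) (i : Fin N) :
    toSeries (formRow M i) = ∑ l, C (M i l) * ((1 - X ^ 2) ^ (l : ℕ) * X ^ (N - 1 - l)) := by
  rw [formRow, map_sum]
  refine sum_congr rfl fun l _ => ?_
  rw [map_mul, map_mul, map_pow, map_pow, map_sub, map_pow, map_one, toSeries_C, toSeries_X]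

lemma exists_mul_eq_one {W : R⟦X⟧} (hW : constantCoeff W = 1) :
    ∃ U, W * U = 1 ∧ constantCoeff U = 1 := by
  obtain ⟨U, hU⟩ := (isUnit_iff_constantCoeff.2 (hW ▸ isUnit_one) : IsUnit W).exists_right_inv
  refine ⟨U, hU, ?_⟩
  have := congrArg constantCoeff hU
  rwa [map_mul, hW, one_mul, map_one] at this

/-- Vectors whose generating functions are `X κ / W` times forms have the determinant of the
coefficients of the forms as a factor of their exterior product. -/
theorem det_dvd_wedgeSeries {N : ℕ} {lam : Fin N → ℕ} (hlam : StrictAnti lam) {l : List R⟦X⟧}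
    {W κ : R⟦X⟧} (hW : constantCoeff W = 1) {num : ℕ → R⟦X⟧} {M : Matrix (Fin N) (Fin N) R}
    (h : List.Forall₂ (fun f i => ∃ g, (∀ k, coeff (lam k) f = coeff (lam k) g) ∧
      W * g = num i) l (List.range' 0 N))
    (hM : ∀ i : Fin N, num i = X * κ * toSeries (formRow M i)) :
    M.det ∣ wedgeSeries l (univ.image lam) ∧
      (lam = rho N → constantCoeff κ = 1 → wedgeSeries l (univ.image lam) = M.det) := by
  obtain ⟨f, hf, hZ⟩ := wedgeSeries_eq_det hlam h
  obtain ⟨U, hU, hU₁⟩ := exists_mul_eq_one hW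
  set E : Fin N → R⟦X⟧ := fun l => X * κ * ((1 - X ^ 2) ^ (l : ℕ) * X ^ (N - 1 - l)) * U with hE
  have hdet := det_coeff_eq lam f E M fun i k => by
    obtain ⟨g, hg, hWg⟩ := hf i
    rw [hg]
    congr 1
    have e : g = num i * U := by
      calc g = W * g * U := by rw [mul_right_comm, hU, one_mul]
        _ = _ := by rw [hWg]
    rw [e, hM, toSeries_formRow, mul_sum, sum_mul]
    refine sum_congr rfl fun l _ => ?_
    rw [hE]
    ring
  rw [hZ, hdet]
  refine ⟨dvd_mul_right _ _, fun hl hκ => ?_⟩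
  subst hl
  rw [det_coeff_rho, mul_one]
  refine fun l => ⟨κ * (1 - X ^ 2) ^ (l : ℕ) * U, ?_, by simp [hκ, hU₁]⟩
  have hl := l.2
  rw [hE, show N - (l : ℕ) = N - 1 - l + 1 by omega, pow_succ]
  ring

variable {b : ℕ → R × R} {n : ℕ} {A : R⟦X⟧ → R⟦X⟧} {nc dc ε : R⟦X⟧} {θ : R}

lemma constantCoeff_denominator (j : ℕ) : constantCoeff (denominator b n j) = 1 := by
  simp [denominator, map_prod, fstC, sndC]

/-- The exterior product of the vectors created in a model without half column and without vector
created by the central row. -/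
theorem wedgeSeries_created_full {lam : Fin n → ℕ} (hlam : StrictAnti lam)
    (hA : ∀ φ, ∃ ψ, A (X ^ 1 * φ) = X ^ 1 * ψ ∧ dc * ψ = nc * φ)
    (hdc : constantCoeff dc = 1) (δ : R) {P κ : Polynomial R} {Q : ℕ → Polynomial R}
    (hP : toSeries P = C δ * nc) (hQ : ∀ i, toSeries (Q i) = (-1) ^ (n - 1 - i) * dc)
    {M : Matrix (Fin n) (Fin n) R}
    (hM : ∀ i : Fin n, numerator (fun k => (b k).1) (fun k => (b k).2) n P (Q i) 0 i =
      κ * formRow M i) :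
    M.det ∣ wedgeSeries (created 1 1 δ 1 A [] ((List.range' 0 n).map b)) (univ.image lam) ∧
      (lam = rho n → constantCoeff (toSeries κ) = 1 →
        wedgeSeries (created 1 1 δ 1 A [] ((List.range' 0 n).map b)) (univ.image lam) = M.det) := by
  have h := created_full (n := n) (b := b) (G := []) hA hdc δ 1
    (fun i => bracket (fstC b) (sndC b) n X (toSeries P) (toSeries (Q i)) i)
    (fun i _ => by simp [-Polynomial.coeToPowerSeries.ringHom_apply, hP, hQ]) (by simp)
    List.Forall₂.nil n 0 (zero_add n)
  rw [List.forall₂_map_right_iff] at h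
  refine det_dvd_wedgeSeries hlam (W := dc * denominator b n 0)
    (by rw [map_mul, hdc, constantCoeff_denominator, one_mul])
    (num := fun i => X * toSeries (numerator (fun k => (b k).1) (fun k => (b k).2) n P (Q i) 0 i))
    (κ := toSeries κ) (M := M) (h.imp fun f i hf => ?_) (fun i => by rw [hM, map_mul, mul_assoc])
  refine ⟨f, fun _ => rfl, ?_⟩
  rw [hf, toSeries_numerator, map_zero, zero_mul, add_zero, pow_one]

/-- The vectors created in a model with a half column, in terms of the numerators. -/
lemma created_half_numerator {m : ℕ}
    (hA : ∀ φ, ∃ ρ, A (X ^ m * φ) = X ^ m * (C (θ * constantCoeff φ) + ρ) ∧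
      constantCoeff ρ = 0 ∧ dc * ρ = nc * φ + C (constantCoeff φ) * ε) (δ σ : R)
    {P : Polynomial R} {Q e : ℕ → Polynomial R}
    (hP : toSeries P = C δ * nc) (hQ : ∀ i, toSeries (Q i) = C (σ * (-1) ^ (n - 1 - i)) * X * dc)
    (he : ∀ i, toSeries (e i) = C (δ * ∏ l ∈ Ico (i + 1) n, (b l).2) * ε) :
    List.Forall₂ (fun f i => ∃ ρ,
        f = X ^ m * (C (δ * θ * ∏ l ∈ Ico (i + 1) n, (b l).2) + ρ) ∧
        dc * denominator b n 0 * ρ =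
          toSeries (numerator (fun k => (b k).1) (fun k => (b k).2) n P (Q i) (e i) i))
      (created (m + 1) m δ σ A [] ((List.range' 0 n).map b)) (List.range' 0 n) := by
  refine (created_half (n := n) (b := b) hA δ σ n 0 (zero_add n)).imp fun f i hf => ?_
  obtain ⟨ρ, h1, -, h2⟩ := hf
  exact ⟨ρ, h1, by rw [h2, toSeries_numerator, hP, hQ, he]⟩

lemma rowSeries_spec (c : R) (φ : R⟦X⟧) : ∃ ψ, rowSeries 1 c c (X ^ 1 * φ) = X ^ 1 * ψ ∧
    (1 - C c * X) * ψ = (X + C c) * φ := by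
  refine ⟨_, rowSeries_mul 1 c c φ, ?_⟩
  linear_combination (X + C c) * φ * one_sub_mul_geometric c

lemma id_spec (m : ℕ) (φ : R⟦X⟧) : ∃ ρ, id (X ^ m * φ) =
    X ^ m * (C (1 * constantCoeff φ) + ρ) ∧
      constantCoeff ρ = 0 ∧ 1 * ρ = 1 * φ + C (constantCoeff φ) * -1 :=
  ⟨φ - C (constantCoeff φ), by simp, by simp, by ring⟩

lemma cornerSeries_spec (c ℓ : R) (φ : R⟦X⟧) : ∃ ρ, cornerSeries c c ℓ (X ^ 0 * φ) =
    X ^ 0 * (C (0 * constantCoeff φ) + ρ) ∧ constantCoeff ρ = 0 ∧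
      (1 - C c * X) * ρ = (X + C c) * φ + C (constantCoeff φ) * (C ℓ * X - (X + C c)) := by
  have hlow : lowPart 1 φ = C (constantCoeff φ) := by
    ext k
    rw [coeff_lowPart, coeff_C]
    rcases Nat.eq_zero_or_pos k with rfl | hk
    · simp
    · rw [if_neg (by omega), if_neg (by omega)]
  refine ⟨cornerSeries c c ℓ φ, by simp, ?_, ?_⟩
  · simp [cornerSeries, hlow]
  · rw [cornerSeries, hlow, coeff_zero_eq_constantCoeff_apply, map_mul]
    linear_combination ((X + C c) * (φ - C (constantCoeff φ)) +
      C ℓ * C (constantCoeff φ) * X) * one_sub_mul_geometric c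

end Product

/-! ### The six families -/

section Families

variable {R : Type*} [CommRing R] {I : R} (hI : I ^ 2 = -1) {n : ℕ} (t : Fin n → R)
  (x : Fin n → Rˣ) (tc xc : R)

include hI in
lemma prod_pairFactor : ∏ i : Fin n, pairFactor (fun k => (layer I t x k).1)
    (fun k => (layer I t x k).2) n i = pairProduct t x := by
  refine prod_congr rfl fun i _ => ?_
  have e : Ico (i + 1 : ℕ) n = (Ioi i).map Fin.valEmbedding := by
    ext k
    simp only [mem_Ico, mem_map, mem_Ioi, Fin.valEmbedding_apply, Fin.lt_def]
    exact ⟨fun h => ⟨⟨k, h.2⟩, h.1, rfl⟩, fun ⟨a, h, hk⟩ => ⟨by omega, by omega⟩⟩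
  rw [pairFactor, e, prod_map]
  refine prod_congr rfl fun k _ => ?_
  simp only [layer, Fin.valEmbedding_apply, Fin.is_lt, dif_pos, Fin.eta]
  have e1 : 1 + I * t i * (x i : R) * (I * t k * (x k : R)) = 1 - t i * t k * x i * x k := by
    linear_combination t i * x i * t k * x k * hI
  have e2 : 1 + I * t i * (x i : R) * (I * t k * ((x k)⁻¹ : Rˣ)) =
      1 - t i * t k * x i * ((x k)⁻¹ : Rˣ) := by
    linear_combination t i * x i * t k * ((x k)⁻¹ : Rˣ) * hI
  rw [e1, e2, mul_comm]

lemma layer_fst (i : Fin n) : (layer I t x i).1 = I * t i * (x i : R) := by simp [layer]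

include hI in
lemma prod_one_add_sq : ∏ i : Fin n, ((1 + (layer I t x i).1 ^ 2) *
    pairFactor (fun k => (layer I t x k).1) (fun k => (layer I t x k).2) n i) =
      (∏ j, (1 - t j ^ 2 * (x j : R) ^ 2)) * pairProduct t x := by
  rw [prod_mul_distrib, prod_pairFactor hI]
  congr 1
  refine prod_congr rfl fun i _ => ?_
  rw [layer_fst]
  linear_combination t i ^ 2 * x i ^ 2 * hI

include hI in
theorem Z_B_spec {lam : Fin n → ℕ} (hlam : IsStrict lam) :
    (∏ j, (1 - t j * (x j : R))) * pairProduct t x ∣ Z I .B t x tc xc lam ∧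
    (lam = rho n →
      Z I .B t x tc xc lam = (∏ j, (1 - t j * (x j : R))) * pairProduct t x) := by
  obtain ⟨M, hdet, hM⟩ := exists_matrix_B (fun k => (layer I t x k).1)
    (fun k => (layer I t x k).2) n hI
  have hdet' : M.det = (∏ j, (1 - t j * (x j : R))) * pairProduct t x := by
    rw [hdet, prod_mul_distrib, prod_pairFactor hI]
    congr 1
    refine prod_congr rfl fun i _ => ?_
    rw [layer_fst]
    linear_combination t i * x i * hI
  have := wedgeSeries_created_full hlam.1 (b := layer I t x) (A := id) (nc := 1) (dc := 1)
    (fun φ => ⟨φ, rfl, rfl⟩) (by simp) I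
    (Q := fun i => (-1) ^ (n - 1 - i)) (by simp) (by simp) hM
  rw [Z_B hI t x tc xc hlam.2, ← hdet']
  exact ⟨this.1, fun h => this.2 h (by simp)⟩

include hI in
theorem Z_Bstar_spec {lam : Fin n → ℕ} (hlam : IsStrict lam) :
    (∏ j, (1 - tc * t j * xc * (x j : R))) * pairProduct t x ∣ Z I .Bstar t x tc xc lam ∧
    (lam = rho n → Z I .Bstar t x tc xc lam =
      (∏ j, (1 - tc * t j * xc * (x j : R))) * pairProduct t x) := by
  obtain ⟨M, hdet, hM⟩ := exists_matrix_Bstar (fun k => (layer I t x k).1)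
    (fun k => (layer I t x k).2) n (I * tc * xc)
  have hdet' : M.det = (∏ j, (1 - tc * t j * xc * (x j : R))) * pairProduct t x := by
    rw [hdet, prod_mul_distrib, prod_pairFactor hI]
    congr 1
    refine prod_congr rfl fun i _ => ?_
    rw [layer_fst]
    linear_combination tc * xc * t i * x i * hI
  have := wedgeSeries_created_full hlam.1 (b := layer I t x) (rowSeries_spec (I * tc * xc))
    (by simp) 1 (Q := fun i => (-1) ^ (n - 1 - i) *
      (1 - Polynomial.C (I * tc * xc) * Polynomial.X)) (by simp) (by simp) hM
  rw [Z_Bstar hI t x tc xc hlam.2, ← hdet']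
  exact ⟨this.1, fun h => this.2 h (by simp)⟩

include hI in
theorem Z_C_spec {lam : Fin n → ℕ} (hlam : IsStrict lam) :
    (∏ j, (1 - t j * (x j : R)) * (1 - t j * tc * xc * (x j : R))) * pairProduct t x ∣
      Z I .C t x tc xc lam ∧
    (lam = rho n → Z I .C t x tc xc lam =
      (∏ j, (1 - t j * (x j : R)) * (1 - t j * tc * xc * (x j : R))) * pairProduct t x) := by
  obtain ⟨M, hdet, hM⟩ := exists_matrix_C (fun k => (layer I t x k).1)
    (fun k => (layer I t x k).2) n (I * tc * xc) hI
  have hdet' : M.det = (∏ j, (1 - t j * (x j : R)) * (1 - t j * tc * xc * (x j : R))) *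
      pairProduct t x := by
    rw [hdet, prod_mul_distrib, prod_pairFactor hI]
    congr 1
    refine prod_congr rfl fun i _ => ?_
    rw [layer_fst]
    have e1 : 1 + I * (I * t i * (x i : R)) = 1 - t i * x i := by
      linear_combination t i * x i * hI
    have e2 : 1 + I * tc * xc * (I * t i * (x i : R)) = 1 - t i * tc * xc * x i := by
      linear_combination t i * tc * xc * x i * hI
    rw [e1, e2]
  have h := created_half_numerator (n := n) (b := layer I t x)
    (cornerSeries_spec (I * tc * xc) (1 - I * (I * tc * xc))) I 1
    (P := Polynomial.C I * (Polynomial.X + Polynomial.C (I * tc * xc)))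
    (Q := fun i => (-1) ^ (n - 1 - i) * Polynomial.X *
      (1 - Polynomial.C (I * tc * xc) * Polynomial.X))
    (e := fun i => Polynomial.C (-(I * (I * tc * xc) * ∏ k ∈ Ico (i + 1 : ℕ) n,
      (layer I t x k).2)) * (1 + Polynomial.C I * Polynomial.X))
    (by simp) (by simp) (fun i => by
      simp only [map_mul, map_add, map_one, map_neg, map_sub, toSeries_C, toSeries_X]
      ring)
  have := det_dvd_wedgeSeries hlam.1
    (W := (1 - C (I * tc * xc) * X) * denominator (layer I t x) n 0)
    (by simp [constantCoeff_denominator]) (κ := 1 + C I * X) (M := M)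
    (h.imp fun f i hf => by
      obtain ⟨ρ, hf, hρ⟩ := hf
      refine ⟨ρ, fun k => ?_, hρ⟩
      rw [hf, pow_zero, one_mul, map_add, coeff_C, if_neg (by have := hlam.2 k; omega), zero_add])
    (fun i => by
      rw [hM i]
      simp only [map_mul, map_add, map_one, toSeries_C, toSeries_X]
      ring)
  rw [Z_C hI t x tc xc hlam.2, ← hdet']
  exact ⟨this.1, fun h => this.2 h (by simp)⟩

include hI in
theorem Z_Cstar_spec {lam : Fin n → ℕ} (hlam : IsStrict lam) :
    (∏ j, (1 - t j ^ 2 * (x j : R) ^ 2)) * pairProduct t x ∣ Z I .Cstar t x tc xc lam ∧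
    (lam = rho n → Z I .Cstar t x tc xc lam =
      (∏ j, (1 - t j ^ 2 * (x j : R) ^ 2)) * pairProduct t x) := by
  obtain ⟨M, hdet, hM⟩ := exists_matrix_Cstar (fun k => (layer I t x k).1)
    (fun k => (layer I t x k).2) n
  have hdet' := hdet.trans (prod_one_add_sq hI t x)
  have h := created_half_numerator (n := n) (b := layer I t x) (A := id) (dc := 1) (nc := 1)
    (id_spec 0) 1 1 (P := 1) (Q := fun i => (-1) ^ (n - 1 - i) * Polynomial.X)
    (e := fun i => Polynomial.C (-∏ k ∈ Ico (i + 1 : ℕ) n, (layer I t x k).2))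
    (by simp) (by simp) (fun i => by rw [toSeries_C, map_neg, one_mul, mul_neg_one])
  have := det_dvd_wedgeSeries hlam.1 (W := 1 * denominator (layer I t x) n 0)
    (by simp [constantCoeff_denominator]) (κ := 1) (M := M)
    (h.imp fun f i hf => by
      obtain ⟨ρ, hf, hρ⟩ := hf
      refine ⟨ρ, fun k => ?_, hρ⟩
      rw [hf, pow_zero, one_mul, map_add, coeff_C, if_neg (by have := hlam.2 k; omega), zero_add])
    (fun i => by rw [hM i, map_mul, toSeries_X, mul_one])
  rw [Z_Cstar hI t x tc xc hlam.2, ← hdet']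
  exact ⟨this.1, fun h => this.2 h (by simp)⟩

include hI in
/-- Without a part `1`, the constant terms of the created vectors, which sit on the half column, do
not contribute, and the numerators are those of `ℭ_*`. -/
theorem Z_D_dvd_of_one_notMem {lam : Fin n → ℕ} (hlam : IsStrict lam) (h1 : ¬ ∃ j, lam j = 1) :
    (∏ j, (1 - t j ^ 2 * (x j : R) ^ 2)) * pairProduct t x ∣ Z I .D t x tc xc lam := by
  obtain ⟨M, hdet, hM⟩ := exists_matrix_Cstar (fun k => (layer I t x k).1)
    (fun k => (layer I t x k).2) n
  have hdet' := hdet.trans (prod_one_add_sq hI t x)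
  have hlam2 : ∀ k, lam k ≠ 1 := fun k hk => h1 ⟨k, hk⟩
  have h := created_half_numerator (n := n) (b := layer I t x) (A := id) (dc := 1) (nc := 1)
    (id_spec 1) 1 1 (P := 1) (Q := fun i => (-1) ^ (n - 1 - i) * Polynomial.X)
    (e := fun i => Polynomial.C (-∏ k ∈ Ico (i + 1 : ℕ) n, (layer I t x k).2))
    (by simp) (by simp) (fun i => by rw [toSeries_C, map_neg, one_mul, mul_neg_one])
  have := det_dvd_wedgeSeries hlam.1 (W := 1 * denominator (layer I t x) n 0)
    (by simp [constantCoeff_denominator]) (κ := X) (M := M)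
    (num := fun i => X * toSeries (numerator (fun k => (layer I t x k).1)
      (fun k => (layer I t x k).2) n 1 ((-1) ^ (n - 1 - i : ℕ) * Polynomial.X)
      (Polynomial.C (-∏ k ∈ Ico (i + 1 : ℕ) n, (layer I t x k).2)) i))
    (h.imp fun f i hf => by
      obtain ⟨ρ, hf, hρ⟩ := hf
      refine ⟨X * ρ, fun k => ?_, by rw [mul_left_comm, hρ]⟩
      rw [hf, pow_one, mul_add, map_add, mul_comm X (C _), coeff_C_mul, coeff_X,
        if_neg (hlam2 k), mul_zero, zero_add])
    (fun i => by rw [hM i, map_mul, toSeries_X, mul_assoc])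
  rw [Z_D hI t x tc xc hlam.2 (q := 0), ← hdet', pow_zero]
  · exact this.1
  · rw [card_eq_zero, filter_eq_empty_iff]
    intro k hk
    obtain ⟨j, -, rfl⟩ := mem_image.1 hk
    have := hlam.2 j
    have := hlam2 j
    omega

include hI in
theorem Z_BC_spec {lam : Fin (n + 1) → ℕ} (hlam : IsStrict lam) :
    (∏ j, (1 - tc * t j * xc * (x j : R)) * (1 - t j ^ 2 * (x j : R) ^ 2)) * pairProduct t x ∣
      Z I .BC t x tc xc lam ∧
    (lam = rho (n + 1) → Z I .BC t x tc xc lam =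
      (∏ j, (1 - tc * t j * xc * (x j : R)) * (1 - t j ^ 2 * (x j : R) ^ 2)) *
        pairProduct t x) := by
  obtain ⟨M, hdet, hM⟩ := exists_matrix_BC (fun k => (layer I t x k).1)
    (fun k => (layer I t x k).2) n (I * tc * xc)
  have hdet' : M.det = (∏ j, (1 - tc * t j * xc * (x j : R)) *
      (1 - t j ^ 2 * (x j : R) ^ 2)) * pairProduct t x := by
    rw [hdet, prod_mul_distrib, prod_pairFactor hI]
    congr 1
    refine prod_congr rfl fun i _ => ?_
    rw [layer_fst, mul_comm]
    have e1 : 1 + (I * t i * (x i : R)) ^ 2 = 1 - t i ^ 2 * x i ^ 2 := by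
      linear_combination t i ^ 2 * x i ^ 2 * hI
    have e2 : 1 + I * tc * xc * (I * t i * (x i : R)) = 1 - tc * t i * xc * x i := by
      linear_combination tc * t i * xc * x i * hI
    rw [e1, e2]
  have h := created_full (n := n) (b := layer I t x) (G := [X ^ 1 * geometric (I * tc * xc)])
    (rowSeries_spec (I * tc * xc)) (by simp) 1 1
    (fun i => if i < n then bracket (fstC (layer I t x)) (sndC (layer I t x)) n X
      (C 1 * (X + C (I * tc * xc)))
      (C (1 * (-1) ^ (n - 1 - i + 1)) * (1 - C (I * tc * xc) * X)) i else 1)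
    (fun i hi => if_pos hi) (by simp) (by
      refine List.Forall₂.cons ?_ List.Forall₂.nil
      beta_reduce
      rw [if_neg (lt_irrefl n)]
      linear_combination X ^ 1 * one_sub_mul_geometric (I * tc * xc)) n 0 (zero_add n)
  rw [List.forall₂_map_right_iff] at h
  have := det_dvd_wedgeSeries hlam.1 (κ := 1) (M := M)
    (W := (1 - C (I * tc * xc) * X) * denominator (layer I t x) n 0)
    (by simp [constantCoeff_denominator])
    (h.imp fun f i hf => ⟨f, fun _ => rfl, hf⟩)
    (fun i => by
      rw [← hM i, pow_one, mul_one]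
      congr 1
      split_ifs with hi
      · rw [toSeries_numerator, map_zero, zero_mul, add_zero]
        congr 2 <;> simp
      · rw [map_hProd, mul_one, toSeries_X]
        simp only [toSeries_C]
        rfl)
  rw [Z_BC hI t x tc xc hlam.2, ← hdet']
  exact ⟨this.1, fun h => this.2 h (by simp)⟩

end Families

/-! ### The family `𝔇` with `1 ∈ λ` -/

section HalfColumn

variable {R : Type*} [CommRing R] {I : R} (hI : I ^ 2 = -1) {n : ℕ} (t : Fin (n + 1) → R)
  (x : Fin (n + 1) → Rˣ) (tc xc : R)

include hI in
/-- If `1` is a part of `λ`, the constant terms of the created vectors contribute to the last column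
of the coefficient matrix. -/
theorem Z_D_spec {lam : Fin (n + 1) → ℕ} (hlam : IsStrict lam) (h1 : ∃ j, lam j = 1) :
    pairProduct t x ∣ Z I .D t x tc xc lam ∧
    (lam = rho (n + 1) → Z I .D t x tc xc lam = pairProduct t x) := by
  obtain ⟨M, hdet, hlast, hM⟩ := exists_matrix_D (fun k => (layer I t x k).1)
    (fun k => (layer I t x k).2) n
  rw [prod_pairFactor hI] at hdet
  have hq : #((univ.image lam).filter (· < 2)) = 1 := by
    obtain ⟨j, hj⟩ := h1
    rw [card_eq_one]
    refine ⟨1, ?_⟩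
    ext k
    simp only [mem_filter, mem_image, mem_univ, true_and, mem_singleton]
    constructor
    · rintro ⟨⟨a, rfl⟩, ha⟩
      have := hlam.2 a
      omega
    · rintro rfl
      exact ⟨⟨j, hj⟩, by omega⟩
  rw [Z_D hI t x tc xc hlam.2 hq]
  have h := created_half (n := n + 1) (b := layer I t x) (A := id) (dc := 1) (nc := 1)
    (id_spec 1) 1 ((-1) ^ 1) (n + 1) 0 (zero_add _)
  obtain ⟨f, hf, hZ⟩ := wedgeSeries_eq_det hlam.1 h
  obtain ⟨U, hU, hU₁⟩ := exists_mul_eq_one (constantCoeff_denominator (b := layer I t x)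
    (n := n + 1) 0)
  set b := layer I t x with hb
  set T := ∏ k ∈ range (n + 1), (b k).1 with hT
  -- the coefficient `M i (last n)` of the last form multiplies the constant term as well
  set E : Fin (n + 1) → R⟦X⟧ := fun l => X * ((1 + X ^ 2) * (if l = Fin.last n then C T else 1) *
    ((1 - X ^ 2) ^ (l : ℕ) * X ^ (n + 1 - 1 - l)) * U +
      if l = Fin.last n then 1 - hProd (fstC b) X 0 (n + 1) * U else 0) with hE
  have hnum : ∀ i : Fin (n + 1), hProd (fstC b) X 0 i *
      bracket (fstC b) (sndC b) (n + 1) X (C 1 * 1)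
        (C ((-1) ^ 1 * (-1) ^ (n + 1 - 1 - i : ℕ)) * X * 1) i =
      ∑ l, C (M i l) * ((1 + X ^ 2) * (if l = Fin.last n then C T else 1) *
        ((1 - X ^ 2) ^ (l : ℕ) * X ^ (n + 1 - 1 - l))) := by
    intro i
    have := congrArg toSeries (hM i)
    rw [toSeries_numerator, map_zero, zero_mul, add_zero,
      map_mul toSeries (1 + _), toSeries_formRow, mul_sum] at this
    convert this using 1
    · congr 2 <;> simp
    · refine sum_congr rfl fun l _ => ?_
      rw [map_add, map_pow, map_one, toSeries_X]
      rcases eq_or_ne l (Fin.last n) with rfl | hl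
      · rw [if_pos rfl, Matrix.updateCol_self, Pi.smul_apply, smul_eq_mul, map_mul, Matrix.col_apply]
        ring
      · rw [if_neg hl, Matrix.updateCol_ne hl]
        ring
  have hfact := det_coeff_eq lam f E M fun i k => by
    congr 1
    obtain ⟨ρ, h2, -, h3⟩ := hf i
    have e : ρ = (∑ l, C (M i l) * ((1 + X ^ 2) * (if l = Fin.last n then C T else 1) *
        ((1 - X ^ 2) ^ (l : ℕ) * X ^ (n + 1 - 1 - l))) -
          C (M i (Fin.last n)) * hProd (fstC b) X 0 (n + 1)) * U := by
      calc ρ = 1 * denominator b (n + 1) 0 * ρ * U := by rw [one_mul, mul_right_comm, hU, one_mul]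
        _ = _ := by
          rw [h3, hnum i, hlast i, one_mul]
          ring
    have e2 : ∑ l, C (M i l) * E l = X * ((∑ l, C (M i l) * ((1 + X ^ 2) *
        (if l = Fin.last n then C T else 1) * ((1 - X ^ 2) ^ (l : ℕ) * X ^ (n + 1 - 1 - l)))) * U +
          C (M i (Fin.last n)) * (1 - hProd (fstC b) X 0 (n + 1) * U)) := by
      simp only [hE, mul_add, mul_ite, mul_zero, sum_add_distrib, sum_ite_eq', mem_univ, if_true,
        sum_mul, mul_sum]
      congr 1
      · refine sum_congr rfl fun l _ => ?_
        split_ifs <;> ring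
      · ring
    rw [h2, e2, e, hlast i, pow_one, one_mul, one_mul]
    ring
  rw [hZ, hfact, hdet]
  refine ⟨dvd_mul_right _ _, fun hl => ?_⟩
  subst hl
  rw [det_coeff_rho, mul_one]
  intro l
  rcases eq_or_ne l (Fin.last n) with rfl | hl
  · refine ⟨(1 + X ^ 2) * C T * (1 - X ^ 2) ^ n * U + (1 - hProd (fstC b) X 0 (n + 1) * U), ?_, ?_⟩
    · simp only [hE, if_true, Fin.val_last, Nat.add_sub_cancel_left, Nat.add_sub_cancel, Nat.sub_self,
        pow_one, pow_zero, mul_one]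
    · have : constantCoeff (hProd (fstC b) X 0 (n + 1)) = T := by
        rw [map_hProd, constantCoeff_X, hProd_zero, hT]
        exact prod_congr rfl fun k _ => constantCoeff_C _
      simp [this, hU₁]
  · have hl' : (l : ℕ) < n := Fin.val_lt_last hl
    refine ⟨(1 + X ^ 2) * (1 - X ^ 2) ^ (l : ℕ) * U, ?_, by simp [hU₁]⟩
    simp only [hE, if_neg hl]
    rw [show n + 1 - (l : ℕ) = n + 1 - 1 - l + 1 by omega, pow_succ]
    ring

end HalfColumn

lemma Z_D_zero {R : Type*} [CommRing R] {I : R} (hI : I ^ 2 = -1) (t : Fin 0 → R)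
    (x : Fin 0 → Rˣ) (tc xc : R) (lam : Fin 0 → ℕ) : Z I .D t x tc xc lam = 1 := by
  rw [Z_D hI t x tc xc (fun j => j.elim0) (q := 0) (by simp)]
  obtain ⟨f, -, hZ⟩ := wedgeSeries_eq_det (lam := lam) (fun i => i.elim0)
    (l := created 2 1 1 ((-1) ^ 0) id [] ((List.range' 0 0).map (layer I t x)))
    (r := fun _ _ => True) List.Forall₂.nil
  rw [hZ, Matrix.det_isEmpty]

lemma isStrict_rho (p : ℕ) : IsStrict (rho p) :=
  ⟨fun i j h => by have : (i : ℕ) < j := h; have := j.2; simp only [rho]; omega,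
    fun j => by have := j.2; simp only [rho]; omega⟩

end BentIce

theorem mainTheorem3 {R : Type*} [CommRing R] (I : R) (hI : I ^ 2 = -1)
    (n : ℕ) (t : Fin n → R) (x : Fin n → Rˣ) (tc xc : R) :
    -- the families with `n` bends and `n` parts; `tc`, `xc` are `t₀`, `x₀`
    (∀ lam : Fin n → ℕ, BentIce.IsStrict lam →
      ((∏ j, (1 - t j * (x j : R))) * BentIce.pairProduct t x ∣
        BentIce.Z I .B t x tc xc lam) ∧
      ((∏ j, (1 - tc * t j * xc * (x j : R))) * BentIce.pairProduct t x ∣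
        BentIce.Z I .Bstar t x tc xc lam) ∧
      ((∏ j, (1 - t j * (x j : R)) * (1 - t j * tc * xc * (x j : R))) *
          BentIce.pairProduct t x ∣
        BentIce.Z I .C t x tc xc lam) ∧
      ((∏ j, (1 - t j ^ 2 * (x j : R) ^ 2)) * BentIce.pairProduct t x ∣
        BentIce.Z I .Cstar t x tc xc lam) ∧
      ((∃ j, lam j = 1) →
        BentIce.pairProduct t x ∣ BentIce.Z I .D t x tc xc lam) ∧
      ((¬ ∃ j, lam j = 1) →
        (∏ j, (1 - t j ^ 2 * (x j : R) ^ 2)) * BentIce.pairProduct t x ∣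
          BentIce.Z I .D t x tc xc lam)) ∧
    -- the family with `n` bends and `n + 1` parts; `tc`, `xc` belong to the last spectral index
    (∀ lam : Fin (n + 1) → ℕ, BentIce.IsStrict lam →
      (∏ j, (1 - tc * t j * xc * (x j : R)) * (1 - t j ^ 2 * (x j : R) ^ 2)) *
          BentIce.pairProduct t x ∣
        BentIce.Z I .BC t x tc xc lam) ∧
    -- equality for `ρ`
    (BentIce.Z I .B t x tc xc (BentIce.rho n) =
      (∏ j, (1 - t j * (x j : R))) * BentIce.pairProduct t x ∧
    BentIce.Z I .Bstar t x tc xc (BentIce.rho n) =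
      (∏ j, (1 - tc * t j * xc * (x j : R))) * BentIce.pairProduct t x ∧
    BentIce.Z I .C t x tc xc (BentIce.rho n) =
      (∏ j, (1 - t j * (x j : R)) * (1 - t j * tc * xc * (x j : R))) *
        BentIce.pairProduct t x ∧
    BentIce.Z I .Cstar t x tc xc (BentIce.rho n) =
      (∏ j, (1 - t j ^ 2 * (x j : R) ^ 2)) * BentIce.pairProduct t x ∧
    BentIce.Z I .D t x tc xc (BentIce.rho n) = BentIce.pairProduct t x ∧
    BentIce.Z I .BC t x tc xc (BentIce.rho (n + 1)) =
      (∏ j, (1 - tc * t j * xc * (x j : R)) * (1 - t j ^ 2 * (x j : R) ^ 2)) *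
        BentIce.pairProduct t x) := by
  refine ⟨fun lam hlam => ⟨(BentIce.Z_B_spec hI t x tc xc hlam).1,
    (BentIce.Z_Bstar_spec hI t x tc xc hlam).1, (BentIce.Z_C_spec hI t x tc xc hlam).1,
    (BentIce.Z_Cstar_spec hI t x tc xc hlam).1, fun h1 => ?_,
    BentIce.Z_D_dvd_of_one_notMem hI t x tc xc hlam⟩,
    fun lam hlam => (BentIce.Z_BC_spec hI t x tc xc hlam).1,
    (BentIce.Z_B_spec hI t x tc xc (BentIce.isStrict_rho n)).2 rfl,
    (BentIce.Z_Bstar_spec hI t x tc xc (BentIce.isStrict_rho n)).2 rfl,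
    (BentIce.Z_C_spec hI t x tc xc (BentIce.isStrict_rho n)).2 rfl,
    (BentIce.Z_Cstar_spec hI t x tc xc (BentIce.isStrict_rho n)).2 rfl, ?_,
    (BentIce.Z_BC_spec hI t x tc xc (BentIce.isStrict_rho (n + 1))).2 rfl⟩
  · cases n with
    | zero => exact h1.choose.elim0
    | succ n => exact (BentIce.Z_D_spec hI t x tc xc hlam h1).1
  · cases n with
    | zero => simp [BentIce.Z_D_zero hI, BentIce.pairProduct]
    | succ n =>
      exact (BentIce.Z_D_spec hI t x tc xc (BentIce.isStrict_rho (n + 1))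
        ⟨Fin.last n, by simp [BentIce.rho]⟩).2 rfl
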